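/- Let $n\in\mathbb N$ and let $\alpha,\beta$ be real numbers with $\alpha>0$, $\max\{1/2,\alpha\}<\beta<1$, $\alpha+\beta-1\ge 0$ and $d:=n-2(\alpha+\beta-1)>0$ (the last condition is automatic when $n\ge 2$). Functions are complex valued, defined on $\mathbb R^{1+n}_+=\{(t,x):t>0,\ x\in\mathbb R^n\}$, measurable, and identified when equal almost everywhere. For $E\subset\mathbb R^n$ let $T(E)=\{(t,x)\in\mathbb R^{1+n}_+: B(x,t)\subset E\}$ and $$\Lambda_d^{(\infty)}(E)=\inf\Big\{\sum_j r_j^d: E\subset\bigcup_j B(x_j,r_j)\Big\}$$ (infimum over countable families of balls), and put $\int_{\mathbb R^n} h\,d\Lambda_d^{(\infty)}=\int_0^\infty\Lambda_d^{(\infty)}(\{h>\lambda\})\,d\lambda$ for $h:\mathbb R^n\to[0,\infty]$. For $\omega\ge 0$ on $\mathbb R^{1+n}_+$ let $N\omega(x)=\sup_{|y-x|<t}\omega(t,y)$. The space $T^1_{\alpha,\beta}$ consists of all $f$ with $$\|f\|_{T^1_{\alpha,\beta}}=\inf_\omega\Big(\int_{\mathbb R^{1+n}_+}|f(t,x)|^2\omega^{-1}(t,x)\frac{dt\,dx}{t^{1-2(\alpha-\beta+1)}}\Big)^{1/2}<\infty,$$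 the infimum being over nonnegative Borel functions $\omega$ on $\mathbb R^{1+n}_+$ with $\int_{\mathbb R^n} N\omega\,d\Lambda^{(\infty)}_{d}\le 1$ that vanish (up to a null set) only where $f$ vanishes. The space $T^\infty_{\alpha,\beta}$ consists of all $g$ with $$\|g\|_{T^\infty_{\alpha,\beta}}=\sup_{B}\Big(\frac1{|B|^{1-2(\alpha+\beta-1)/n}}\int_{T(B)}|g(t,y)|^2\frac{dt\,dy}{t^{1+2(\alpha-\beta+1)}}\Big)^{1/2}<\infty,$$ the supremum being over all balls $B\subset\mathbb R^n$. A $T^1_{\alpha,\beta}$-atom is a measurable function $a$ supported in $T(B)$ for some ball $B$ with $$\int_{T(B)}|a(t,y)|^2\frac{dt\,dy}{t^{1-2(\alpha-\beta+1)}}\le\frac{1}{|B|^{1-2(\alpha+\beta-1)/n}}.$$ Then, with constants depending only on $n,\alpha,\beta$: (i) If $a_j$ are $T^1_{\alpha,\beta}$-atoms and $\sum_j|\lambda_j|<\infty$, then $\sum_j\lambda_ja_j$ converges almost everywhere, and in the quasi-norm $\|\cdot\|_{T^1_{\alpha,\beta}}$, to an element of $T^1_{\alpha,\beta}$. A measurable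 function $f$ belongs to $T^1_{\alpha,\beta}$ if and only if $f=\sum_j\lambda_ja_j$ almost everywhere for some sequence of $T^1_{\alpha,\beta}$-atoms $a_j$ and some $\ell^1$-sequence $(\lambda_j)$. Moreover, for $f\in T^1_{\alpha,\beta}$, $$\|f\|_{T^1_{\alpha,\beta}}\approx |||f|||:=\inf\Big\{\sum_j|\lambda_j|: f=\sum_j\lambda_ja_j\Big\},$$ the infimum being over all such decompositions of $f$; $|||\cdot|||$ is a norm on $T^1_{\alpha,\beta}$, which makes it a Banach space. (ii) There is a constant $C$ such that for all $f\in T^1_{\alpha,\beta}$ and $g\in T^\infty_{\alpha,\beta}$ $$\int_{\mathbb R^{1+n}_+}|f(t,y)g(t,y)|\frac{dt\,dy}{t}\le C\|f\|_{T^1_{\alpha,\beta}}\|g\|_{T^\infty_{\alpha,\beta}}.$$ (iii) The map sending $g$ to the functional $f\mapsto\langle f,g\rangle=\int_{\mathbb R^{1+n}_+}f(t,y)g(t,y)\frac{dt\,dy}{t}$ is a linear bijection of $T^\infty_{\alpha,\beta}$ onto the Banach space dual of $(T^1_{\alpha,\beta},|||\cdot|||)$, and the norm of this functional is equivalent to $\|g\|_{T^\infty_{\alpha,\beta}}$.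 -/

import Mathlib

open MeasureTheory Set Filter Topology
open scoped NNReal ENNReal

/-- The ambient space `ℝ × ℝⁿ` with points `(t, x)`. Functions on the upper half-space
`{(t, x) : t > 0}` are represented by functions on `ℝ × ℝⁿ`, whose values at `t ≤ 0` never matter. -/
abbrev TX (n : ℕ) : Type := ℝ × EuclideanSpace ℝ (Fin n)

/-- Lebesgue measure `dt dx` on the upper half-space `{(t, x) : t > 0}`. -/
noncomputable def halfMeasure (n : ℕ) : Measure (TX n) :=
  volume.restrict {p | 0 < p.1}

/-- The tent `T(A) = {(t, x) : t > 0, B(x, t) ⊆ A}` over a set `A ⊆ ℝⁿ`. -/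
def tent {n : ℕ} (A : Set (EuclideanSpace ℝ (Fin n))) : Set (TX n) :=
  {p | 0 < p.1 ∧ Metric.ball p.2 p.1 ⊆ A}

/-- The `d`-dimensional Hausdorff capacity: the infimum of `∑ r_j ^ d` over all countable
families of balls `B(x_j, r_j)` that cover `A`. -/
noncomputable def hausdorffCapacity {n : ℕ} (d : ℝ) (A : Set (EuclideanSpace ℝ (Fin n))) :
    ℝ≥0∞ :=
  ⨅ (S : Set (EuclideanSpace ℝ (Fin n) × ℝ)) (_ : S.Countable) (_ : ∀ b ∈ S, 0 < b.2)
    (_ : A ⊆ ⋃ b ∈ S, Metric.ball b.1 b.2), ∑' b : S, ENNReal.ofReal (b.1.2 ^ d)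

/-- The integral `∫_0^∞ Λ_d({f > s}) ds` of `f : ℝⁿ → [0, ∞]` against the Hausdorff capacity. -/
noncomputable def capacityIntegral {n : ℕ} (d : ℝ) (f : EuclideanSpace ℝ (Fin n) → ℝ≥0∞) :
    ℝ≥0∞ :=
  ∫⁻ s in Ioi (0 : ℝ), hausdorffCapacity d {x | ENNReal.ofReal s < f x}

/-- The nontangential maximal function `Nω(x) = sup {ω(t, y) : |y - x| < t}`. -/
noncomputable def nontangentialMax {n : ℕ} (ω : TX n → ℝ≥0) (x : EuclideanSpace ℝ (Fin n)) :
    ℝ≥0∞ :=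
  ⨆ (p : TX n) (_ : dist p.2 x < p.1), (ω p : ℝ≥0∞)

/-- The (quasi-)norm of `T¹_{α,β}`. In `‖f‖² / ω` the conventions are `0 / 0 = 0` and
`a / 0 = ∞` for `a > 0`. -/
noncomputable def tentOneNorm (n : ℕ) (α β : ℝ) (f : TX n → ℂ) : ℝ≥0∞ :=
  ⨅ (ω : TX n → ℝ≥0) (_ : Measurable ω)
    (_ : capacityIntegral (n - 2 * (α + β - 1)) (nontangentialMax ω) ≤ 1)
    (_ : ∀ᵐ p ∂(halfMeasure n), ω p = 0 → f p = 0),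
    (∫⁻ p, ‖f p‖ₑ ^ 2 / (ω p : ℝ≥0∞) / ENNReal.ofReal (p.1 ^ (1 - 2 * (α - β + 1)))
      ∂(halfMeasure n)) ^ (1 / 2 : ℝ)

/-- The norm of `T^∞_{α,β}`; the supremum runs over all balls `B(x, r)` of `ℝⁿ`. -/
noncomputable def tentInftyNorm (n : ℕ) (α β : ℝ) (g : TX n → ℂ) : ℝ≥0∞ :=
  ⨆ (x : EuclideanSpace ℝ (Fin n)) (r : ℝ) (_ : 0 < r),
    ((∫⁻ p in tent (Metric.ball x r),
        ‖g p‖ₑ ^ 2 / ENNReal.ofReal (p.1 ^ (1 + 2 * (α - β + 1))))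
      / volume (Metric.ball x r) ^ (1 - 2 * (α + β - 1) / n)) ^ (1 / 2 : ℝ)

/-- `T¹_{α,β}`-atoms. -/
def IsTentAtom (n : ℕ) (α β : ℝ) (a : TX n → ℂ) : Prop :=
  AEStronglyMeasurable a (halfMeasure n) ∧
  ∃ (x : EuclideanSpace ℝ (Fin n)) (r : ℝ), 0 < r ∧
    (∀ᵐ p ∂(halfMeasure n), p ∉ tent (Metric.ball x r) → a p = 0) ∧
    ∫⁻ p in tent (Metric.ball x r),
        ‖a p‖ₑ ^ 2 / ENNReal.ofReal (p.1 ^ (1 - 2 * (α - β + 1)))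
      ≤ 1 / volume (Metric.ball x r) ^ (1 - 2 * (α + β - 1) / n)

/-- `f = ∑ c_j a_j` almost everywhere, with `(c_j)` in `ℓ¹` and `T¹_{α,β}`-atoms `a_j`. -/
structure IsAtomicDecomposition (n : ℕ) (α β : ℝ) (f : TX n → ℂ) (c : ℕ → ℂ)
    (a : ℕ → TX n → ℂ) : Prop where
  summable : Summable fun j => ‖c j‖
  atom : ∀ j, IsTentAtom n α β (a j)
  hasSum : ∀ᵐ p ∂(halfMeasure n), HasSum (fun j => c j * a j p) (f p)

/-- The infimum of `∑ |c_j|` over all atomic decompositions of `f` (`∞` if there is none). -/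
noncomputable def atomicNorm (n : ℕ) (α β : ℝ) (f : TX n → ℂ) : ℝ≥0∞ :=
  ⨅ (c : ℕ → ℂ) (a : ℕ → TX n → ℂ) (_ : IsAtomicDecomposition n α β f c a), ∑' j, ‖c j‖ₑ

theorem hausdorffCapacity_union_le {n : ℕ} (d : ℝ) (A B : Set (EuclideanSpace ℝ (Fin n))) :
    hausdorffCapacity d (A ∪ B) ≤ hausdorffCapacity d A + hausdorffCapacity d B := by
  simp only [hausdorffCapacity, ENNReal.iInf_add, ENNReal.add_iInf]
  refine le_iInf fun T => le_iInf fun hT => le_iInf fun hT' => le_iInf fun hTB => ?_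
  refine le_iInf fun S => le_iInf fun hS => le_iInf fun hS' => le_iInf fun hSA => ?_
  have hpos : ∀ b ∈ S ∪ T, 0 < b.2 := fun b hb => hb.elim (hS' b) (hT' b)
  have hcov : A ∪ B ⊆ ⋃ b ∈ S ∪ T, Metric.ball b.1 b.2 := by
    rw [biUnion_union]
    exact union_subset_union hSA hTB
  exact (iInf₂_le_of_le (S ∪ T) (hS.union hT) <| iInf₂_le_of_le hpos hcov le_rfl).trans
    (ENNReal.tsum_union_le (fun b => ENNReal.ofReal (b.2 ^ d)) S T)

theorem hausdorffCapacity_mono {n : ℕ} (d : ℝ) {A B : Set (EuclideanSpace ℝ (Fin n))}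
    (h : A ⊆ B) : hausdorffCapacity d A ≤ hausdorffCapacity d B :=
  iInf_mono fun _ => iInf_mono fun _ => iInf_mono fun _ => iInf_mono' fun h' => ⟨h.trans h', le_rfl⟩

theorem hausdorffCapacity_empty {n : ℕ} (d : ℝ) :
    hausdorffCapacity d (∅ : Set (EuclideanSpace ℝ (Fin n))) = 0 := by
  refine le_antisymm ?_ zero_le
  refine iInf_le_of_le ∅ <| iInf_le_of_le countable_empty <| iInf_le_of_le (by simp) <|
    iInf_le_of_le (by simp) ?_
  simp

theorem capacityIntegral_sup_half {n : ℕ} (d : ℝ) (ω₁ ω₂ : TX n → ℝ≥0)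
    (h₁ : capacityIntegral d (nontangentialMax ω₁) ≤ 1)
    (h₂ : capacityIntegral d (nontangentialMax ω₂) ≤ 1) :
    capacityIntegral d (nontangentialMax fun p => max (ω₁ p) (ω₂ p) / 2) ≤ 1 := by
  set F : (TX n → ℝ≥0) → ℝ → ℝ≥0∞ := fun ω s =>
    hausdorffCapacity d {x | ENNReal.ofReal s < nontangentialMax ω x} with hF
  have hanti : ∀ ω, Antitone (F ω) := fun ω s t hst =>
    hausdorffCapacity_mono d fun x hx => (ENNReal.ofReal_le_ofReal hst).trans_lt hx
  have hscale : ∀ ω, ∫⁻ s in Ioi (0 : ℝ), F ω (2 * s) = 2⁻¹ * ∫⁻ s in Ioi (0 : ℝ), F ω s := by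
    intro ω
    have hm : Measurable ((Ioi (0 : ℝ)).indicator (F ω)) :=
      (hanti ω).measurable.indicator measurableSet_Ioi
    have e : (Ioi (0 : ℝ)).indicator (fun s => F ω (2 * s))
        = fun s => (Ioi (0 : ℝ)).indicator (F ω) (2 * s) := by
      ext s
      simp [indicator]
    rw [← lintegral_indicator measurableSet_Ioi, ← lintegral_indicator measurableSet_Ioi, e,
      ← lintegral_map hm (measurable_const_mul (2 : ℝ)),
      Real.map_volume_mul_left (two_ne_zero), lintegral_smul_measure]
    simp [ENNReal.ofReal_inv_of_pos]
  have hle : ∀ s ∈ Ioi (0 : ℝ), F (fun p => max (ω₁ p) (ω₂ p) / 2) s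
      ≤ F ω₁ (2 * s) + F ω₂ (2 * s) := by
    intro s hs
    refine (hausdorffCapacity_mono d ?_).trans (hausdorffCapacity_union_le d _ _)
    intro x hx
    simp only [mem_ofPred_eq, nontangentialMax, lt_iSup_iff] at hx
    obtain ⟨p, hp, h⟩ := hx
    have h' : ENNReal.ofReal (2 * s) < ((max (ω₁ p) (ω₂ p) : ℝ≥0) : ℝ≥0∞) := by
      rw [ENNReal.ofReal, ENNReal.coe_lt_coe] at h ⊢
      rw [Real.toNNReal_mul zero_le_two]
      rw [lt_div_iff₀ two_pos] at h
      simpa [mul_comm] using h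
    rcases max_cases (ω₁ p) (ω₂ p) with ⟨e, -⟩ | ⟨e, -⟩ <;> rw [e] at h'
    · exact Or.inl (h'.trans_le (le_iSup₂_of_le p hp le_rfl))
    · exact Or.inr (h'.trans_le (le_iSup₂_of_le p hp le_rfl))
  calc capacityIntegral d (nontangentialMax fun p => max (ω₁ p) (ω₂ p) / 2)
      ≤ ∫⁻ s in Ioi (0 : ℝ), (F ω₁ (2 * s) + F ω₂ (2 * s)) :=
        setLIntegral_mono' measurableSet_Ioi hle
    _ = 2⁻¹ * (∫⁻ s in Ioi (0 : ℝ), F ω₁ s) + 2⁻¹ * ∫⁻ s in Ioi (0 : ℝ), F ω₂ s := by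
        have hm : Measurable fun s => F ω₁ (2 * s) :=
          (hanti ω₁).measurable.comp (measurable_const_mul (2 : ℝ))
        rw [lintegral_add_left hm, hscale, hscale]
    _ ≤ 2⁻¹ * 1 + 2⁻¹ * 1 := by gcongr <;> assumption
    _ = 1 := by simp [ENNReal.inv_two_add_inv_two]

theorem tentOneNorm_lt_top_iff {n : ℕ} {α β : ℝ} {f : TX n → ℂ} :
    tentOneNorm n α β f < ∞ ↔ ∃ ω : TX n → ℝ≥0, Measurable ω ∧
      capacityIntegral (n - 2 * (α + β - 1)) (nontangentialMax ω) ≤ 1 ∧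
      (∀ᵐ p ∂(halfMeasure n), ω p = 0 → f p = 0) ∧
      ∫⁻ p, ‖f p‖ₑ ^ 2 / (ω p : ℝ≥0∞) / ENNReal.ofReal (p.1 ^ (1 - 2 * (α - β + 1)))
        ∂(halfMeasure n) < ∞ := by
  simp only [tentOneNorm, iInf_lt_iff, exists_prop,
    ENNReal.rpow_lt_top_iff_of_pos (show (0 : ℝ) < 1 / 2 by norm_num)]

theorem enorm_add_sq_le (a b : ℂ) : ‖a + b‖ₑ ^ 2 ≤ 2 * ‖a‖ₑ ^ 2 + 2 * ‖b‖ₑ ^ 2 := by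
  have h : ‖a + b‖ ^ 2 ≤ 2 * ‖a‖ ^ 2 + 2 * ‖b‖ ^ 2 := by
    nlinarith [norm_add_le a b, norm_nonneg (a + b), sq_nonneg (‖a‖ - ‖b‖)]
  have h' : ‖a + b‖₊ ^ 2 ≤ 2 * ‖a‖₊ ^ 2 + 2 * ‖b‖₊ ^ 2 := by exact_mod_cast h
  simp only [enorm_eq_nnnorm]
  exact_mod_cast h'

/-- The space `T¹_{α,β}` of (classes of) measurable functions with `‖f‖_{T¹_{α,β}} < ∞`. -/
noncomputable def TentOne (n : ℕ) (α β : ℝ) : Submodule ℂ (TX n →ₘ[halfMeasure n] ℂ) where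
  carrier := {f | tentOneNorm n α β f < ∞}
  zero_mem' := by
    have h0 : (⇑(0 : TX n →ₘ[halfMeasure n] ℂ)) =ᵐ[halfMeasure n] 0 := AEEqFun.coeFn_zero
    refine tentOneNorm_lt_top_iff.2 ⟨0, measurable_zero, ?_, h0.mono fun p hp _ => hp, ?_⟩
    · simp [capacityIntegral, nontangentialMax, hausdorffCapacity_empty]
    · refine lt_of_eq_of_lt (lintegral_congr_ae (g := fun _ => 0) (h0.mono fun p hp => ?_))
        (by simp)
      simp [hp]
  add_mem' := by
    intro f g hf hg
    obtain ⟨ω₁, hm₁, hc₁, hz₁, hi₁⟩ := tentOneNorm_lt_top_iff.1 hf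
    obtain ⟨ω₂, hm₂, hc₂, hz₂, hi₂⟩ := tentOneNorm_lt_top_iff.1 hg
    have hadd := AEEqFun.coeFn_add f g
    refine tentOneNorm_lt_top_iff.2 ⟨fun p => max (ω₁ p) (ω₂ p) / 2,
      (hm₁.max hm₂).div_const 2, capacityIntegral_sup_half _ _ _ hc₁ hc₂, ?_, ?_⟩
    · filter_upwards [hadd, hz₁, hz₂] with p hp h₁ h₂ h
      have h' : ω₁ p = 0 ∧ ω₂ p = 0 := by simpa using h
      simp [hp, h₁ h'.1, h₂ h'.2]
    · set W : TX n → ℝ≥0∞ := fun p => ENNReal.ofReal (p.1 ^ (1 - 2 * (α - β + 1))) with hW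
      have hWm : Measurable W := by fun_prop
      have key : ∀ᵐ p ∂(halfMeasure n),
          ‖(f + g) p‖ₑ ^ 2 / ((max (ω₁ p) (ω₂ p) / 2 : ℝ≥0) : ℝ≥0∞) / W p
            ≤ 4 * (‖f p‖ₑ ^ 2 / (ω₁ p : ℝ≥0∞) / W p) + 4 * (‖g p‖ₑ ^ 2 / (ω₂ p : ℝ≥0∞) / W p) := by
        filter_upwards [hadd] with p hp
        have hdiv : ∀ (x : ℝ≥0∞) (w : ℝ≥0), w ≤ max (ω₁ p) (ω₂ p) →
            2 * x / ((max (ω₁ p) (ω₂ p) / 2 : ℝ≥0) : ℝ≥0∞) ≤ 4 * (x / w) := by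
          intro x w hw
          have hw' : ((w / 2 : ℝ≥0) : ℝ≥0∞) ≤ ((max (ω₁ p) (ω₂ p) / 2 : ℝ≥0) : ℝ≥0∞) := by
            gcongr
          refine (ENNReal.div_le_div_left hw' _).trans (le_of_eq ?_)
          rw [ENNReal.coe_div two_ne_zero, ENNReal.coe_ofNat, div_eq_mul_inv, div_eq_mul_inv,
            div_eq_mul_inv, ENNReal.mul_inv (by simp) (by simp), inv_inv,
            show (4 : ℝ≥0∞) = 2 * 2 by norm_num]
          ring
        calc ‖(f + g) p‖ₑ ^ 2 / ((max (ω₁ p) (ω₂ p) / 2 : ℝ≥0) : ℝ≥0∞) / W p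
            ≤ (2 * ‖f p‖ₑ ^ 2 + 2 * ‖g p‖ₑ ^ 2)
                / ((max (ω₁ p) (ω₂ p) / 2 : ℝ≥0) : ℝ≥0∞) / W p := by
              rw [hp]
              gcongr
              exact enorm_add_sq_le _ _
          _ ≤ (4 * (‖f p‖ₑ ^ 2 / (ω₁ p : ℝ≥0∞)) + 4 * (‖g p‖ₑ ^ 2 / (ω₂ p : ℝ≥0∞))) / W p := by
              rw [ENNReal.add_div]
              gcongr
              · exact hdiv _ _ (le_max_left _ _)
              · exact hdiv _ _ (le_max_right _ _)
          _ = _ := by rw [ENNReal.add_div, mul_div_assoc, mul_div_assoc]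
      refine (lintegral_mono_ae key).trans_lt ?_
      have hf' : AEMeasurable (fun p => 4 * (‖f p‖ₑ ^ 2 / (ω₁ p : ℝ≥0∞) / W p))
          (halfMeasure n) :=
        (((f.aemeasurable.enorm.pow_const 2).div hm₁.coe_nnreal_ennreal.aemeasurable).div
          hWm.aemeasurable).const_mul 4
      rw [lintegral_add_left' hf', lintegral_const_mul' _ _ (by simp),
        lintegral_const_mul' _ _ (by simp)]
      exact ENNReal.add_lt_top.2 ⟨ENNReal.mul_lt_top (by simp) hi₁,
        ENNReal.mul_lt_top (by simp) hi₂⟩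
  smul_mem' := by
    intro c f hf
    obtain ⟨ω, hm, hc, hz, hi⟩ := tentOneNorm_lt_top_iff.1 hf
    have hs := AEEqFun.coeFn_smul c f
    refine tentOneNorm_lt_top_iff.2 ⟨ω, hm, hc, ?_, ?_⟩
    · filter_upwards [hs, hz] with p hp h h'
      simp [hp, h h']
    · have key : ∀ᵐ p ∂(halfMeasure n), ‖(c • f) p‖ₑ ^ 2 / (ω p : ℝ≥0∞)
            / ENNReal.ofReal (p.1 ^ (1 - 2 * (α - β + 1)))
          = ‖c‖ₑ ^ 2 * (‖f p‖ₑ ^ 2 / (ω p : ℝ≥0∞)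
            / ENNReal.ofReal (p.1 ^ (1 - 2 * (α - β + 1)))) := by
        filter_upwards [hs] with p hp
        rw [hp, Pi.smul_apply, smul_eq_mul, enorm_mul, mul_pow, mul_div_assoc, mul_div_assoc]
      rw [lintegral_congr_ae key, lintegral_const_mul' _ _ (by simp)]
      exact ENNReal.mul_lt_top (by simp) hi

theorem tentInftyNorm_zero (n : ℕ) (α β : ℝ) : tentInftyNorm n α β 0 = 0 := by
  simp [tentInftyNorm]

theorem tentInftyNorm_le_of_ae {n : ℕ} {α β : ℝ} {f g h : TX n → ℂ} (A B : ℝ≥0)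
    (hf : AEStronglyMeasurable f (halfMeasure n))
    (hfg : ∀ᵐ p ∂(halfMeasure n), ‖h p‖ₑ ^ 2 ≤ A * ‖f p‖ₑ ^ 2 + B * ‖g p‖ₑ ^ 2) :
    tentInftyNorm n α β h ≤
      (A * tentInftyNorm n α β f ^ (2 : ℝ) + B * tentInftyNorm n α β g ^ (2 : ℝ)) ^
        (1 / 2 : ℝ) := by
  refine iSup_le fun x => iSup₂_le fun r hr => ?_
  gcongr
  set V := volume (Metric.ball x r) ^ (1 - 2 * (α + β - 1) / n)
  set W : TX n → ℝ≥0∞ := fun p => ENNReal.ofReal (p.1 ^ (1 + 2 * (α - β + 1))) with hW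
  have hWm : Measurable W := by fun_prop
  have hres : volume.restrict (tent (Metric.ball x r)) ≤ halfMeasure n :=
    Measure.restrict_mono (fun p hp => hp.1) le_rfl
  have hsq : ∀ u : TX n → ℂ, (∫⁻ p in tent (Metric.ball x r), ‖u p‖ₑ ^ 2 / W p) / V
      ≤ tentInftyNorm n α β u ^ (2 : ℝ) := by
    intro u
    have hle : ((∫⁻ p in tent (Metric.ball x r), ‖u p‖ₑ ^ 2 / W p) / V) ^ (1 / 2 : ℝ)
        ≤ tentInftyNorm n α β u :=
      le_iSup_of_le x (le_iSup₂_of_le r hr le_rfl)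
    refine le_trans (le_of_eq ?_) (ENNReal.rpow_le_rpow hle zero_le_two)
    rw [← ENNReal.rpow_mul]
    norm_num
  have hm : AEMeasurable (fun p => A * (‖f p‖ₑ ^ 2 / W p))
      (volume.restrict (tent (Metric.ball x r))) :=
    (((hf.mono_measure hres).aemeasurable.enorm.pow_const 2).div hWm.aemeasurable).const_mul _
  have hle : ∫⁻ p in tent (Metric.ball x r), ‖h p‖ₑ ^ 2 / W p
      ≤ A * (∫⁻ p in tent (Metric.ball x r), ‖f p‖ₑ ^ 2 / W p)
        + B * ∫⁻ p in tent (Metric.ball x r), ‖g p‖ₑ ^ 2 / W p := by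
    rw [← lintegral_const_mul' _ _ (by simp), ← lintegral_const_mul' _ _ (by simp),
      ← lintegral_add_left' hm]
    refine lintegral_mono_ae ((hfg.filter_mono (ae_mono hres)).mono fun p hp => ?_)
    calc ‖h p‖ₑ ^ 2 / W p ≤ (A * ‖f p‖ₑ ^ 2 + B * ‖g p‖ₑ ^ 2) / W p := by gcongr
      _ = _ := by rw [ENNReal.add_div, mul_div_assoc, mul_div_assoc]
  calc (∫⁻ p in tent (Metric.ball x r), ‖h p‖ₑ ^ 2 / W p) / V
      ≤ (A * (∫⁻ p in tent (Metric.ball x r), ‖f p‖ₑ ^ 2 / W p)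
        + B * ∫⁻ p in tent (Metric.ball x r), ‖g p‖ₑ ^ 2 / W p) / V := by gcongr
    _ = A * ((∫⁻ p in tent (Metric.ball x r), ‖f p‖ₑ ^ 2 / W p) / V)
        + B * ((∫⁻ p in tent (Metric.ball x r), ‖g p‖ₑ ^ 2 / W p) / V) := by
        rw [ENNReal.add_div, mul_div_assoc, mul_div_assoc]
    _ ≤ _ := by
        gcongr
        · exact hsq f
        · exact hsq g

theorem tentInftyNorm_lt_top_of_ae {n : ℕ} {α β : ℝ} {f g h : TX n → ℂ} (A B : ℝ≥0)
    (hf : AEStronglyMeasurable f (halfMeasure n))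
    (hfg : ∀ᵐ p ∂(halfMeasure n), ‖h p‖ₑ ^ 2 ≤ A * ‖f p‖ₑ ^ 2 + B * ‖g p‖ₑ ^ 2)
    (h₁ : tentInftyNorm n α β f < ∞) (h₂ : tentInftyNorm n α β g < ∞) :
    tentInftyNorm n α β h < ∞ := by
  refine (tentInftyNorm_le_of_ae A B hf hfg).trans_lt
    (ENNReal.rpow_lt_top_of_nonneg (by norm_num) (ENNReal.add_lt_top.2 ⟨?_, ?_⟩).ne)
  · exact ENNReal.mul_lt_top (by simp) (ENNReal.rpow_lt_top_of_nonneg zero_le_two h₁.ne)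
  · exact ENNReal.mul_lt_top (by simp) (ENNReal.rpow_lt_top_of_nonneg zero_le_two h₂.ne)

/-- The space `T^∞_{α,β}` of (classes of) measurable functions with `‖g‖_{T^∞_{α,β}} < ∞`. -/
noncomputable def TentInfty (n : ℕ) (α β : ℝ) : Submodule ℂ (TX n →ₘ[halfMeasure n] ℂ) where
  carrier := {g | tentInftyNorm n α β g < ∞}
  zero_mem' := by
    have hz : tentInftyNorm n α β 0 < ∞ := by simp [tentInftyNorm_zero]
    refine tentInftyNorm_lt_top_of_ae 0 0 aestronglyMeasurable_zero ?_ hz hz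
    filter_upwards [AEEqFun.coeFn_zero (α := TX n) (β := ℂ) (μ := halfMeasure n)] with p hp
    simp [hp]
  add_mem' := by
    intro f g hf hg
    refine tentInftyNorm_lt_top_of_ae 2 2 f.aestronglyMeasurable ?_ hf hg
    filter_upwards [AEEqFun.coeFn_add f g] with p hp
    simpa [hp] using enorm_add_sq_le (f p) (g p)
  smul_mem' := by
    intro c f hf
    refine tentInftyNorm_lt_top_of_ae (‖c‖₊ ^ 2) 0 f.aestronglyMeasurable ?_ hf hf
    filter_upwards [AEEqFun.coeFn_smul c f] with p hp
    simp [hp, mul_pow, enorm_eq_nnnorm]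

/-- `T¹_{α,β}` carries the norm given by atomic decompositions. -/
noncomputable instance (n : ℕ) (α β : ℝ) : Norm (TentOne n α β) :=
  ⟨fun f => (atomicNorm n α β f).toReal⟩

/-! ### Tents, coverings and Carleson measures -/

section Tents

variable {n : ℕ}

/-! Write `d = n - 2(α+β-1)` and `γ = α-β+1`. The theorem rests on two facts comparing weights `ω`
of capacitary size at most one with superpositions of normalized tent indicators `r⁻ᵈ
1_{T(B(x,r))}`.

The first is geometric (`exists_tent_cover`). Covering a set by balls does not cover the tent over
it by the tents over these balls, but a Vitali argument gives enlarged balls whose tents do, at a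
cost `∑ rᵈ` larger only by a constant. Hence a measure that is Carleson of dimension `d` on tents
over balls is controlled by capacity on arbitrary tents, and by layer cake it integrates every
admissible `ω`.

The second is a quasi-sublinearity of the capacitary integral (`capacityIntegral_tsum_ball_le`):
after passing to dyadic cubes, `∑ bᵢ rᵢ⁻ᵈ 1_{Bᵢ}` has capacitary integral at most a constant times
`∑ bᵢ`. So `∑ bᵢ rᵢ⁻ᵈ 1_{T(Bᵢ)}` is an admissible weight when `∑ bᵢ` is small.

The rest is Cauchy–Schwarz. The second fact provides a weight for each atomic series
(`ae_le_of_forall_atom`). Conversely, given `ω`, the tents over `{Nω > 2ᵏ}` are covered by tents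
over balls, `f` is cut along `{2ᵏ < ω ≤ 2ᵏ⁺¹}`, and the normalized pieces are atoms
(`exists_isAtomicDecomposition_of_weight`). The pairing inequality writes `fg` as `(f ω^(-1/2)) (g
ω^(1/2))` and uses that `|g|² t^(-1-2γ) dt dx` is Carleson (`lintegral_pairing_le`).

The atomic norm is countably subadditive, which yields completeness and norm convergence of atomic
series. For duality, an admissible weight bounded below on every tent embeds an `L²`-space into
`T¹`; Riesz representation there produces `g`, testing on `conj g · t^(-2γ) 1_{T(B)}` bounds its
`T^∞`-norm, and the formula extends from atoms by density. -/

theorem tent_mono {A B : Set (EuclideanSpace ℝ (Fin n))} (h : A ⊆ B) : tent A ⊆ tent B :=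
  fun _ hp => ⟨hp.1, hp.2.trans h⟩

/-- No regularity of `A` is needed: within `{t > 0}` the complement of the tent is a union of open
cones over the points outside `A`. -/
theorem measurableSet_tent (A : Set (EuclideanSpace ℝ (Fin n))) : MeasurableSet (tent A) := by
  have e : tent A = {p : TX n | 0 < p.1} ∩ (⋃ z ∈ Aᶜ, {p : TX n | dist z p.2 < p.1})ᶜ := by
    ext p
    simp only [tent, mem_ofPred_eq, mem_inter_iff, mem_compl_iff, mem_iUnion, not_exists,
      and_congr_right_iff]
    intro _
    constructor
    · exact fun h z hz hzp => hz (h hzp)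
    · intro h z hz
      by_contra hzA
      exact h z hzA hz
  rw [e]
  refine (measurableSet_lt measurable_const measurable_fst).inter (IsOpen.measurableSet ?_).compl
  exact isOpen_biUnion fun z _ =>
    isOpen_lt (continuous_const.dist continuous_snd) continuous_fst

theorem restrict_halfMeasure_tent (A : Set (EuclideanSpace ℝ (Fin n))) :
    (halfMeasure n).restrict (tent A) = volume.restrict (tent A) :=
  Measure.restrict_restrict_of_subset fun _ hp => hp.1

theorem ae_halfMeasure_pos : ∀ᵐ p ∂(halfMeasure n), 0 < p.1 :=
  ae_restrict_mem (measurableSet_lt measurable_const measurable_fst)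

/-- Compare volumes. In dimension zero all balls coincide and a tent has unbounded height. -/
theorem tent_ball_fst_le {n : ℕ} (hn : 0 < n) {x : EuclideanSpace ℝ (Fin n)} {r : ℝ}
    {p : TX n} (hp : p ∈ tent (Metric.ball x r)) : p.1 ≤ r := by
  have : Nonempty (Fin n) := ⟨⟨0, hn⟩⟩
  have hr : 0 < r := by
    by_contra h
    have := hp.2 (Metric.mem_ball_self hp.1)
    rw [Metric.ball_eq_empty.2 (not_lt.1 h)] at this
    exact this
  have h1 : volume (Metric.ball p.2 p.1) ≤ volume (Metric.ball x r) := measure_mono hp.2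
  rw [Measure.addHaar_ball_of_pos _ _ hp.1, Measure.addHaar_ball_of_pos _ _ hr,
    ENNReal.mul_le_mul_iff_left (Metric.measure_ball_pos _ _ one_pos).ne' measure_ball_lt_top.ne,
    ENNReal.ofReal_le_ofReal_iff (by positivity), finrank_euclideanSpace_fin] at h1
  exact le_of_pow_le_pow_left₀ hn.ne' hr.le h1

/-- If `B(y, t)` is covered by balls of radius `< t`, then `t ^ d` is at most the sum of the `d`-th
powers of their radii. -/
theorem rpow_le_tsum_of_ball_subset {d : ℝ} (hdn : d ≤ n)
    {S : Set (EuclideanSpace ℝ (Fin n) × ℝ)} (hS : S.Countable) (hpos : ∀ b ∈ S, 0 < b.2)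
    {y : EuclideanSpace ℝ (Fin n)} {t : ℝ} (ht : 0 < t) (hlt : ∀ b ∈ S, b.2 < t)
    (hcov : Metric.ball y t ⊆ ⋃ b ∈ S, Metric.ball b.1 b.2) :
    ENNReal.ofReal (t ^ d) ≤ ∑' b : S, ENNReal.ofReal (b.1.2 ^ d) := by
  set V := volume (Metric.ball (0 : EuclideanSpace ℝ (Fin n)) 1)
  have hV0 : V ≠ 0 := (Metric.measure_ball_pos _ _ one_pos).ne'
  have hV : V ≠ ∞ := measure_ball_lt_top.ne
  have h1 : ENNReal.ofReal (t ^ n) * V ≤ (∑' b : S, ENNReal.ofReal (b.1.2 ^ n)) * V := by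
    have := (measure_mono hcov).trans (measure_biUnion_le volume hS fun b => Metric.ball b.1 b.2)
    rw [Measure.addHaar_ball_of_pos _ _ ht, finrank_euclideanSpace_fin] at this
    refine this.trans (le_of_eq ?_)
    rw [← ENNReal.tsum_mul_right]
    refine tsum_congr fun b => ?_
    rw [Measure.addHaar_ball_of_pos _ _ (hpos b b.2), finrank_euclideanSpace_fin]
  rw [ENNReal.mul_le_mul_iff_left hV0 hV] at h1
  -- Volume gives the bound with exponent `n`; since the radii are below `t` and `d ≤ n`, it
  -- descends to exponent `d`.
  have h2 : ∀ b : S, ENNReal.ofReal (b.1.2 ^ n)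
      ≤ ENNReal.ofReal (t ^ ((n : ℝ) - d)) * ENNReal.ofReal (b.1.2 ^ d) := by
    intro b
    have hb := hpos b b.2
    rw [← ENNReal.ofReal_mul (by positivity)]
    apply ENNReal.ofReal_le_ofReal
    calc b.1.2 ^ n = b.1.2 ^ ((n : ℝ) - d) * b.1.2 ^ d := by
          rw [← Real.rpow_add hb, sub_add_cancel, Real.rpow_natCast]
      _ ≤ _ := by
          gcongr ?_ * _
          exact Real.rpow_le_rpow hb.le (hlt b b.2).le (sub_nonneg.2 hdn)
  have h3 : ENNReal.ofReal (t ^ ((n : ℝ) - d)) * ENNReal.ofReal (t ^ d)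
      ≤ ENNReal.ofReal (t ^ ((n : ℝ) - d)) * ∑' b : S, ENNReal.ofReal (b.1.2 ^ d) := by
    rw [← ENNReal.ofReal_mul (by positivity), ← Real.rpow_add ht, sub_add_cancel,
      Real.rpow_natCast, ← ENNReal.tsum_mul_left]
    exact h1.trans (ENNReal.tsum_le_tsum h2)
  rwa [ENNReal.mul_le_mul_iff_right (by simpa using by positivity) (by simp)] at h3

/-- The tent over a set covered by balls `B_j` is covered by tents over balls `B'_i`, with
`∑ r'_i ^ d` bounded by a multiple of `∑ r_j ^ d`. -/
theorem exists_tent_cover {d : ℝ} (hd : 0 < d) (hdn : d ≤ n)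
    {A : Set (EuclideanSpace ℝ (Fin n))} {S : Set (EuclideanSpace ℝ (Fin n) × ℝ)}
    (hS : S.Countable) (hpos : ∀ b ∈ S, 0 < b.2) (hcov : A ⊆ ⋃ b ∈ S, Metric.ball b.1 b.2)
    (hfin : ∑' b : S, ENNReal.ofReal (b.1.2 ^ d) ≠ ∞) :
    ∃ (ι : Type) (_ : Countable ι) (x : ι → EuclideanSpace ℝ (Fin n)) (r : ι → ℝ),
      (∀ i, 0 < r i) ∧ tent A ⊆ ⋃ i, tent (Metric.ball (x i) (r i)) ∧
      ∑' i, ENNReal.ofReal (r i ^ d)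
        ≤ ENNReal.ofReal (3 ^ d + 16 ^ d) * ∑' b : S, ENNReal.ofReal (b.1.2 ^ d) := by
  set M := ∑' b : S, ENNReal.ofReal (b.1.2 ^ d) with hM
  -- These are the points that the tents over the tripled balls miss. A covering ball that meets
  -- `B(y, t)` must then be smaller than `t`, since otherwise its triple would contain `B(y, t)`.
  let F : Set (TX n) :=
    {p | p ∈ tent A ∧ ∀ b ∈ S, ¬ Metric.ball p.2 p.1 ⊆ Metric.ball b.1 (3 * b.2)}
  let N : TX n → Set (EuclideanSpace ℝ (Fin n) × ℝ) := fun p =>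
    {b | b ∈ S ∧ (Metric.ball b.1 b.2 ∩ Metric.ball p.2 p.1).Nonempty}
  have hNlt : ∀ p ∈ F, ∀ b ∈ N p, b.2 < p.1 := by
    rintro p hp b ⟨hb, z, hz, hz'⟩
    by_contra! h
    refine hp.2 b hb fun y hy => ?_
    rw [Metric.mem_ball] at *
    linarith [dist_triangle4 y p.2 z b.1, dist_comm z p.2]
  have hNsum : ∀ p ∈ F, ENNReal.ofReal (p.1 ^ d) ≤ ∑' b : N p, ENNReal.ofReal (b.1.2 ^ d) := by
    intro p hp
    refine rpow_le_tsum_of_ball_subset (y := p.2) hdn (hS.mono fun b hb => hb.1)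
      (fun b hb => hpos b hb.1) hp.1.1 (hNlt p hp) fun y hy => ?_
    obtain ⟨b, hb, hyb⟩ := mem_iUnion₂.1 (hcov (hp.1.2 hy))
    exact mem_iUnion₂.2 ⟨b, ⟨hb, y, hyb, hy⟩, hyb⟩
  have hNcenter : ∀ p ∈ F, ∀ b ∈ N p, b.1 ∈ Metric.closedBall p.2 (3 * p.1) := by
    rintro p hp b hb
    obtain ⟨_, z, hz, hz'⟩ := id hb
    have := hNlt p hp b hb
    have := hp.1.1
    rw [Metric.mem_ball] at *
    rw [Metric.mem_closedBall]
    linarith [dist_triangle_left b.1 p.2 z]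
  -- Vitali's lemma needs bounded radii; here `tᵈ` is at most the total cost of the covering.
  have hbdd : ∀ p ∈ F, 3 * p.1 ≤ 3 * M.toReal ^ d⁻¹ := by
    intro p hp
    have h0 := hp.1.1
    have : p.1 ^ d ≤ M.toReal := by
      rw [← ENNReal.ofReal_le_iff_le_toReal hfin]
      refine (hNsum p hp).trans ?_
      exact ENNReal.tsum_comp_le_tsum_of_injective
        (f := fun b : N p => (⟨b.1, b.2.1⟩ : S)) (fun a b h => by
          simpa [Subtype.ext_iff] using h) fun b => ENNReal.ofReal (b.1.2 ^ d)
    have := Real.rpow_le_rpow (by positivity) this (inv_nonneg.2 hd.le)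
    rw [Real.rpow_rpow_inv h0.le hd.ne'] at this
    linarith
  -- The covering balls meeting `B(y, t)` have their centers in the closed ball of radius `3t`.
  -- Selecting disjoint balls of radius `3t` therefore makes these families disjoint, so the
  -- selected `tᵈ` sum to at most `M`.
  obtain ⟨u, huF, hudisj, hu⟩ :=
    Vitali.exists_disjoint_subfamily_covering_enlargement_closedBall F (fun p => p.2)
      (fun p => 3 * p.1) _ hbdd 5 (by norm_num)
  have hucount : u.Countable := by
    refine hudisj.countable_of_nonempty_interior fun p hp => ?_
    refine ⟨p.2, Metric.ball_subset_interior_closedBall (Metric.mem_ball_self ?_)⟩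
    have := (huF hp).1.1
    linarith
  have : Countable S := hS.to_subtype
  have : Countable u := hucount.to_subtype
  have husum : ∑' p : u, ENNReal.ofReal (p.1.1 ^ d) ≤ M := by
    calc ∑' p : u, ENNReal.ofReal (p.1.1 ^ d)
        ≤ ∑' p : u, ∑' b : N p.1, ENNReal.ofReal (b.1.2 ^ d) :=
          ENNReal.tsum_le_tsum fun p => hNsum p (huF p.2)
      _ = ∑' q : (Σ p : u, N p.1), ENNReal.ofReal (q.2.1.2 ^ d) :=
          (ENNReal.tsum_sigma' fun q : (Σ p : u, N p.1) => ENNReal.ofReal (q.2.1.2 ^ d)).symm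
      _ ≤ M := by
          refine ENNReal.tsum_comp_le_tsum_of_injective
            (f := fun q : (Σ p : u, N p.1) => (⟨q.2.1, q.2.2.1⟩ : S)) ?_
            fun b => ENNReal.ofReal (b.1.2 ^ d)
          rintro ⟨p, b⟩ ⟨p', b'⟩ h
          have hb : b.1 = b'.1 := by simpa [Subtype.ext_iff] using h
          have hp : p = p' := by
            by_contra hne
            refine Set.disjoint_left.1
              (hudisj p.2 p'.2 fun h => hne (Subtype.ext h))
              (hNcenter p (huF p.2) b b.2) ?_
            rw [hb]
            exact hNcenter p' (huF p'.2) b' b'.2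
          subst hp
          rw [Subtype.ext hb]
  -- The factor 16 is Vitali's `5 · 3 = 15`, rounded up to pass from a closed ball to an open one.
  refine ⟨S ⊕ u, inferInstance, Sum.elim (fun b => b.1.1) (fun p => p.1.2),
    Sum.elim (fun b => 3 * b.1.2) (fun p => 16 * p.1.1), ?_, ?_, ?_⟩
  · rintro (b | p)
    · have := hpos b b.2
      simpa using this
    · have := (huF p.2).1.1
      simpa using this
  · intro p hp
    by_cases h : ∃ b ∈ S, Metric.ball p.2 p.1 ⊆ Metric.ball b.1 (3 * b.2)
    · obtain ⟨b, hb, h⟩ := h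
      exact mem_iUnion.2 ⟨Sum.inl ⟨b, hb⟩, hp.1, h⟩
    · push Not at h
      obtain ⟨q, hq, hpq⟩ := hu p ⟨hp, h⟩
      have hq0 := (huF hq).1.1
      have hp0 := hp.1
      refine mem_iUnion.2 ⟨Sum.inr ⟨q, hq⟩, hp.1, ?_⟩
      refine (Metric.ball_subset_ball (by linarith)).trans
        ((Metric.ball_subset_closedBall (ε := 3 * p.1)).trans (hpq.trans ?_))
      exact Metric.closedBall_subset_ball (by dsimp; linarith)
  · rw [Summable.tsum_sum ENNReal.summable ENNReal.summable,
      ENNReal.ofReal_add (by positivity) (by positivity), add_mul]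
    refine add_le_add ?_ ?_
    · rw [hM, ← ENNReal.tsum_mul_left]
      refine ENNReal.tsum_le_tsum fun b => le_of_eq ?_
      have := hpos b b.2
      rw [← ENNReal.ofReal_mul (by positivity), ← Real.mul_rpow (by norm_num) this.le]
      rfl
    · refine le_trans (le_of_eq ?_) (mul_le_mul_right husum _)
      rw [← ENNReal.tsum_mul_left]
      refine tsum_congr fun p => ?_
      have := (huF p.2).1.1
      rw [← ENNReal.ofReal_mul (by positivity), ← Real.mul_rpow (by norm_num) this.le]
      rfl

theorem exists_tent_cover_of_hausdorffCapacity_lt {d : ℝ} (hd : 0 < d) (hdn : d ≤ n)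
    {A : Set (EuclideanSpace ℝ (Fin n))} {K : ℝ≥0∞} (hK : hausdorffCapacity d A < K) :
    ∃ (ι : Type) (_ : Countable ι) (x : ι → EuclideanSpace ℝ (Fin n)) (r : ι → ℝ),
      (∀ i, 0 < r i) ∧ tent A ⊆ ⋃ i, tent (Metric.ball (x i) (r i)) ∧
      ∑' i, ENNReal.ofReal (r i ^ d) ≤ ENNReal.ofReal (3 ^ d + 16 ^ d) * K := by
  simp only [hausdorffCapacity, iInf_lt_iff] at hK
  obtain ⟨S, hS, hpos, hcov, hlt⟩ := hK
  obtain ⟨ι, hι, x, r, hr, hx, hsum⟩ := exists_tent_cover hd hdn hS hpos hcov hlt.ne_top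
  exact ⟨ι, hι, x, r, hr, hx, hsum.trans (mul_le_mul_right hlt.le _)⟩

/-- A Carleson-type bound over balls extends to a bound by capacity over arbitrary sets. -/
theorem measure_tent_le_hausdorffCapacity {d : ℝ} (hd : 0 < d) (hdn : d ≤ n)
    {μ : Measure (TX n)} {M : ℝ≥0∞} (hM : M ≠ ∞)
    (hμ : ∀ x r, 0 < r → μ (tent (Metric.ball x r)) ≤ M * ENNReal.ofReal (r ^ d))
    {A : Set (EuclideanSpace ℝ (Fin n))} (hA : hausdorffCapacity d A ≠ ∞) :
    μ (tent A) ≤ M * ENNReal.ofReal (3 ^ d + 16 ^ d) * hausdorffCapacity d A := by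
  have key : ∀ K : ℝ≥0∞, hausdorffCapacity d A < K →
      μ (tent A) ≤ M * ENNReal.ofReal (3 ^ d + 16 ^ d) * K := by
    intro K hK
    obtain ⟨ι, hι, x, r, hr, hx, hsum⟩ := exists_tent_cover_of_hausdorffCapacity_lt hd hdn hK
    calc μ (tent A) ≤ ∑' i, μ (tent (Metric.ball (x i) (r i))) :=
          (measure_mono hx).trans (measure_iUnion_le _)
      _ ≤ ∑' i, M * ENNReal.ofReal (r i ^ d) := ENNReal.tsum_le_tsum fun i => hμ _ _ (hr i)
      _ ≤ _ := by
          rw [ENNReal.tsum_mul_left, mul_assoc]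
          gcongr
  have hC : M * ENNReal.ofReal (3 ^ d + 16 ^ d) ≠ ∞ := ENNReal.mul_ne_top hM (by simp)
  have hlim : Tendsto (fun K => M * ENNReal.ofReal (3 ^ d + 16 ^ d) * K)
      (𝓝[>] (hausdorffCapacity d A))
      (𝓝 (M * ENNReal.ofReal (3 ^ d + 16 ^ d) * hausdorffCapacity d A)) :=
    (ENNReal.Tendsto.const_mul tendsto_id (Or.inr hC)).mono_left nhdsWithin_le_nhds
  have : (𝓝[>] (hausdorffCapacity d A)).NeBot := by
    refine nhdsGT_neBot_of_exists_gt ⟨∞, lt_top_iff_ne_top.2 hA⟩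
  exact ge_of_tendsto hlim (eventually_nhdsWithin_of_forall key)

/-- A Carleson-type measure integrates functions with small capacitary nontangential maximal
function. -/
theorem lintegral_le_of_capacityIntegral_le {d : ℝ} (hd : 0 < d) (hdn : d ≤ n)
    {μ : Measure (TX n)} {M : ℝ≥0∞} (hM : M ≠ ∞) (hpos : ∀ᵐ p ∂μ, 0 < p.1)
    (hμ : ∀ x r, 0 < r → μ (tent (Metric.ball x r)) ≤ M * ENNReal.ofReal (r ^ d))
    {ω : TX n → ℝ≥0} (hω : Measurable ω) (hcap : capacityIntegral d (nontangentialMax ω) ≤ 1) :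
    ∫⁻ p, ω p ∂μ ≤ M * ENNReal.ofReal (3 ^ d + 16 ^ d) := by
  set C := M * ENNReal.ofReal (3 ^ d + 16 ^ d)
  have hanti : Antitone fun s : ℝ =>
      hausdorffCapacity d {x | ENNReal.ofReal s < nontangentialMax ω x} := fun s t hst =>
    hausdorffCapacity_mono d fun x hx => (ENNReal.ofReal_le_ofReal hst).trans_lt hx
  have hfin : ∀ᵐ s ∂(volume.restrict (Ioi (0 : ℝ))),
      hausdorffCapacity d {x | ENNReal.ofReal s < nontangentialMax ω x} < ∞ :=
    ae_lt_top hanti.measurable (hcap.trans_lt ENNReal.one_lt_top).ne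
  have hlayer : ∫⁻ p, ω p ∂μ = ∫⁻ s in Ioi (0 : ℝ), μ {p | s < (ω p : ℝ)} := by
    refine Eq.trans ?_ (lintegral_eq_lintegral_meas_lt μ (f := fun p => (ω p : ℝ))
      (Eventually.of_forall fun p => (ω p).2) (by fun_prop))
    simp
  rw [hlayer]
  calc ∫⁻ s in Ioi (0 : ℝ), μ {p | s < (ω p : ℝ)}
      ≤ ∫⁻ s in Ioi (0 : ℝ),
          C * hausdorffCapacity d {x | ENNReal.ofReal s < nontangentialMax ω x} := by
        refine lintegral_mono_ae ?_
        filter_upwards [hfin, ae_restrict_mem measurableSet_Ioi] with s hs hs0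
        refine le_trans (measure_mono_ae ?_)
          (measure_tent_le_hausdorffCapacity hd hdn hM hμ hs.ne)
        -- `{ω > s}` lies in the tent over `{Nω > s}`: every `x` in `B(y, t)` has `(t, y)` in its
        -- cone.
        filter_upwards [hpos] with p hp hps
        have h : s < (ω p : ℝ) := hps
        have hs' : ENNReal.ofReal s < ω p := by
          rw [ENNReal.ofReal, ENNReal.coe_lt_coe]
          rwa [Real.toNNReal_lt_iff_lt_coe (hs0 : 0 < s).le]
        refine ⟨hp, fun x hx => hs'.trans_le ?_⟩
        have hx' : dist p.2 x < p.1 := by rw [dist_comm]; exact hx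
        exact le_iSup₂_of_le (f := fun (p : TX n) (_ : dist p.2 x < p.1) => (ω p : ℝ≥0∞))
          p hx' le_rfl
    _ = C * capacityIntegral d (nontangentialMax ω) := by
        rw [lintegral_const_mul _ hanti.measurable]
        rfl
    _ ≤ C := by simpa using mul_le_mul_right hcap C

end Tents

/-! ### Dyadic cubes and quasi-sublinearity of the capacitary integral -/

section Dyadic

variable {n : ℕ}

/-- The capacity is defined through sets of balls; repetitions in an indexed family only add to the
cost. -/
theorem hausdorffCapacity_le_tsum {ι : Type*} [Countable ι] (d : ℝ)
    {A : Set (EuclideanSpace ℝ (Fin n))} {x : ι → EuclideanSpace ℝ (Fin n)} {r : ι → ℝ}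
    (hr : ∀ i, 0 < r i) (hA : A ⊆ ⋃ i, Metric.ball (x i) (r i)) :
    hausdorffCapacity d A ≤ ∑' i, ENNReal.ofReal (r i ^ d) := by
  refine iInf_le_of_le (range fun i => (x i, r i)) <| iInf_le_of_le (countable_range _) <|
    iInf_le_of_le (by rintro _ ⟨i, rfl⟩; exact hr i) <| iInf_le_of_le (by simpa using hA) ?_
  exact ENNReal.tsum_le_tsum_comp_of_surjective 
    (rangeFactorization_surjective (f := fun i => (x i, r i)))
    fun b : range (fun i => (x i, r i)) => ENNReal.ofReal (b.1.2 ^ d)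

/-- The index of the dyadic cube of side `2 ^ (-k)` that contains `x`. -/
noncomputable def dyadicIndex (k : ℤ) (x : EuclideanSpace ℝ (Fin n)) : Fin n → ℤ :=
  fun i => ⌊x i * 2 ^ k⌋

/-- The corner of the dyadic cube of side `2 ^ (-k)` with index `m`. -/
noncomputable def dyadicCorner (k : ℤ) (m : Fin n → ℤ) : EuclideanSpace ℝ (Fin n) :=
  WithLp.toLp 2 fun i => (m i : ℝ) * 2 ^ (-k)

theorem dyadicIndex_dyadicCorner (k : ℤ) (m : Fin n → ℤ) :
    dyadicIndex k (dyadicCorner k m) = m := by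
  ext i
  have : (2 : ℝ) ^ (-k) * 2 ^ k = 1 := by
    rw [← zpow_add₀ two_ne_zero, neg_add_cancel, zpow_zero]
  simp only [dyadicIndex, dyadicCorner, mul_assoc, this, mul_one, Int.floor_intCast]

/-- Dyadic cubes are nested: the coarser index is the integer quotient of the finer one by a power
of two. -/
theorem dyadicIndex_eq_of_le {j k : ℤ} (hjk : j ≤ k) {x y : EuclideanSpace ℝ (Fin n)}
    (h : dyadicIndex k x = dyadicIndex k y) : dyadicIndex j x = dyadicIndex j y := by
  obtain ⟨m, rfl⟩ : ∃ m : ℕ, j = k - m := ⟨(k - j).toNat, by omega⟩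
  have key : ∀ z : EuclideanSpace ℝ (Fin n), ∀ i,
      dyadicIndex (k - m) z i = dyadicIndex k z i / ((2 ^ m : ℕ) : ℤ) := by
    intro z i
    simp only [dyadicIndex]
    rw [← Int.floor_div_natCast, zpow_sub₀ two_ne_zero, zpow_natCast]
    push_cast
    rw [mul_div_assoc]
  ext i
  rw [key, key, h]

/-- The factor `n + 1` in place of `√n` makes the inequality strict, so that open balls around the
corners cover the cubes. -/
theorem dist_dyadicCorner_lt (k : ℤ) (x : EuclideanSpace ℝ (Fin n)) :
    dist x (dyadicCorner k (dyadicIndex k x)) < (n + 1) * 2 ^ (-k) := by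
  have h2 : (0 : ℝ) < 2 ^ (-k) := by positivity
  rw [EuclideanSpace.dist_eq, Real.sqrt_lt' (by positivity)]
  have hi : ∀ i, dist (x i) (dyadicCorner k (dyadicIndex k x) i) ^ 2 ≤ ((2 : ℝ) ^ (-k)) ^ 2 := by
    intro i
    gcongr
    have h1 : (2 : ℝ) ^ k * 2 ^ (-k) = 1 := by
      rw [← zpow_add₀ two_ne_zero, add_neg_cancel, zpow_zero]
    have e : x i - dyadicCorner k (dyadicIndex k x) i
        = Int.fract (x i * 2 ^ k) * 2 ^ (-k) := by
      rw [Int.fract, sub_mul, mul_assoc, h1]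
      simp [dyadicCorner, dyadicIndex]
    rw [Real.dist_eq, e, abs_of_nonneg (mul_nonneg (Int.fract_nonneg _) h2.le)]
    exact mul_le_of_le_one_left h2.le (Int.fract_lt_one _).le
  refine (Finset.sum_le_sum fun i _ => hi i).trans_lt ?_
  simp only [Finset.sum_const, Finset.card_univ, Fintype.card_fin, nsmul_eq_mul]
  have hn : (0 : ℝ) ≤ n := n.cast_nonneg
  rw [mul_pow]
  gcongr
  nlinarith

/-- With side in `(2r, 4r]` each coordinate ranges over an interval no longer than a side, so its
floor takes at most two consecutive values. The Boolean vector `ε` records which one, leaving `2ⁿ`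
candidate cubes. -/
theorem exists_dyadicIndex_eq_of_mem_ball (x : EuclideanSpace ℝ (Fin n)) {r : ℝ} (hr : 0 < r) :
    ∃ (k : ℤ) (m : (Fin n → Bool) → Fin n → ℤ), (2 : ℝ) ^ (-k) ≤ 4 * r ∧
      ∀ y ∈ Metric.ball x r, ∃ ε, dyadicIndex k y = m ε := by
  obtain ⟨l, hl, hl'⟩ := exists_mem_Ico_zpow (x := 2 * r) (y := (2 : ℝ)) (by positivity)
    (by norm_num)
  rw [zpow_add_one₀ two_ne_zero] at hl'
  refine ⟨-(l + 1), fun ε i => ⌊(x i - r) * 2 ^ (-(l + 1))⌋ + if ε i then 1 else 0, ?_, ?_⟩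
  · rw [neg_neg, zpow_add_one₀ two_ne_zero]
    linarith
  · intro y hy
    have h2 : (0 : ℝ) < 2 ^ (-(l + 1)) := by positivity
    have h1 : (2 : ℝ) ^ l * 2 * 2 ^ (-(l + 1)) = 1 := by
      rw [← zpow_add_one₀ two_ne_zero, ← zpow_add₀ two_ne_zero, add_neg_cancel, zpow_zero]
    have h3 : 2 * r * 2 ^ (-(l + 1)) ≤ 1 := by
      rw [← h1]
      gcongr
    refine ⟨fun i => decide (dyadicIndex (-(l + 1)) y i ≠ ⌊(x i - r) * 2 ^ (-(l + 1))⌋), ?_⟩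
    ext i
    have hyi : |y i - x i| < r := by
      have := (PiLp.norm_apply_le (y - x) i).trans_lt (by simpa [dist_eq_norm] using hy)
      simpa using this
    rw [abs_lt] at hyi
    have ha : (x i - r) * 2 ^ (-(l + 1)) ≤ y i * 2 ^ (-(l + 1)) := by
      gcongr
      linarith
    have hb : y i * 2 ^ (-(l + 1)) ≤ (x i - r) * 2 ^ (-(l + 1)) + 1 := by
      have : y i * 2 ^ (-(l + 1)) ≤ (x i - r + 2 * r) * 2 ^ (-(l + 1)) := by
        gcongr
        linarith
      linarith
    have ha' := Int.floor_le_floor ha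
    have hb' := Int.floor_le_floor hb
    rw [Int.floor_add_one] at hb'
    simp only [dyadicIndex] at *
    by_cases h : ⌊y i * 2 ^ (-(l + 1))⌋ = ⌊(x i - r) * 2 ^ (-(l + 1))⌋
    · simp only [h, ne_eq, not_true_eq_false, decide_false, Bool.false_eq_true, if_false, add_zero]
    · simp only [h, ne_eq, not_false_eq_true, decide_true, if_true]
      omega

theorem volume_ofReal_mem_Ico_le (a b : ℝ≥0∞) :
    volume {s : ℝ | 0 < s ∧ a ≤ ENNReal.ofReal s ∧ ENNReal.ofReal s < a + b} ≤ b := by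
  by_cases hb : b = ∞
  · simp [hb]
  by_cases ha : a = ∞
  · simp [ha]
  lift a to ℝ≥0 using ha
  lift b to ℝ≥0 using hb
  calc _ ≤ volume (Ico (a : ℝ) (a + b)) := by
        refine measure_mono fun s ⟨h0, h1, h2⟩ => ?_
        rw [ENNReal.ofReal, ENNReal.coe_le_coe, Real.le_toNNReal_iff_coe_le h0.le] at h1
        rw [ENNReal.ofReal, ← ENNReal.coe_add, ENNReal.coe_lt_coe,
          Real.toNNReal_lt_iff_lt_coe h0.le] at h2
        exact ⟨h1, by simpa using h2⟩
    _ = b := by simp [Real.volume_Ico]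

/-- Integral of a sum of dyadic pieces: over each point the cubes are stacked from large to
small. -/
theorem capacityIntegral_dyadic_le {d : ℝ} (hd : 0 < d) (v : ℤ → (Fin n → ℤ) → ℝ≥0∞) :
    capacityIntegral d (fun x => ∑' k, v k (dyadicIndex k x)) ≤
      ENNReal.ofReal ((n + 1) ^ d) *
        ∑' q : ℤ × (Fin n → ℤ), v q.1 q.2 * ENNReal.ofReal ((2 ^ (-q.1)) ^ d) := by
  set T := ∑' q : ℤ × (Fin n → ℤ), v q.1 q.2 * ENNReal.ofReal ((2 ^ (-q.1)) ^ d) with hT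
  have hn : (0 : ℝ) < (n + 1) ^ d := by positivity
  by_cases hTtop : T = ∞
  · rw [hTtop, ENNReal.mul_top (by simpa using hn)]
    exact le_top
  -- The stack of the cubes containing `x` of side larger than `2^(-k)`. By nesting it is constant
  -- on each cube of generation `k`, which makes `a q` below a function of the cube alone.
  set S : ℤ → EuclideanSpace ℝ (Fin n) → ℝ≥0∞ := fun k x =>
    ∑' j, if j < k then v j (dyadicIndex j x) else 0 with hS
  have hSsucc : ∀ k x, S (k + 1) x = S k x + v k (dyadicIndex k x) := by
    intro k x
    rw [hS]
    dsimp only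
    rw [← tsum_ite_eq k (fun j => v j (dyadicIndex j x)), ← ENNReal.tsum_add]
    refine tsum_congr fun j => ?_
    rcases lt_trichotomy j k with h | h | h
    · simp [h, h.ne, h.trans (lt_add_one k)]
    · simp [h]
    · simp [h.not_gt, h.ne', (show ¬ j < k + 1 by omega)]
  have hScongr : ∀ k x y, dyadicIndex k x = dyadicIndex k y → S k x = S k y := by
    intro k x y h
    refine tsum_congr fun j => ?_
    split_ifs with hj
    · rw [dyadicIndex_eq_of_le hj.le h]
    · rfl
  -- For `j < k` one has `(2ᵏ)ᵈ (2⁻ʲ)ᵈ ≥ 1`. The stack thus tends to zero as `k → -∞`, so there is a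
  -- first generation at which it exceeds a given `s > 0`.
  have hSle : ∀ k x, S k x ≤ ENNReal.ofReal ((2 ^ k) ^ d) * T := by
    intro k x
    calc S k x ≤ ∑' j, ENNReal.ofReal ((2 ^ k) ^ d) *
          (v j (dyadicIndex j x) * ENNReal.ofReal ((2 ^ (-j)) ^ d)) := by
          refine ENNReal.tsum_le_tsum fun j => ?_
          split_ifs with hj
          · rw [mul_left_comm, ← ENNReal.ofReal_mul (by positivity),
              ← Real.mul_rpow (by positivity) (by positivity), ← zpow_add₀ two_ne_zero]
            refine le_mul_of_one_le_right zero_le ?_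
            rw [ENNReal.one_le_ofReal]
            exact Real.one_le_rpow (one_le_zpow₀ (by norm_num) (by omega)) hd.le
          · exact zero_le
      _ ≤ _ := by
          rw [ENNReal.tsum_mul_left]
          gcongr
          exact ENNReal.tsum_comp_le_tsum_of_injective
            (f := fun j : ℤ => (j, dyadicIndex j x)) (fun a b h => (Prod.ext_iff.1 h).1)
            fun q => v q.1 q.2 * ENNReal.ofReal ((2 ^ (-q.1)) ^ d)
  let a : ℤ × (Fin n → ℤ) → ℝ≥0∞ := fun q => S q.1 (dyadicCorner q.1 q.2)
  have hfind : ∀ s : ℝ, 0 < s → ∀ x, ENNReal.ofReal s < ∑' k, v k (dyadicIndex k x) →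
      ∃ k, S k x ≤ ENNReal.ofReal s ∧ ENNReal.ofReal s < S k x + v k (dyadicIndex k x) := by
    intro s hs x hx
    have hex : ∃ k, ENNReal.ofReal s < S k x := by
      rw [ENNReal.tsum_eq_iSup_sum, lt_iSup_iff] at hx
      obtain ⟨F, hF⟩ := hx
      obtain ⟨M, hM⟩ := F.exists_le
      refine ⟨M + 1, hF.trans_le ?_⟩
      refine le_trans (le_of_eq ?_) (ENNReal.sum_le_tsum F)
      exact Finset.sum_congr rfl fun j hj => by simp [hM j hj]
    have hbdd : ∃ b, ∀ k, ENNReal.ofReal s < S k x → b ≤ k := by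
      have h2d : (2 : ℝ) ^ (-d) < 1 := Real.rpow_lt_one_of_one_lt_of_neg (by norm_num) (by linarith)
      obtain ⟨N, hN⟩ := exists_pow_lt_of_lt_one (show 0 < s / (T.toReal + 1) by positivity) h2d
      refine ⟨-N, fun k hk => ?_⟩
      by_contra! hlt
      refine absurd (hk.trans_le (hSle k x)) (not_lt.2 ?_)
      rw [← ENNReal.ofReal_toReal hTtop, ← ENNReal.ofReal_mul (by positivity)]
      apply ENNReal.ofReal_le_ofReal
      have h1 : ((2 : ℝ) ^ k) ^ d ≤ (2 ^ (-d)) ^ N := by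
        rw [← Real.rpow_natCast, ← Real.rpow_mul (by norm_num), ← Real.rpow_intCast,
          ← Real.rpow_mul (by norm_num)]
        apply Real.rpow_le_rpow_of_exponent_le (by norm_num)
        have : (k : ℝ) ≤ -N := by exact_mod_cast hlt.le
        nlinarith
      rw [lt_div_iff₀ (by positivity)] at hN
      have hp : (0 : ℝ) ≤ (2 ^ (-d)) ^ N := by positivity
      have ht := ENNReal.toReal_nonneg (a := T)
      nlinarith [mul_le_mul_of_nonneg_right h1 ht]
    obtain ⟨k, hk, hmin⟩ := Int.exists_least_of_bdd hbdd hex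
    refine ⟨k - 1, ?_, ?_⟩
    · by_contra! h
      have := hmin _ h
      omega
    · rw [← hSsucc, sub_add_cancel]
      exact hk
  -- Each point of the level set lies in a cube whose slab `[a, a + v)` contains `s`. Covering by
  -- those cubes and integrating in `s`, a cube pays its size to the power `d` only on a set of `s`
  -- of length at most `v`.
  have hcap : ∀ s ∈ Ioi (0 : ℝ),
      hausdorffCapacity d {x : EuclideanSpace ℝ (Fin n) |
        ENNReal.ofReal s < ∑' k, v k (dyadicIndex k x)} ≤
      ∑' q : ℤ × (Fin n → ℤ),
        {s : ℝ | 0 < s ∧ a q ≤ ENNReal.ofReal s ∧ ENNReal.ofReal s < a q + v q.1 q.2}.indicator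
          (fun _ => ENNReal.ofReal (((n + 1) * 2 ^ (-q.1)) ^ d)) s := by
    intro s hs
    let Q : Set (ℤ × (Fin n → ℤ)) :=
      {q | 0 < s ∧ a q ≤ ENNReal.ofReal s ∧ ENNReal.ofReal s < a q + v q.1 q.2}
    refine (hausdorffCapacity_le_tsum (ι := Q) d
      (x := fun q => dyadicCorner q.1.1 q.1.2) (r := fun q => (n + 1) * 2 ^ (-q.1.1))
      (fun q => by positivity) ?_).trans (le_of_eq ?_)
    · intro x hx
      obtain ⟨k, hk, hk'⟩ := hfind s hs x hx
      have e : S k x = a (k, dyadicIndex k x) :=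
        hScongr _ _ _ (dyadicIndex_dyadicCorner k _).symm
      rw [e] at hk hk'
      exact mem_iUnion.2 ⟨⟨(k, dyadicIndex k x), hs, hk, hk'⟩, dist_dyadicCorner_lt k x⟩
    · exact tsum_subtype Q fun q => ENNReal.ofReal (((n + 1) * 2 ^ (-q.1)) ^ d)
  have hmeas : ∀ q : ℤ × (Fin n → ℤ), MeasurableSet
      {s : ℝ | 0 < s ∧ a q ≤ ENNReal.ofReal s ∧ ENNReal.ofReal s < a q + v q.1 q.2} := by
    intro q
    exact measurableSet_Ioi.inter
      ((measurableSet_le measurable_const ENNReal.measurable_ofReal).inter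
        (measurableSet_lt ENNReal.measurable_ofReal measurable_const))
  calc _ ≤ ∫⁻ s : ℝ, ∑' q : ℤ × (Fin n → ℤ),
        {s : ℝ | 0 < s ∧ a q ≤ ENNReal.ofReal s ∧ ENNReal.ofReal s < a q + v q.1 q.2}.indicator
          (fun _ => ENNReal.ofReal (((n + 1) * 2 ^ (-q.1)) ^ d)) s :=
        (setLIntegral_mono' measurableSet_Ioi hcap).trans (setLIntegral_le_lintegral _ _)
    _ = ∑' q : ℤ × (Fin n → ℤ), ENNReal.ofReal (((n + 1) * 2 ^ (-q.1)) ^ d) * volume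
        {s : ℝ | 0 < s ∧ a q ≤ ENNReal.ofReal s ∧ ENNReal.ofReal s < a q + v q.1 q.2} := by
        rw [lintegral_tsum fun q => (measurable_const.indicator (hmeas q)).aemeasurable]
        exact tsum_congr fun q => lintegral_indicator_const (hmeas q) _
    _ ≤ _ := by
        rw [hT, ← ENNReal.tsum_mul_left]
        refine ENNReal.tsum_le_tsum fun q => ?_
        rw [Real.mul_rpow (by positivity) (by positivity), ENNReal.ofReal_mul (by positivity),
          mul_assoc, mul_comm (v q.1 q.2)]
        gcongr
        exact volume_ofReal_mem_Ico_le _ _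

theorem capacityIntegral_mono (d : ℝ) {f g : EuclideanSpace ℝ (Fin n) → ℝ≥0∞} (h : ∀ x, f x ≤ g x) :
    capacityIntegral d f ≤ capacityIntegral d g :=
  lintegral_mono fun _ => hausdorffCapacity_mono d fun x hx => lt_of_lt_of_le hx (h x)

/-- The constant in the sublinearity estimate for sums of normalized indicators of balls. -/
noncomputable def capacityConst (n : ℕ) (d : ℝ) : ℝ≥0 :=
  Real.toNNReal ((n + 1) ^ d) * (2 ^ n * Real.toNNReal (4 ^ d))

theorem capacityConst_pos (n : ℕ) (d : ℝ) : 0 < capacityConst n d := by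
  have h1 : 0 < Real.toNNReal (((n : ℝ) + 1) ^ d) := Real.toNNReal_pos.2 (by positivity)
  have h2 : 0 < Real.toNNReal ((4 : ℝ) ^ d) := Real.toNNReal_pos.2 (by positivity)
  unfold capacityConst
  positivity

/-- Replace each ball by its `2ⁿ` dyadic cubes and apply the dyadic bound. In `capacityConst` the
factor `(n+1)ᵈ` pays for the return from cubes to balls, and `4ᵈ` for the side of the cubes. -/
theorem capacityIntegral_tsum_ball_le {ι : Type*} {d : ℝ} (hd : 0 < d) (c : ι → ℝ≥0∞)
    {x : ι → EuclideanSpace ℝ (Fin n)} {r : ι → ℝ} (hr : ∀ i, 0 < r i) :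
    capacityIntegral d (fun y => ∑' i, (Metric.ball (x i) (r i)).indicator
      (fun _ => c i / ENNReal.ofReal (r i ^ d)) y) ≤ capacityConst n d * ∑' i, c i := by
  classical
  choose K M hK hM using fun i => exists_dyadicIndex_eq_of_mem_ball (x i) (hr i)
  let b : ι × (Fin n → Bool) → ℝ≥0∞ := fun p => c p.1 / ENNReal.ofReal (r p.1 ^ d)
  let v : ℤ → (Fin n → ℤ) → ℝ≥0∞ := fun k m =>
    ∑' p : ι × (Fin n → Bool), if (k, m) = (K p.1, M p.1 p.2) then b p else 0
  have hle : ∀ y, ∑' i, (Metric.ball (x i) (r i)).indicator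
      (fun _ => c i / ENNReal.ofReal (r i ^ d)) y ≤ ∑' k, v k (dyadicIndex k y) := by
    intro y
    simp only [v]
    rw [ENNReal.tsum_comm, ENNReal.tsum_prod']
    refine ENNReal.tsum_le_tsum fun i => ?_
    by_cases hy : y ∈ Metric.ball (x i) (r i)
    · obtain ⟨ε, hε⟩ := hM i y hy
      rw [indicator_of_mem hy]
      refine le_trans ?_ (ENNReal.le_tsum ε)
      refine le_trans ?_ (ENNReal.le_tsum (K i))
      simp [hε, b]
    · rw [indicator_of_notMem hy]
      exact zero_le
  refine ((capacityIntegral_mono d hle).trans (capacityIntegral_dyadic_le hd v)).trans ?_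
  have hsum : ∑' q : ℤ × (Fin n → ℤ), v q.1 q.2 * ENNReal.ofReal ((2 ^ (-q.1)) ^ d)
      = ∑' p : ι × (Fin n → Bool), b p * ENNReal.ofReal ((2 ^ (-K p.1)) ^ d) := by
    simp only [v, ← ENNReal.tsum_mul_right]
    rw [ENNReal.tsum_comm]
    refine tsum_congr fun p => ?_
    rw [tsum_eq_single (K p.1, M p.1 p.2) fun q hq => by simp [hq]]
    simp
  have hterm : ∀ p : ι × (Fin n → Bool), b p * ENNReal.ofReal ((2 ^ (-K p.1)) ^ d)
      ≤ c p.1 * ENNReal.ofReal (4 ^ d) := by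
    intro p
    have h0 := hr p.1
    have h1 : ENNReal.ofReal ((2 ^ (-K p.1)) ^ d)
        ≤ ENNReal.ofReal (r p.1 ^ d) * ENNReal.ofReal (4 ^ d) := by
      rw [← ENNReal.ofReal_mul (by positivity), ← Real.mul_rpow h0.le (by norm_num)]
      apply ENNReal.ofReal_le_ofReal
      refine Real.rpow_le_rpow (by positivity) ?_ hd.le
      linarith [hK p.1]
    calc b p * ENNReal.ofReal ((2 ^ (-K p.1)) ^ d)
        ≤ c p.1 / ENNReal.ofReal (r p.1 ^ d) *
          (ENNReal.ofReal (r p.1 ^ d) * ENNReal.ofReal (4 ^ d)) := by gcongr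
      _ = _ := by
        rw [← mul_assoc, ENNReal.div_mul_cancel (by simpa using by positivity) (by simp)]
  rw [hsum]
  calc _ ≤ ENNReal.ofReal ((n + 1) ^ d) *
        ∑' p : ι × (Fin n → Bool), c p.1 * ENNReal.ofReal (4 ^ d) := by
        exact mul_le_mul_right (ENNReal.tsum_le_tsum hterm) _
    _ = _ := by
        rw [ENNReal.tsum_prod']
        simp only [tsum_fintype, Finset.sum_const, Finset.card_univ, Fintype.card_pi,
          Fintype.card_bool, Finset.prod_const, Fintype.card_fin, nsmul_eq_mul]
        rw [ENNReal.tsum_mul_left, ENNReal.tsum_mul_right, capacityConst]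
        push_cast
        simp only [ENNReal.ofReal]
        ring

end Dyadic

/-! ### Cauchy–Schwarz for sums and integrals in `[0, ∞]` -/

section CauchySchwarz

theorem ENNReal.rpow_half_rpow_two (x : ℝ≥0∞) : (x ^ (1 / 2 : ℝ)) ^ (2 : ℝ) = x := by
  rw [← ENNReal.rpow_mul]
  norm_num

theorem ENNReal.sq_rpow_half (x : ℝ≥0∞) : (x ^ 2) ^ (1 / 2 : ℝ) = x := by
  rw [← ENNReal.rpow_natCast, ← ENNReal.rpow_mul]
  norm_num

theorem ENNReal.tsum_rpow_half_mul_le {ι : Type*} (x y : ι → ℝ≥0∞) :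
    ∑' i, (x i * y i) ^ (1 / 2 : ℝ) ≤ (∑' i, x i) ^ (1 / 2 : ℝ) * (∑' i, y i) ^ (1 / 2 : ℝ) := by
  rw [ENNReal.tsum_eq_iSup_sum]
  refine iSup_le fun s => ?_
  calc ∑ i ∈ s, (x i * y i) ^ (1 / 2 : ℝ)
      = ∑ i ∈ s, x i ^ (1 / 2 : ℝ) * y i ^ (1 / 2 : ℝ) :=
        Finset.sum_congr rfl fun i _ => ENNReal.mul_rpow_of_nonneg _ _ (by norm_num)
    _ ≤ (∑ i ∈ s, x i) ^ (1 / 2 : ℝ) * (∑ i ∈ s, y i) ^ (1 / 2 : ℝ) := by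
        have := ENNReal.inner_le_Lp_mul_Lq s (fun i => x i ^ (1 / 2 : ℝ))
          (fun i => y i ^ (1 / 2 : ℝ)) Real.HolderConjugate.two_two
        simpa only [ENNReal.rpow_half_rpow_two] using this
    _ ≤ _ := by
        gcongr
        · exact ENNReal.sum_le_tsum s
        · exact ENNReal.sum_le_tsum s

theorem lintegral_rpow_half_mul_le {X : Type*} [MeasurableSpace X] {μ : Measure X}
    {x y : X → ℝ≥0∞} (hx : AEMeasurable x μ) (hy : AEMeasurable y μ) :
    ∫⁻ p, (x p * y p) ^ (1 / 2 : ℝ) ∂μ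
      ≤ (∫⁻ p, x p ∂μ) ^ (1 / 2 : ℝ) * (∫⁻ p, y p ∂μ) ^ (1 / 2 : ℝ) := by
  have := ENNReal.lintegral_mul_le_Lp_mul_Lq μ Real.HolderConjugate.two_two
    (hx.pow_const (1 / 2 : ℝ)) (hy.pow_const (1 / 2 : ℝ))
  simp only [ENNReal.rpow_half_rpow_two] at this
  refine le_trans (le_of_eq (lintegral_congr fun p => ?_)) this
  exact ENNReal.mul_rpow_of_nonneg _ _ (by norm_num)

end CauchySchwarz

/-! ### Normalizations and the pairing inequality -/

section Norms

variable {n : ℕ} {α β : ℝ}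

theorem pos_of_dim_pos (hαβ : 0 ≤ α + β - 1) (hd : 0 < (n : ℝ) - 2 * (α + β - 1)) : 0 < n := by
  rcases Nat.eq_zero_or_pos n with rfl | h
  · norm_num at hd
    linarith
  · exact h

/-- The factor of `r ^ (n - 2 (α + β - 1))` in the normalization of the tent spaces. -/
noncomputable def ballConst (n : ℕ) (α β : ℝ) : ℝ≥0 :=
  (volume (Metric.ball (0 : EuclideanSpace ℝ (Fin n)) 1) ^
    (1 - 2 * (α + β - 1) / n)).toNNReal

theorem ballConst_pos (n : ℕ) (α β : ℝ) : 0 < ballConst n α β := by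
  have h : 0 < volume (Metric.ball (0 : EuclideanSpace ℝ (Fin n)) 1) :=
    Metric.measure_ball_pos _ _ one_pos
  exact ENNReal.toNNReal_pos (ENNReal.rpow_pos h measure_ball_lt_top.ne).ne'
    (ENNReal.rpow_ne_top_of_ne_zero h.ne' measure_ball_lt_top.ne)

/-- The exponent equals `d / n`, which turns the volume normalization into the scale `rᵈ` of the
capacity. -/
theorem volume_ball_rpow (hn : 0 < n) (hd : 0 < (n : ℝ) - 2 * (α + β - 1))
    (x : EuclideanSpace ℝ (Fin n)) {r : ℝ} (hr : 0 < r) :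
    volume (Metric.ball x r) ^ (1 - 2 * (α + β - 1) / n)
      = ENNReal.ofReal (r ^ ((n : ℝ) - 2 * (α + β - 1))) * ballConst n α β := by
  have h : 0 < volume (Metric.ball (0 : EuclideanSpace ℝ (Fin n)) 1) :=
    Metric.measure_ball_pos _ _ one_pos
  have hn' : (n : ℝ) ≠ 0 := by exact_mod_cast hn.ne'
  have he : 0 ≤ 1 - 2 * (α + β - 1) / (n : ℝ) := by
    rw [one_sub_div hn']
    positivity
  rw [Measure.addHaar_ball_of_pos _ _ hr, ENNReal.mul_rpow_of_nonneg _ _ he, ballConst,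
    ENNReal.coe_toNNReal (ENNReal.rpow_ne_top_of_ne_zero h.ne' measure_ball_lt_top.ne),
    ENNReal.ofReal_rpow_of_pos (by positivity), finrank_euclideanSpace_fin, ← Real.rpow_natCast,
    ← Real.rpow_mul hr.le]
  congr 4
  field_simp

/-- Membership in `T^∞` is a Carleson condition of dimension `d` on `|g|² t^(-1-2γ) dt dx`. -/
theorem lintegral_tent_le_tentInftyNorm (hn : 0 < n) (hd : 0 < (n : ℝ) - 2 * (α + β - 1))
    (g : TX n → ℂ) (x : EuclideanSpace ℝ (Fin n)) {r : ℝ} (hr : 0 < r) :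
    ∫⁻ p in tent (Metric.ball x r), ‖g p‖ₑ ^ 2 / ENNReal.ofReal (p.1 ^ (1 + 2 * (α - β + 1)))
      ≤ tentInftyNorm n α β g ^ 2 * ballConst n α β *
        ENNReal.ofReal (r ^ ((n : ℝ) - 2 * (α + β - 1))) := by
  have hle : ((∫⁻ p in tent (Metric.ball x r),
      ‖g p‖ₑ ^ 2 / ENNReal.ofReal (p.1 ^ (1 + 2 * (α - β + 1))))
      / volume (Metric.ball x r) ^ (1 - 2 * (α + β - 1) / n)) ^ (1 / 2 : ℝ)
      ≤ tentInftyNorm n α β g := le_iSup_of_le x (le_iSup₂_of_le r hr le_rfl)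
  have hle2 := ENNReal.rpow_le_rpow hle (zero_le_two (α := ℝ))
  have hB := ballConst_pos n α β
  rw [ENNReal.rpow_half_rpow_two, volume_ball_rpow hn hd x hr, ENNReal.div_le_iff_le_mul,
    ENNReal.rpow_ofNat] at hle2
  · rwa [mul_comm (ENNReal.ofReal _), ← mul_assoc] at hle2
  · left
    have : 0 < r ^ ((n : ℝ) - 2 * (α + β - 1)) := by positivity
    simp [this, hB.ne']
  · left
    exact ENNReal.mul_ne_top (by simp) (by simp)

/-- The weights of `T¹` and `T^∞` are conjugate with respect to `dt dx / t`; this is what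
Cauchy–Schwarz needs. -/
theorem weight_mul_weight {γ t : ℝ} (ht : 0 < t) :
    ENNReal.ofReal (t ^ (1 - 2 * γ)) * ENNReal.ofReal (t ^ (1 + 2 * γ)) = ENNReal.ofReal t ^ 2 := by
  rw [← ENNReal.ofReal_mul (by positivity), ← Real.rpow_add ht, ← ENNReal.ofReal_pow ht.le,
    ← Real.rpow_natCast]
  congr 2
  push_cast
  ring

theorem le_tentOneNorm {f : TX n → ℂ} {y : ℝ≥0∞}
    (h : ∀ ω : TX n → ℝ≥0, Measurable ω →
      capacityIntegral (n - 2 * (α + β - 1)) (nontangentialMax ω) ≤ 1 →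
      (∀ᵐ p ∂(halfMeasure n), ω p = 0 → f p = 0) →
      y ≤ (∫⁻ p, ‖f p‖ₑ ^ 2 / (ω p : ℝ≥0∞) / ENNReal.ofReal (p.1 ^ (1 - 2 * (α - β + 1)))
        ∂(halfMeasure n)) ^ (1 / 2 : ℝ)) : y ≤ tentOneNorm n α β f :=
  le_iInf fun ω => le_iInf fun h1 => le_iInf fun h2 => le_iInf fun h3 => h ω h1 h2 h3

theorem tentOneNorm_le {f : TX n → ℂ} {ω : TX n → ℝ≥0} (h1 : Measurable ω)
    (h2 : capacityIntegral (n - 2 * (α + β - 1)) (nontangentialMax ω) ≤ 1)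
    (h3 : ∀ᵐ p ∂(halfMeasure n), ω p = 0 → f p = 0) :
    tentOneNorm n α β f ≤
      (∫⁻ p, ‖f p‖ₑ ^ 2 / (ω p : ℝ≥0∞) / ENNReal.ofReal (p.1 ^ (1 - 2 * (α - β + 1)))
        ∂(halfMeasure n)) ^ (1 / 2 : ℝ) :=
  iInf_le_of_le ω <| iInf_le_of_le h1 <| iInf_le_of_le h2 <| iInf_le_of_le h3 le_rfl

/-- The constant in the pairing inequality. -/
noncomputable def pairingConst (n : ℕ) (α β : ℝ) : ℝ≥0 :=
  (ballConst n α β * Real.toNNReal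
    (3 ^ ((n : ℝ) - 2 * (α + β - 1)) + 16 ^ ((n : ℝ) - 2 * (α + β - 1)))) ^ (1 / 2 : ℝ)

/-- For each admissible `ω`, split `fg` as `f ω^(-1/2)` times `g ω^(1/2)`. The second factor is the
integral of `ω` against the Carleson measure of `g`, bounded independently of `ω`, so the infimum
over `ω` may be taken. -/
theorem lintegral_pairing_le (hαβ : 0 ≤ α + β - 1) (hd : 0 < (n : ℝ) - 2 * (α + β - 1))
    {f g : TX n → ℂ} (hf : AEStronglyMeasurable f (halfMeasure n))
    (hg : AEStronglyMeasurable g (halfMeasure n)) (hf' : tentOneNorm n α β f < ∞)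
    (hg' : tentInftyNorm n α β g < ∞) :
    ∫⁻ p, ‖f p * g p‖ₑ / ENNReal.ofReal p.1 ∂(halfMeasure n)
      ≤ pairingConst n α β * tentOneNorm n α β f * tentInftyNorm n α β g := by
  have hn := pos_of_dim_pos hαβ hd
  set d := (n : ℝ) - 2 * (α + β - 1) with hd_def
  set D := ENNReal.ofReal (3 ^ d + 16 ^ d) with hD
  set G : TX n → ℝ≥0∞ := fun p => ‖g p‖ₑ ^ 2 / ENNReal.ofReal (p.1 ^ (1 + 2 * (α - β + 1)))
    with hG
  have hGm : AEMeasurable G (halfMeasure n) :=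
    (hg.aemeasurable.enorm.pow_const 2).div (by fun_prop)
  set M := tentInftyNorm n α β g ^ 2 * ballConst n α β with hM
  have hMtop : M ≠ ∞ := ENNReal.mul_ne_top (ENNReal.pow_ne_top hg'.ne) (by simp)
  have hK : (M * D) ^ (1 / 2 : ℝ) ≠ ∞ :=
    ENNReal.rpow_ne_top_of_nonneg (by norm_num) (ENNReal.mul_ne_top hMtop (by simp [hD]))
  set I := ∫⁻ p, ‖f p * g p‖ₑ / ENNReal.ofReal p.1 ∂(halfMeasure n) with hI
  have hmain : I / (M * D) ^ (1 / 2 : ℝ) ≤ tentOneNorm n α β f := by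
    refine le_tentOneNorm fun ω hω hcap hz => ENNReal.div_le_of_le_mul ?_
    have hcarl : ∫⁻ p, ω p * G p ∂(halfMeasure n) ≤ M * D := by
      have := lintegral_le_of_capacityIntegral_le (μ := (halfMeasure n).withDensity G)
        hd (by rw [hd_def]; linarith) hMtop
        ((withDensity_absolutelyContinuous _ _).ae_le ae_halfMeasure_pos) (fun x r hr => ?_)
        hω hcap
      · rw [lintegral_withDensity_eq_lintegral_mul₀ hGm (by fun_prop)] at this
        refine le_trans (le_of_eq (lintegral_congr fun p => ?_)) this
        exact mul_comm _ _
      · rw [withDensity_apply _ (measurableSet_tent _), restrict_halfMeasure_tent]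
        exact lintegral_tent_le_tentInftyNorm hn hd g x hr
    calc I ≤ ∫⁻ p, ((‖f p‖ₑ ^ 2 / (ω p : ℝ≥0∞) /
            ENNReal.ofReal (p.1 ^ (1 - 2 * (α - β + 1)))) * (ω p * G p)) ^ (1 / 2 : ℝ)
            ∂(halfMeasure n) := by
          refine lintegral_mono_ae ?_
          filter_upwards [hz, ae_halfMeasure_pos] with p hp ht
          by_cases h0 : ω p = 0
          · simp [hp h0]
          · have hω0 : (ω p : ℝ≥0∞) ≠ 0 := by exact_mod_cast h0
            have e : (‖f p‖ₑ ^ 2 / (ω p : ℝ≥0∞) /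
                ENNReal.ofReal (p.1 ^ (1 - 2 * (α - β + 1)))) * (ω p * G p)
                = (‖f p * g p‖ₑ / ENNReal.ofReal p.1) ^ 2 := by
              have ht1 : ENNReal.ofReal (p.1 ^ (1 - 2 * (α - β + 1))) ≠ 0 := by
                simpa using by positivity
              have ht2 : ENNReal.ofReal (p.1 ^ (1 + 2 * (α - β + 1))) ≠ 0 := by
                simpa using by positivity
              have ht0 : ENNReal.ofReal p.1 ≠ 0 := by simpa using ht
              have hinv : (ENNReal.ofReal (p.1 ^ (1 - 2 * (α - β + 1))))⁻¹ *
                  (ENNReal.ofReal (p.1 ^ (1 + 2 * (α - β + 1))))⁻¹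
                  = (ENNReal.ofReal p.1)⁻¹ ^ 2 := by
                rw [← ENNReal.mul_inv (Or.inl ht1) (Or.inl (by simp)), weight_mul_weight ht,
                  ENNReal.inv_pow]
              rw [enorm_mul, hG]
              simp only [div_eq_mul_inv]
              calc _ = ‖f p‖ₑ ^ 2 * ‖g p‖ₑ ^ 2 * ((ω p : ℝ≥0∞)⁻¹ * ω p) *
                    ((ENNReal.ofReal (p.1 ^ (1 - 2 * (α - β + 1))))⁻¹ *
                    (ENNReal.ofReal (p.1 ^ (1 + 2 * (α - β + 1))))⁻¹) := by ring
                _ = _ := by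
                  rw [hinv, ENNReal.inv_mul_cancel hω0 (by simp)]
                  ring
            rw [e, ENNReal.sq_rpow_half]
      _ ≤ _ * _ := lintegral_rpow_half_mul_le
          (((hf.aemeasurable.enorm.pow_const 2).div (by fun_prop)).div (by fun_prop))
          (AEMeasurable.mul (by fun_prop) hGm)
      _ ≤ _ := by gcongr
  -- The divisor may vanish, for instance when `g = 0`; the finiteness of the norm of `f` covers
  -- this case.
  rw [ENNReal.div_le_iff_le_mul (Or.inr hf'.ne) (Or.inl hK)] at hmain
  refine hmain.trans (le_of_eq ?_)
  rw [hM, pairingConst, ENNReal.coe_rpow_of_nonneg _ (by norm_num), mul_assoc,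
    ENNReal.mul_rpow_of_nonneg _ _ (by norm_num), ENNReal.sq_rpow_half, ENNReal.coe_mul]
  change _ * (_ * (_ * D) ^ (1 / 2 : ℝ)) = (_ * D) ^ (1 / 2 : ℝ) * _ * _
  ring

end Norms

/-! ### Admissible weights built from balls -/

section BallWeight

variable {n : ℕ} {ι : Type*}

/-- The weight `∑ b_i r_i ^ (-d) 1_{T(B_i)}` before truncation to finite values. -/
noncomputable def ballWeight (d : ℝ) (b : ι → ℝ≥0∞) (x : ι → EuclideanSpace ℝ (Fin n)) (r : ι → ℝ)
    (p : TX n) : ℝ≥0∞ :=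
  ∑' i, (tent (Metric.ball (x i) (r i))).indicator (fun _ => b i / ENNReal.ofReal (r i ^ d)) p

theorem measurable_ballWeight [Countable ι] (d : ℝ) (b : ι → ℝ≥0∞)
    (x : ι → EuclideanSpace ℝ (Fin n)) (r : ι → ℝ) : Measurable (ballWeight d b x r) :=
  Measurable.tsum fun _ => measurable_const.indicator (measurableSet_tent _)

/-- A tent containing `(t, y)` sits over a ball of radius at least `t`, so the sum is at most `t⁻ᵈ ∑
bᵢ`. Truncation to finite values therefore loses nothing. -/
theorem ballWeight_ne_top (hn : 0 < n) {d : ℝ} (hd : 0 < d) {b : ι → ℝ≥0∞} (hb : ∑' i, b i ≠ ∞)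
    (x : ι → EuclideanSpace ℝ (Fin n)) (r : ι → ℝ) (p : TX n) : ballWeight d b x r p ≠ ∞ := by
  by_cases hp : 0 < p.1
  · have hle : ballWeight d b x r p ≤ (∑' i, b i) / ENNReal.ofReal (p.1 ^ d) := by
      rw [div_eq_mul_inv, ← ENNReal.tsum_mul_right]
      refine ENNReal.tsum_le_tsum fun i => ?_
      by_cases hpi : p ∈ tent (Metric.ball (x i) (r i))
      · rw [indicator_of_mem hpi, div_eq_mul_inv]
        gcongr
        exact tent_ball_fst_le hn hpi
      · simp [hpi]
    refine ne_top_of_le_ne_top (ENNReal.div_ne_top hb ?_) hle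
    simpa using by positivity
  · have : ballWeight d b x r p = 0 :=
      ENNReal.tsum_eq_zero.2 fun i => indicator_of_notMem (fun h => hp h.1) _
    simp [this]

/-- The nontangential maximal function of `1_{T(B)}` is at most `1_B`, which reduces the claim to
sums over balls. -/
theorem capacityIntegral_ballWeight_le {d : ℝ} (hd : 0 < d) {b : ι → ℝ≥0∞}
    (hb : capacityConst n d * ∑' i, b i ≤ 1) (x : ι → EuclideanSpace ℝ (Fin n)) {r : ι → ℝ}
    (hr : ∀ i, 0 < r i) :
    capacityIntegral d (nontangentialMax fun p => (ballWeight d b x r p).toNNReal) ≤ 1 := by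
  refine (capacityIntegral_mono d fun y => ?_).trans
    ((capacityIntegral_tsum_ball_le (x := x) hd b hr).trans hb)
  refine iSup₂_le fun p hp => ENNReal.coe_toNNReal_le_self.trans ?_
  refine ENNReal.tsum_le_tsum fun i => ?_
  by_cases hpi : p ∈ tent (Metric.ball (x i) (r i))
  · rw [indicator_of_mem hpi, indicator_of_mem (hpi.2 (by rwa [Metric.mem_ball, dist_comm]))]
  · simp [hpi]

theorem tsum_ne_top_of_capacityConst_mul_le {d : ℝ} {b : ι → ℝ≥0∞}
    (hb : capacityConst n d * ∑' i, b i ≤ 1) : ∑' i, b i ≠ ∞ := by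
  intro h
  rw [h, ENNReal.mul_top (by simpa using (capacityConst_pos n d).ne')] at hb
  simp at hb

end BallWeight

/-! ### From atomic series to the `T¹`-norm -/

section AtomicSeries

variable {n : ℕ} {α β : ℝ}

/-- The constant bounding the `T¹`-norm of an atomic series. -/
noncomputable def atomConst (n : ℕ) (α β : ℝ) : ℝ≥0 :=
  (capacityConst n (n - 2 * (α + β - 1)) / ballConst n α β) ^ (1 / 2 : ℝ)

theorem atomConst_pos (n : ℕ) (α β : ℝ) : 0 < atomConst n α β :=
  NNReal.rpow_pos (div_pos (capacityConst_pos _ _) (ballConst_pos _ _ _))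

/-- Cauchy–Schwarz against the ball weight `w` with coefficients `|cⱼ|/(κL)` bounds `∑ |cⱼ aⱼ|` by
`(w G)^(1/2)`, where `G = κL ∑ |cⱼ| rⱼᵈ |aⱼ|²`. The normalization of atoms makes the weighted
integral of `G` at most a multiple of `L²`. Finiteness of `w` and of `G` almost everywhere gives
convergence, and `|f|² / w ≤ G` gives the norm bound. A separate `L > 0` avoids dividing by a
vanishing coefficient sum. -/
theorem ae_le_of_forall_atom (hαβ : 0 ≤ α + β - 1) (hd : 0 < (n : ℝ) - 2 * (α + β - 1))
    {c : ℕ → ℂ} {a : ℕ → TX n → ℂ} (ha : ∀ j, IsTentAtom n α β (a j)) {L : ℝ≥0} (hL : 0 < L)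
    (hcL : ∑' j, ‖c j‖ₑ ≤ L) :
    (∀ᵐ p ∂(halfMeasure n), ∑' j, ‖c j * a j p‖ₑ ≠ ∞) ∧
    ∀ f : TX n → ℂ, (∀ᵐ p ∂(halfMeasure n), ‖f p‖ₑ ≤ ∑' j, ‖c j * a j p‖ₑ) →
      tentOneNorm n α β f ≤ atomConst n α β * L := by
  have hn := pos_of_dim_pos hαβ hd
  choose hm x r hr hsupp hint using ha
  set d := (n : ℝ) - 2 * (α + β - 1) with hd_def
  set κ := capacityConst n d with hκ
  have hκ0 : 0 < κ := capacityConst_pos n d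
  have hB := ballConst_pos n α β
  set W : TX n → ℝ≥0∞ := fun p => ENNReal.ofReal (p.1 ^ (1 - 2 * (α - β + 1))) with hW
  have hWm : Measurable W := by fun_prop
  set b : ℕ → ℝ≥0∞ := fun j => ‖c j‖ₑ * (κ * L : ℝ≥0)⁻¹ with hb
  have hκL : 0 < κ * L := by positivity
  have hbsum : κ * ∑' j, b j ≤ 1 := by
    rw [hb, ENNReal.tsum_mul_right]
    calc (κ : ℝ≥0∞) * ((∑' j, ‖c j‖ₑ) * ((κ * L)⁻¹ : ℝ≥0))
        ≤ κ * (L * ((κ * L)⁻¹ : ℝ≥0)) := by gcongr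
      _ = 1 := by
        rw [← ENNReal.coe_mul, ← ENNReal.coe_mul, ← ENNReal.coe_one, ENNReal.coe_inj]
        field_simp
  have hwtop : ∀ p, ballWeight d b x r p ≠ ∞ :=
    ballWeight_ne_top hn hd (tsum_ne_top_of_capacityConst_mul_le hbsum) x r
  set G : TX n → ℝ≥0∞ := fun p => (κ * L : ℝ≥0) *
    ∑' j, ‖c j‖ₑ * ENNReal.ofReal (r j ^ d) * ‖a j p‖ₑ ^ 2 with hG
  have hGm : AEMeasurable G (halfMeasure n) :=
    (AEMeasurable.tsum fun j => ((hm j).aemeasurable.enorm.pow_const 2).const_mul _).const_mul _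
  have hatom : ∀ j, ENNReal.ofReal (r j ^ d) * ∫⁻ p, ‖a j p‖ₑ ^ 2 / W p ∂(halfMeasure n)
      ≤ (ballConst n α β : ℝ≥0∞)⁻¹ := by
    intro j
    have hr' : ENNReal.ofReal (r j ^ d) ≠ 0 := by
      have := hr j
      simpa using by positivity
    have e : ∫⁻ p, ‖a j p‖ₑ ^ 2 / W p ∂(halfMeasure n)
        = ∫⁻ p in tent (Metric.ball (x j) (r j)), ‖a j p‖ₑ ^ 2 / W p := by
      rw [← restrict_halfMeasure_tent, ← lintegral_indicator (measurableSet_tent _)]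
      refine lintegral_congr_ae ((hsupp j).mono fun p hp => ?_)
      by_cases h : p ∈ tent (Metric.ball (x j) (r j))
      · simp [h]
      · simp [h, hp h]
    rw [e]
    refine (mul_le_mul_right (hint j) _).trans (le_of_eq ?_)
    rw [volume_ball_rpow hn hd _ (hr j), one_div, ENNReal.mul_inv (Or.inl hr') (Or.inl (by simp)),
      ← mul_assoc, ENNReal.mul_inv_cancel hr' (by simp), one_mul]
  have hGint : ∫⁻ p, G p / W p ∂(halfMeasure n) ≤ (κ * L * L / ballConst n α β : ℝ≥0) := by
    calc ∫⁻ p, G p / W p ∂(halfMeasure n)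
        = ∫⁻ p, (κ * L : ℝ≥0) * ∑' j, ‖c j‖ₑ * (ENNReal.ofReal (r j ^ d) *
            (‖a j p‖ₑ ^ 2 / W p)) ∂(halfMeasure n) := by
          refine lintegral_congr fun p => ?_
          simp only [hG, div_eq_mul_inv, mul_assoc]
          congr 1
          rw [← ENNReal.tsum_mul_right]
          simp only [mul_assoc]
      _ = (κ * L : ℝ≥0) * ∑' j, ‖c j‖ₑ * (ENNReal.ofReal (r j ^ d) *
            ∫⁻ p, ‖a j p‖ₑ ^ 2 / W p ∂(halfMeasure n)) := by
          have hmj : ∀ j, AEMeasurable (fun p => ‖a j p‖ₑ ^ 2 / W p) (halfMeasure n) :=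
            fun j => ((hm j).aemeasurable.enorm.pow_const 2).div hWm.aemeasurable
          rw [lintegral_const_mul' _ _ ENNReal.coe_ne_top,
            lintegral_tsum fun j => ((hmj j).const_mul _).const_mul _]
          congr 1
          refine tsum_congr fun j => ?_
          rw [lintegral_const_mul' _ _ (by simp), lintegral_const_mul' _ _ (by simp)]
      _ ≤ (κ * L : ℝ≥0) * ∑' j, ‖c j‖ₑ * (ballConst n α β : ℝ≥0∞)⁻¹ := by
          gcongr with j
          exact hatom j
      _ ≤ (κ * L : ℝ≥0) * (L * (ballConst n α β : ℝ≥0∞)⁻¹) := by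
          rw [ENNReal.tsum_mul_right]
          gcongr
      _ = _ := by
          rw [← ENNReal.coe_inv hB.ne', ← ENNReal.coe_mul, ← ENNReal.coe_mul, div_eq_mul_inv,
            mul_assoc (κ * L)]
  have hcs : ∀ᵐ p ∂(halfMeasure n), ∑' j, ‖c j * a j p‖ₑ
      ≤ (ballWeight d b x r p * G p) ^ (1 / 2 : ℝ) := by
    filter_upwards [ae_all_iff.2 hsupp] with p hp
    have hG' : G p = ∑' j, (κ * L : ℝ≥0) * (‖c j‖ₑ * ENNReal.ofReal (r j ^ d) * ‖a j p‖ₑ ^ 2) :=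
      ENNReal.tsum_mul_left.symm
    rw [ENNReal.mul_rpow_of_nonneg _ _ (by norm_num), hG', ballWeight]
    refine le_trans (ENNReal.tsum_le_tsum fun j => ?_) (ENNReal.tsum_rpow_half_mul_le _ _)
    by_cases h : p ∈ tent (Metric.ball (x j) (r j))
    · rw [indicator_of_mem h]
      have hr' : ENNReal.ofReal (r j ^ d) ≠ 0 := by
        have := hr j
        simpa using by positivity
      have e : b j / ENNReal.ofReal (r j ^ d) *
          ((κ * L : ℝ≥0) * (‖c j‖ₑ * ENNReal.ofReal (r j ^ d) * ‖a j p‖ₑ ^ 2))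
          = ‖c j * a j p‖ₑ ^ 2 := by
        have hinv : (((κ * L)⁻¹ : ℝ≥0) : ℝ≥0∞) * (κ * L : ℝ≥0) = 1 := by
          rw [← ENNReal.coe_mul, inv_mul_cancel₀ hκL.ne', ENNReal.coe_one]
        rw [hb, enorm_mul, div_eq_mul_inv]
        calc _ = (‖c j‖ₑ * ‖a j p‖ₑ) ^ 2 * ((((κ * L)⁻¹ : ℝ≥0) : ℝ≥0∞) * (κ * L : ℝ≥0)) *
              ((ENNReal.ofReal (r j ^ d))⁻¹ * ENNReal.ofReal (r j ^ d)) := by ring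
          _ = _ := by rw [hinv, ENNReal.inv_mul_cancel hr' (by simp), mul_one, mul_one]
      rw [e, ENNReal.sq_rpow_half]
    · simp [hp j h]
  have hGtop : ∀ᵐ p ∂(halfMeasure n), G p ≠ ∞ := by
    filter_upwards [ae_lt_top' (hGm.div hWm.aemeasurable) (hGint.trans_lt ENNReal.coe_lt_top).ne]
      with p hp h
    simp only [Pi.div_apply, h] at hp
    rw [ENNReal.top_div_of_ne_top (by simp [hW])] at hp
    exact lt_irrefl _ hp
  refine ⟨?_, fun f hf => ?_⟩
  · filter_upwards [hcs, hGtop] with p hp hp'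
    exact ne_top_of_le_ne_top (ENNReal.rpow_ne_top_of_nonneg (by norm_num)
      (ENNReal.mul_ne_top (hwtop p) hp')) hp
  · have hf2 : ∀ᵐ p ∂(halfMeasure n), ‖f p‖ₑ ^ 2 ≤ G p * ballWeight d b x r p := by
      filter_upwards [hcs, hf] with p hp hp'
      have := ENNReal.rpow_le_rpow (hp'.trans hp) (zero_le_two (α := ℝ))
      rwa [ENNReal.rpow_half_rpow_two, ENNReal.rpow_ofNat, mul_comm] at this
    refine (tentOneNorm_le (measurable_ballWeight d b x r).ennreal_toNNReal
      (capacityIntegral_ballWeight_le hd hbsum x hr) ?_).trans ?_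
    · filter_upwards [hf2] with p hp h0
      have h0' : ballWeight d b x r p = 0 := by
        rw [← ENNReal.coe_toNNReal (hwtop p), h0, ENNReal.coe_zero]
      simpa [h0'] using hp
    · have : atomConst n α β * (L : ℝ≥0∞)
          = ((κ * L * L / ballConst n α β : ℝ≥0) : ℝ≥0∞) ^ (1 / 2 : ℝ) := by
        rw [← ENNReal.coe_rpow_of_nonneg _ (by norm_num), ← ENNReal.coe_mul, ENNReal.coe_inj,
          atomConst, mul_assoc, mul_div_right_comm, NNReal.mul_rpow, ← pow_two,
          ← NNReal.rpow_natCast, ← NNReal.rpow_mul]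
        norm_num [hκ, hd_def]
      rw [this]
      gcongr
      refine (lintegral_mono_ae ?_).trans hGint
      filter_upwards [hf2] with p hp
      gcongr
      rw [ENNReal.coe_toNNReal (hwtop p)]
      exact ENNReal.div_le_of_le_mul hp

theorem ae_summable_of_forall_atom (hαβ : 0 ≤ α + β - 1) (hd : 0 < (n : ℝ) - 2 * (α + β - 1))
    {c : ℕ → ℂ} {a : ℕ → TX n → ℂ} (hc : Summable fun j => ‖c j‖)
    (ha : ∀ j, IsTentAtom n α β (a j)) :
    ∀ᵐ p ∂(halfMeasure n), Summable fun j => ‖c j * a j p‖ := by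
  have hfin : ∑' j, ‖c j‖ₑ ≠ ∞ := by
    simpa [enorm_eq_nnnorm, ENNReal.tsum_coe_ne_top_iff_summable, ← NNReal.summable_coe] using hc
  have hle : ∑' j, ‖c j‖ₑ ≤ ((∑' j, ‖c j‖ₑ).toNNReal + 1 : ℝ≥0) := by
    rw [ENNReal.coe_add, ENNReal.coe_toNNReal hfin]
    exact le_self_add
  filter_upwards [(ae_le_of_forall_atom hαβ hd ha (by positivity) hle).1] with p hp
  simpa only [enorm_eq_nnnorm, ENNReal.tsum_coe_ne_top_iff_summable, ← NNReal.summable_coe,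
    coe_nnnorm] using hp

theorem IsAtomicDecomposition.tsum_enorm_ne_top {f : TX n → ℂ} {c : ℕ → ℂ} {a : ℕ → TX n → ℂ}
    (h : IsAtomicDecomposition n α β f c a) : ∑' j, ‖c j‖ₑ ≠ ∞ := by
  simpa [enorm_eq_nnnorm, ENNReal.tsum_coe_ne_top_iff_summable, ← NNReal.summable_coe]
    using h.summable

theorem IsAtomicDecomposition.tentOneNorm_le (hαβ : 0 ≤ α + β - 1)
    (hd : 0 < (n : ℝ) - 2 * (α + β - 1)) {f : TX n → ℂ} {c : ℕ → ℂ} {a : ℕ → TX n → ℂ}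
    (h : IsAtomicDecomposition n α β f c a) :
    tentOneNorm n α β f ≤ atomConst n α β * ∑' j, ‖c j‖ₑ := by
  have hfin := h.tsum_enorm_ne_top
  have hf : ∀ᵐ p ∂(halfMeasure n), ‖f p‖ₑ ≤ ∑' j, ‖c j * a j p‖ₑ := by
    filter_upwards [h.hasSum] with p hp
    rw [← hp.tsum_eq]
    exact enorm_tsum_le_tsum_enorm
  -- The auxiliary bound `L` has to be positive, hence the sum plus `ε`, with `ε → 0` at the end.
  have key : ∀ ε : ℝ≥0, 0 < ε →
      tentOneNorm n α β f ≤ atomConst n α β * (∑' j, ‖c j‖ₑ + ε) := by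
    intro ε hε
    have := (ae_le_of_forall_atom hαβ hd h.atom (L := (∑' j, ‖c j‖ₑ).toNNReal + ε) (by positivity)
      (by rw [ENNReal.coe_add, ENNReal.coe_toNNReal hfin]; exact le_self_add)).2 f hf
    rwa [ENNReal.coe_add, ENNReal.coe_toNNReal hfin] at this
  have hlim : Tendsto (fun ε : ℝ≥0 => (atomConst n α β : ℝ≥0∞) * (∑' j, ‖c j‖ₑ + ε)) (𝓝[>] 0)
      (𝓝 (atomConst n α β * (∑' j, ‖c j‖ₑ + (0 : ℝ≥0)))) := by
    refine (ENNReal.Tendsto.const_mul (Tendsto.const_add _ ?_) (Or.inr (by simp))).mono_left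
      nhdsWithin_le_nhds
    exact ENNReal.tendsto_coe.2 tendsto_id
  simpa using ge_of_tendsto hlim (eventually_nhdsWithin_of_forall key)

theorem exists_isAtomicDecomposition_of_lt {f : TX n → ℂ} {y : ℝ≥0∞}
    (h : atomicNorm n α β f < y) :
    ∃ c a, IsAtomicDecomposition n α β f c a ∧ ∑' j, ‖c j‖ₑ < y := by
  simpa only [atomicNorm, iInf_lt_iff, exists_prop] using h

theorem IsAtomicDecomposition.atomicNorm_le {f : TX n → ℂ} {c : ℕ → ℂ} {a : ℕ → TX n → ℂ}
    (h : IsAtomicDecomposition n α β f c a) : atomicNorm n α β f ≤ ∑' j, ‖c j‖ₑ :=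
  iInf_le_of_le c <| iInf_le_of_le a <| iInf_le_of_le h le_rfl

theorem tentOneNorm_le_atomicNorm (hαβ : 0 ≤ α + β - 1)
    (hd : 0 < (n : ℝ) - 2 * (α + β - 1)) (f : TX n → ℂ) :
    tentOneNorm n α β f ≤ atomConst n α β * atomicNorm n α β f := by
  rw [mul_comm, ← ENNReal.div_le_iff_le_mul
    (Or.inl (by simpa using (atomConst_pos n α β).ne')) (Or.inl (by simp))]
  refine le_iInf fun c => le_iInf fun a => le_iInf fun h => ENNReal.div_le_of_le_mul ?_
  rw [mul_comm]
  exact h.tentOneNorm_le hαβ hd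

theorem isTentAtom_zero : IsTentAtom n α β 0 :=
  ⟨aestronglyMeasurable_zero, 0, 1, one_pos, by simp, by simp⟩

/-- A decomposition over a countable index set. -/
theorem exists_isAtomicDecomposition_of_countable {ι : Type*} [Countable ι] {f : TX n → ℂ}
    {c : ι → ℂ} {a : ι → TX n → ℂ} (hc : ∑' i, ‖c i‖ₑ ≠ ∞) (ha : ∀ i, IsTentAtom n α β (a i))
    (hf : ∀ᵐ p ∂(halfMeasure n), HasSum (fun i => c i * a i p) (f p)) :
    ∃ c' a', IsAtomicDecomposition n α β f c' a' ∧ ∑' j, ‖c' j‖ₑ = ∑' i, ‖c i‖ₑ := by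
  obtain ⟨e, he⟩ := Countable.exists_injective_nat ι
  have hsum : ∑' j, ‖Function.extend e c 0 j‖ₑ = ∑' i, ‖c i‖ₑ := by
    rw [← he.tsum_eq]
    · exact tsum_congr fun i => by rw [he.extend_apply]
    · intro j hj
      by_contra h
      exact hj (by simp [Function.extend_apply' _ _ _ h])
  refine ⟨Function.extend e c 0, Function.extend e a 0, ⟨?_, fun j => ?_, ?_⟩, hsum⟩
  · rw [← hsum] at hc
    simpa [enorm_eq_nnnorm, ENNReal.tsum_coe_ne_top_iff_summable, ← NNReal.summable_coe] using hc
  · by_cases h : ∃ i, e i = j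
    · obtain ⟨i, rfl⟩ := h
      rw [he.extend_apply]
      exact ha i
    · rw [Function.extend_apply' _ _ _ h]
      exact isTentAtom_zero
  · filter_upwards [hf] with p hp
    rw [← hasSum_extend_zero he] at hp
    convert hp using 1
    ext j
    by_cases h : ∃ i, e i = j
    · obtain ⟨i, rfl⟩ := h
      simp only [he.extend_apply]
    · simp [Function.extend_apply' _ _ _ h]

theorem atomicNorm_le_of_countable {ι : Type*} [Countable ι] {f : TX n → ℂ}
    {c : ι → ℂ} {a : ι → TX n → ℂ} (ha : ∀ i, IsTentAtom n α β (a i))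
    (hf : ∀ᵐ p ∂(halfMeasure n), HasSum (fun i => c i * a i p) (f p)) :
    atomicNorm n α β f ≤ ∑' i, ‖c i‖ₑ := by
  by_cases hc : ∑' i, ‖c i‖ₑ = ∞
  · simp [hc]
  obtain ⟨c', a', h, e⟩ := exists_isAtomicDecomposition_of_countable hc ha hf
  exact e ▸ h.atomicNorm_le

end AtomicSeries

/-! ### From an admissible weight to atoms -/

section Decomposition

variable {n : ℕ} {α β : ℝ}

theorem exists_measurable_disjoint_refinement {X ι : Type*} [MeasurableSpace X] [Countable ι]
    {A : ι → Set X} (hA : ∀ i, MeasurableSet (A i)) :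
    ∃ D : ι → Set X, (∀ i, MeasurableSet (D i)) ∧ (∀ i, D i ⊆ A i) ∧
      Pairwise (Function.onFun Disjoint D) ∧ ⋃ i, A i ⊆ ⋃ i, D i := by
  obtain ⟨e, he⟩ := Countable.exists_injective_nat ι
  refine ⟨fun i => A i \ ⋃ (j) (_ : e j < e i), A j, fun i => ?_, fun i => sdiff_subset, ?_, ?_⟩
  · exact (hA i).diff (MeasurableSet.iUnion fun j => MeasurableSet.iUnion fun _ => hA j)
  · intro i j hij
    rw [Function.onFun, Set.disjoint_left]
    intro p hi hj
    rcases lt_or_gt_of_ne (he.ne hij) with h | h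
    · exact hj.2 (mem_iUnion₂.2 ⟨i, h, hi.1⟩)
    · exact hi.2 (mem_iUnion₂.2 ⟨j, h, hj.1⟩)
  · intro p hp
    have hne : {i | p ∈ A i}.Nonempty := mem_iUnion.1 hp
    have hwf : WellFounded fun i j : ι => e i < e j := (measure e).wf
    refine mem_iUnion.2 ⟨hwf.min _ hne, hwf.min_mem _ hne, fun h => ?_⟩
    obtain ⟨j, hj, hpj⟩ := mem_iUnion₂.1 h
    exact hwf.not_lt_min _ hpj hj

/-- Cutting `f` along sets inside tents, on which the weight is controlled, gives an atomic
decomposition. -/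
theorem exists_isAtomicDecomposition_of_cover {ι : Type*} [Countable ι] (hn : 0 < n)
    (hd : 0 < (n : ℝ) - 2 * (α + β - 1)) {f : TX n → ℂ}
    (hf : AEStronglyMeasurable f (halfMeasure n)) {ω : TX n → ℝ≥0}
    {x : ι → EuclideanSpace ℝ (Fin n)} {r : ι → ℝ} (hr : ∀ i, 0 < r i) {v : ι → ℝ≥0}
    (hv : ∀ i, v i ≠ 0) {A : ι → Set (TX n)} (hA : ∀ i, MeasurableSet (A i))
    (hAtent : ∀ i, A i ⊆ tent (Metric.ball (x i) (r i))) (hAω : ∀ i, ∀ p ∈ A i, ω p ≤ v i)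
    (hcov : ∀ᵐ p ∂(halfMeasure n), f p ≠ 0 → ∃ i, p ∈ A i) {S : ℝ≥0∞} (hStop : S ≠ ∞)
    (hS : ∑' i, v i * ENNReal.ofReal (r i ^ ((n : ℝ) - 2 * (α + β - 1))) ≤ S)
    (hJ : ∫⁻ p, ‖f p‖ₑ ^ 2 / (ω p : ℝ≥0∞) / ENNReal.ofReal (p.1 ^ (1 - 2 * (α - β + 1)))
        ∂(halfMeasure n) ≠ ∞) :
    ∃ c a, IsAtomicDecomposition n α β f c a ∧ ∑' j, ‖c j‖ₑ ≤ (∫⁻ p, ‖f p‖ₑ ^ 2 / (ω p : ℝ≥0∞) /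
        ENNReal.ofReal (p.1 ^ (1 - 2 * (α - β + 1))) ∂(halfMeasure n)) ^ (1 / 2 : ℝ) *
        (S * ballConst n α β) ^ (1 / 2 : ℝ) := by
  set d := (n : ℝ) - 2 * (α + β - 1) with hd_def
  set W : TX n → ℝ≥0∞ := fun p => ENNReal.ofReal (p.1 ^ (1 - 2 * (α - β + 1))) with hW
  have hWm : Measurable W := by fun_prop
  set J := ∫⁻ p, ‖f p‖ₑ ^ 2 / (ω p : ℝ≥0∞) / W p ∂(halfMeasure n) with hJ_def
  obtain ⟨D, hDm, hDA, hDdisj, hDcov⟩ := exists_measurable_disjoint_refinement hA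
  set I : ι → ℝ≥0∞ := fun i => ∫⁻ p in D i, ‖f p‖ₑ ^ 2 / W p ∂(halfMeasure n) with hI
  set R : ι → ℝ≥0∞ := fun i => ENNReal.ofReal (r i ^ d) * ballConst n α β with hR
  have hB := ballConst_pos n α β
  have hR0 : ∀ i, R i ≠ 0 := fun i => by
    have := hr i
    refine mul_ne_zero ?_ (by simpa using hB.ne')
    simpa using by positivity
  have hRtop : ∀ i, R i ≠ ∞ := fun i => ENNReal.mul_ne_top (by simp) (by simp)
  -- The coefficient for which the piece of `f` on `D i`, divided by it, satisfies the atom bound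
  -- with equality when it is nonzero.
  set l : ι → ℝ≥0∞ := fun i => (I i * R i) ^ (1 / 2 : ℝ) with hl
  have hIle : ∀ i, I i ≤ v i * ∫⁻ p in D i, ‖f p‖ₑ ^ 2 / (ω p : ℝ≥0∞) / W p ∂(halfMeasure n) := by
    intro i
    rw [← lintegral_const_mul' _ _ (by simp)]
    refine setLIntegral_mono' (hDm i) fun p hp => ?_
    rw [← mul_div_assoc]
    gcongr
    have h1 : ‖f p‖ₑ ^ 2 / (v i : ℝ≥0∞) ≤ ‖f p‖ₑ ^ 2 / (ω p : ℝ≥0∞) := by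
      gcongr
      exact hAω i p (hDA i hp)
    rwa [ENNReal.div_le_iff_le_mul (Or.inl (by simpa using hv i)) (Or.inl (by simp)),
      mul_comm] at h1
  -- On `D i` the bound `ω ≤ v i` inserts `ω` into the integral. Cauchy–Schwarz then separates the
  -- weighted integral of `f` from the cost `∑ vᵢ rᵢᵈ`.
  have hlsum : ∑' i, l i ≤ J ^ (1 / 2 : ℝ) * (S * ballConst n α β) ^ (1 / 2 : ℝ) := by
    calc ∑' i, l i
        ≤ ∑' i, ((∫⁻ p in D i, ‖f p‖ₑ ^ 2 / (ω p : ℝ≥0∞) / W p ∂(halfMeasure n)) *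
            (v i * R i)) ^ (1 / 2 : ℝ) := by
          refine ENNReal.tsum_le_tsum fun i => ENNReal.rpow_le_rpow ?_ (by norm_num)
          exact (mul_le_mul_left (hIle i) (R i)).trans_eq (by ring)
      _ ≤ _ := ENNReal.tsum_rpow_half_mul_le _ _
      _ ≤ _ := by
          gcongr
          · rw [← lintegral_iUnion hDm hDdisj]
            exact setLIntegral_le_lintegral _ _
          · simp only [hR, ← mul_assoc]
            rw [ENNReal.tsum_mul_right]
            gcongr
  have hlsum' : ∑' i, l i ≠ ∞ := by
    refine ne_top_of_le_ne_top (ENNReal.mul_ne_top ?_ ?_) hlsum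
    · exact ENNReal.rpow_ne_top_of_nonneg (by norm_num) hJ
    · exact ENNReal.rpow_ne_top_of_nonneg (by norm_num) (ENNReal.mul_ne_top hStop (by simp))
  have hltop : ∀ i, l i ≠ ∞ := ENNReal.ne_top_of_tsum_ne_top hlsum'
  set c : ι → ℂ := fun i => ((l i).toReal : ℂ) with hc
  have hcl : ∀ i, ‖c i‖ₑ = l i := fun i => by
    rw [hc, ← ofReal_norm, Complex.norm_real, Real.norm_of_nonneg ENNReal.toReal_nonneg,
      ENNReal.ofReal_toReal (hltop i)]
  set a : ι → TX n → ℂ := fun i p => (c i)⁻¹ * (D i).indicator f p with ha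
  have hl2 : ∀ i, l i ^ 2 = I i * R i := fun i => by
    rw [← ENNReal.rpow_ofNat, hl, ENNReal.rpow_half_rpow_two]
  have hatom : ∀ i, IsTentAtom n α β (a i) := by
    intro i
    refine ⟨(hf.indicator (hDm i)).const_mul _, x i, r i, hr i, ?_, ?_⟩
    · refine Eventually.of_forall fun p hp => ?_
      have : p ∉ D i := fun h => hp (hAtent i (hDA i h))
      simp [ha, this]
    · rw [volume_ball_rpow hn hd _ (hr i), one_div]
      change _ ≤ (R i)⁻¹
      by_cases h0 : c i = 0
      · simp [ha, h0]
      have hl0 : l i ≠ 0 := by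
        rw [← hcl i]
        simpa using h0
      have hI0 : I i ≠ 0 := by
        intro h
        simp [hl, h] at hl0
      have hItop : I i ≠ ∞ := by
        intro h
        refine hltop i ?_
        simp only [hl, h]
        rw [ENNReal.top_mul (hR0 i), ENNReal.top_rpow_of_pos (by norm_num)]
      calc ∫⁻ p in tent (Metric.ball (x i) (r i)), ‖a i p‖ₑ ^ 2 / W p
          ≤ ∫⁻ p, ‖a i p‖ₑ ^ 2 / W p ∂(halfMeasure n) := by
            rw [← restrict_halfMeasure_tent]
            exact setLIntegral_le_lintegral _ _
        _ = ∫⁻ p, (l i ^ 2)⁻¹ * (D i).indicator (fun p => ‖f p‖ₑ ^ 2 / W p) p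
              ∂(halfMeasure n) := by
            refine lintegral_congr fun p => ?_
            by_cases hp : p ∈ D i
            · simp only [ha, hp, indicator_of_mem, enorm_mul, enorm_inv h0, hcl, mul_pow,
                ENNReal.inv_pow, mul_div_assoc]
            · simp [ha, hp]
        _ = (I i * R i)⁻¹ * I i := by
            rw [lintegral_const_mul' _ _ (by simpa using hl0), lintegral_indicator (hDm i), hl2]
        _ ≤ (R i)⁻¹ := by
            rw [ENNReal.mul_inv (Or.inl hI0) (Or.inl hItop), mul_right_comm,
              ENNReal.inv_mul_cancel hI0 hItop, one_mul]
  -- If the coefficient is zero, then `0⁻¹ = 0` makes the atom zero; this agrees with `f` almost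
  -- everywhere on `D i`, because `I i = 0`.
  have hca : ∀ᵐ p ∂(halfMeasure n), ∀ i, c i * a i p = (D i).indicator f p := by
    refine ae_all_iff.2 fun i => ?_
    by_cases h0 : c i = 0
    · have hI0 : I i = 0 := by
        have hl0 : l i = 0 := by rw [← hcl i, h0, enorm_zero]
        have := hl2 i
        rw [hl0] at this
        simpa [hR0 i] using this.symm
      have hI0' : ∫⁻ p in D i, ‖f p‖ₑ ^ 2 / W p ∂(halfMeasure n) = 0 := hI0
      rw [lintegral_eq_zero_iff' (f := fun p => ‖f p‖ₑ ^ 2 / W p)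
        (((hf.aemeasurable.enorm.pow_const 2).div hWm.aemeasurable).restrict), Filter.EventuallyEq, ae_restrict_iff' (hDm i)] at hI0'
      filter_upwards [hI0'] with p hp
      by_cases hpD : p ∈ D i
      · have := hp hpD
        simp only [Pi.zero_apply, ENNReal.div_eq_zero_iff] at this
        have hf0 : f p = 0 := by simpa [hW] using this
        simp [ha, h0, hf0, hpD]
      · simp [ha, hpD]
    · exact Eventually.of_forall fun p => mul_inv_cancel_left₀ h0 _
  obtain ⟨c', a', h, e⟩ := exists_isAtomicDecomposition_of_countable (f := f) (c := c)
    (by simpa only [hcl] using hlsum') hatom (by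
      filter_upwards [hca, hcov] with p hp hp'
      simp only [hp]
      by_cases hfp : f p = 0
      · have : (fun i => (D i).indicator f p) = 0 := by
          ext i
          simp [indicator, hfp]
        rw [this, hfp]
        exact hasSum_zero
      · obtain ⟨i, hi⟩ := hp' hfp
        obtain ⟨j, hj⟩ := mem_iUnion.1 (hDcov (mem_iUnion.2 ⟨i, hi⟩))
        have := hasSum_single (f := fun i => (D i).indicator f p) j fun k hk =>
          indicator_of_notMem (Set.disjoint_left.1 (hDdisj hk.symm) hj) f
        simpa [hj] using this)
  refine ⟨c', a', h, ?_⟩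
  rw [e]
  simpa only [hcl] using hlsum

/-- Superlevel capacities decrease in the level, and `2ᵏ` is twice the length of `(2ᵏ⁻¹, 2ᵏ]`. -/
theorem tsum_zpow_mul_hausdorffCapacity_le {d : ℝ} {h : EuclideanSpace ℝ (Fin n) → ℝ≥0∞} :
    ∑' k : ℤ, ENNReal.ofReal (2 ^ k) * hausdorffCapacity d {x | ENNReal.ofReal (2 ^ k) < h x}
      ≤ 2 * capacityIntegral d h := by
  set F : ℝ → ℝ≥0∞ := fun s => hausdorffCapacity d {x | ENNReal.ofReal s < h x} with hF
  have hanti : Antitone F := fun s t hst =>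
    hausdorffCapacity_mono d fun x hx => (ENNReal.ofReal_le_ofReal hst).trans_lt hx
  have hk : ∀ k : ℤ, ENNReal.ofReal (2 ^ k) * F (2 ^ k)
      ≤ 2 * ∫⁻ s in Ioc ((2 : ℝ) ^ (k - 1)) (2 ^ k), F s := by
    intro k
    have hvol : ENNReal.ofReal (2 ^ k)
        = 2 * volume (Ioc ((2 : ℝ) ^ (k - 1)) (2 ^ k)) := by
      rw [Real.volume_Ioc, ← ENNReal.ofReal_ofNat 2, ← ENNReal.ofReal_mul (by norm_num),
        zpow_sub_one₀ two_ne_zero]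
      congr 1
      ring
    rw [hvol, mul_assoc, mul_comm (volume _), ← setLIntegral_const]
    exact mul_le_mul_right (setLIntegral_mono' measurableSet_Ioc fun s hs => hanti hs.2) 2
  have hdisj : Pairwise (Function.onFun Disjoint fun k : ℤ => Ioc ((2 : ℝ) ^ (k - 1)) (2 ^ k)) := by
    intro j k hjk
    rw [Function.onFun, Set.disjoint_left]
    rintro s ⟨h1, h2⟩ ⟨h3, h4⟩
    have h5 := (zpow_lt_zpow_iff_right₀ (one_lt_two (α := ℝ))).1 (h1.trans_le h4)
    have h6 := (zpow_lt_zpow_iff_right₀ (one_lt_two (α := ℝ))).1 (h3.trans_le h2)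
    omega
  calc _ ≤ ∑' k : ℤ, 2 * ∫⁻ s in Ioc ((2 : ℝ) ^ (k - 1)) (2 ^ k), F s := ENNReal.tsum_le_tsum hk
    _ = 2 * ∫⁻ s in ⋃ k : ℤ, Ioc ((2 : ℝ) ^ (k - 1)) (2 ^ k), F s := by
        rw [ENNReal.tsum_mul_left, lintegral_iUnion (fun _ => measurableSet_Ioc) hdisj]
    _ ≤ _ := by
        refine mul_le_mul_right (lintegral_mono_set (iUnion_subset fun k s hs => ?_)) 2
        exact lt_trans (by positivity) hs.1

/-- The constant bounding the atomic norm by the `T¹`-norm. -/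
noncomputable def decompositionConst (n : ℕ) (α β : ℝ) : ℝ≥0 :=
  (6 * Real.toNNReal (3 ^ ((n : ℝ) - 2 * (α + β - 1)) + 16 ^ ((n : ℝ) - 2 * (α + β - 1)))
    * ballConst n α β) ^ (1 / 2 : ℝ)

theorem decompositionConst_pos (n : ℕ) (α β : ℝ) : 0 < decompositionConst n α β := by
  have h : 0 < Real.toNNReal
      (3 ^ ((n : ℝ) - 2 * (α + β - 1)) + 16 ^ ((n : ℝ) - 2 * (α + β - 1))) :=
    Real.toNNReal_pos.2 (by positivity)
  have := ballConst_pos n α β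
  exact NNReal.rpow_pos (by positivity)

/-- A point with `2ᵏ < ω` lies in the tent over `{Nω > 2ᵏ}`, which is covered by tents over balls at
a cost comparable to the capacity. Cutting `f` where also `ω ≤ 2ᵏ⁺¹` gives pieces with total cost `∑
2ᵏ⁺¹ rᵈ`, and this is bounded through the dyadic sum of capacities. -/
theorem exists_isAtomicDecomposition_of_weight (hαβ : 0 ≤ α + β - 1)
    (hd : 0 < (n : ℝ) - 2 * (α + β - 1)) {f : TX n → ℂ}
    (hf : AEStronglyMeasurable f (halfMeasure n)) {ω : TX n → ℝ≥0} (hω : Measurable ω)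
    (hcap : capacityIntegral (n - 2 * (α + β - 1)) (nontangentialMax ω) ≤ 1)
    (hz : ∀ᵐ p ∂(halfMeasure n), ω p = 0 → f p = 0)
    (hJ : ∫⁻ p, ‖f p‖ₑ ^ 2 / (ω p : ℝ≥0∞) / ENNReal.ofReal (p.1 ^ (1 - 2 * (α - β + 1)))
        ∂(halfMeasure n) ≠ ∞) :
    ∃ c a, IsAtomicDecomposition n α β f c a ∧ ∑' j, ‖c j‖ₑ ≤ decompositionConst n α β *
      (∫⁻ p, ‖f p‖ₑ ^ 2 / (ω p : ℝ≥0∞) / ENNReal.ofReal (p.1 ^ (1 - 2 * (α - β + 1)))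
        ∂(halfMeasure n)) ^ (1 / 2 : ℝ) := by
  have hn := pos_of_dim_pos hαβ hd
  set d := (n : ℝ) - 2 * (α + β - 1) with hd_def
  set E := ENNReal.ofReal (3 ^ d + 16 ^ d) with hE
  let O : ℤ → Set (EuclideanSpace ℝ (Fin n)) := fun k =>
    {x | ENNReal.ofReal (2 ^ k) < nontangentialMax ω x}
  have hsumO : ∑' k : ℤ, ENNReal.ofReal (2 ^ k) * hausdorffCapacity d (O k) ≤ 2 :=
    tsum_zpow_mul_hausdorffCapacity_le.trans (by simpa using mul_le_mul_right hcap 2)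
  -- The slack `2⁻ᵏ εₖ` makes room for near-optimal coverings even where the capacity is zero, and
  -- adds at most 1 after weighting by `2ᵏ`. This is the origin of `6 = 2 · (2 + 1)`.
  obtain ⟨ε, hε, hεsum⟩ := ENNReal.exists_pos_sum_of_countable one_ne_zero ℤ
  have h2inv : ∀ k : ℤ, ENNReal.ofReal ((2 : ℝ) ^ k) * ENNReal.ofReal (2 ^ (-k)) = 1 := by
    intro k
    rw [← ENNReal.ofReal_mul (by positivity), ← zpow_add₀ two_ne_zero, add_neg_cancel, zpow_zero,
      ENNReal.ofReal_one]
  have hOtop : ∀ k, hausdorffCapacity d (O k) ≠ ∞ := by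
    intro k h
    have := (ENNReal.le_tsum k).trans hsumO
    rw [h, ENNReal.mul_top (by simpa using by positivity)] at this
    simp at this
  have hlt : ∀ k, hausdorffCapacity d (O k)
      < hausdorffCapacity d (O k) + ENNReal.ofReal (2 ^ (-k)) * ε k := by
    intro k
    refine ENNReal.lt_add_right (hOtop k) (mul_ne_zero ?_ (by simpa using (hε k).ne'))
    simpa using by positivity
  choose ι hι x r hr hcov hsum using fun k =>
    exists_tent_cover_of_hausdorffCapacity_lt hd (by rw [hd_def]; linarith) (hlt k)
  have hS : ∑' q : (Σ k, ι k), (((2 : ℝ≥0) ^ (q.1 + 1) : ℝ≥0) : ℝ≥0∞) *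
      ENNReal.ofReal (r q.1 q.2 ^ d) ≤ 6 * E := by
    have h2 : ∀ k : ℤ, (((2 : ℝ≥0) ^ (k + 1) : ℝ≥0) : ℝ≥0∞) = 2 * ENNReal.ofReal (2 ^ k) := by
      intro k
      rw [zpow_add_one₀ two_ne_zero, mul_comm, ENNReal.coe_mul, ENNReal.coe_ofNat]
      congr 1
      rw [ENNReal.ofReal, Real.toNNReal_zpow (by norm_num)]
      simp
    calc _ = ∑' k, 2 * ENNReal.ofReal (2 ^ k) * ∑' i, ENNReal.ofReal (r k i ^ d) := by
          rw [ENNReal.tsum_sigma']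
          refine tsum_congr fun k => ?_
          rw [← ENNReal.tsum_mul_left]
          exact tsum_congr fun i => by rw [h2]
      _ ≤ ∑' k, 2 * ENNReal.ofReal (2 ^ k) *
            (E * (hausdorffCapacity d (O k) + ENNReal.ofReal (2 ^ (-k)) * ε k)) := by
          gcongr with k
          exact hsum k
      _ = 2 * E * ∑' k : ℤ, (ENNReal.ofReal (2 ^ k) * hausdorffCapacity d (O k) + ε k) := by
          rw [← ENNReal.tsum_mul_left]
          refine tsum_congr fun k => ?_
          calc _ = 2 * E * (ENNReal.ofReal (2 ^ k) * hausdorffCapacity d (O k) +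
                (ENNReal.ofReal ((2 : ℝ) ^ k) * ENNReal.ofReal (2 ^ (-k))) * ε k) := by ring
            _ = _ := by rw [h2inv, one_mul]
      _ ≤ 2 * E * (2 + 1) := by
          rw [ENNReal.tsum_add]
          gcongr
      _ = 6 * E := by ring
  have hcovae : ∀ᵐ p ∂(halfMeasure n), f p ≠ 0 → ∃ q : (Σ k, ι k),
      p ∈ {p | 2 ^ q.1 < ω p ∧ ω p ≤ 2 ^ (q.1 + 1)} ∩
        tent (Metric.ball (x q.1 q.2) (r q.1 q.2)) := by
    filter_upwards [hz, ae_halfMeasure_pos] with p hp ht hfp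
    have hω0 : 0 < ω p := pos_iff_ne_zero.2 fun h => hfp (hp h)
    obtain ⟨k, hk, hk'⟩ := exists_mem_Ioc_zpow (y := (2 : ℝ≥0)) hω0 (by norm_num)
    have hpO : p ∈ tent (O k) := by
      refine ⟨ht, fun y hy => lt_of_lt_of_le ?_ (le_iSup₂_of_le
        (f := fun (p : TX n) (_ : dist p.2 y < p.1) => (ω p : ℝ≥0∞)) p
        (by rw [dist_comm]; exact hy) le_rfl)⟩
      rw [ENNReal.ofReal, ENNReal.coe_lt_coe, Real.toNNReal_zpow (by norm_num)]
      simpa using hk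
    obtain ⟨i, hi⟩ := mem_iUnion.1 (hcov k hpO)
    exact ⟨⟨k, i⟩, ⟨hk, hk'⟩, hi⟩
  obtain ⟨c, a, h, hle⟩ := exists_isAtomicDecomposition_of_cover hn hd hf (ω := ω)
    (x := fun q : (Σ k, ι k) => x q.1 q.2) (r := fun q => r q.1 q.2) (fun q => hr q.1 q.2)
    (v := fun q => 2 ^ (q.1 + 1)) (fun q => by positivity)
    (fun q => ((measurableSet_lt measurable_const hω).inter
      (measurableSet_le hω measurable_const)).inter (measurableSet_tent _))
    (fun q => inter_subset_right) (fun q p hp => hp.1.2) hcovae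
    (ENNReal.mul_ne_top (by simp) (by simp [hE])) hS hJ
  refine ⟨c, a, h, hle.trans (le_of_eq ?_)⟩
  rw [mul_comm, decompositionConst, ENNReal.coe_rpow_of_nonneg _ (by norm_num)]
  push_cast
  rfl

theorem atomicNorm_le_tentOneNorm (hαβ : 0 ≤ α + β - 1)
    (hd : 0 < (n : ℝ) - 2 * (α + β - 1)) {f : TX n → ℂ}
    (hf : AEStronglyMeasurable f (halfMeasure n)) :
    atomicNorm n α β f ≤ decompositionConst n α β * tentOneNorm n α β f := by
  have hC := decompositionConst_pos n α β
  rw [mul_comm, ← ENNReal.div_le_iff_le_mul (Or.inl (by simpa using hC.ne')) (Or.inl (by simp))]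
  refine le_tentOneNorm fun ω hω hcap hz => ENNReal.div_le_of_le_mul ?_
  rw [mul_comm]
  by_cases hJ : ∫⁻ p, ‖f p‖ₑ ^ 2 / (ω p : ℝ≥0∞) / ENNReal.ofReal (p.1 ^ (1 - 2 * (α - β + 1)))
        ∂(halfMeasure n) = ∞
  · rw [hJ, ENNReal.top_rpow_of_pos (by norm_num), ENNReal.mul_top (by simpa using hC.ne')]
    exact le_top
  · obtain ⟨c, a, h, hle⟩ := exists_isAtomicDecomposition_of_weight hαβ hd hf hω hcap hz hJ
    exact h.atomicNorm_le.trans hle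

theorem tentOneNorm_lt_top_iff_exists_decomposition (hαβ : 0 ≤ α + β - 1)
    (hd : 0 < (n : ℝ) - 2 * (α + β - 1)) {f : TX n → ℂ}
    (hf : AEStronglyMeasurable f (halfMeasure n)) :
    tentOneNorm n α β f < ∞ ↔ ∃ c a, IsAtomicDecomposition n α β f c a := by
  constructor
  · intro h
    obtain ⟨ω, hω, hcap, hz, hJ⟩ := tentOneNorm_lt_top_iff.1 h
    obtain ⟨c, a, h, -⟩ := exists_isAtomicDecomposition_of_weight hαβ hd hf hω hcap hz hJ.ne
    exact ⟨c, a, h⟩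
  · rintro ⟨c, a, h⟩
    exact (h.tentOneNorm_le hαβ hd).trans_lt
      (ENNReal.mul_lt_top (by simp) (lt_top_iff_ne_top.2 h.tsum_enorm_ne_top))

theorem tentOneNorm_lt_top_iff_atomicNorm_lt_top (hαβ : 0 ≤ α + β - 1)
    (hd : 0 < (n : ℝ) - 2 * (α + β - 1)) {f : TX n → ℂ}
    (hf : AEStronglyMeasurable f (halfMeasure n)) :
    tentOneNorm n α β f < ∞ ↔ atomicNorm n α β f < ∞ :=
  ⟨fun h => (atomicNorm_le_tentOneNorm hαβ hd hf).trans_lt (ENNReal.mul_lt_top (by simp) h),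
    fun h => (tentOneNorm_le_atomicNorm hαβ hd f).trans_lt (ENNReal.mul_lt_top (by simp) h)⟩

end Decomposition

/-! ### Properties of the atomic norm -/

section AtomicNorm

variable {n : ℕ} {α β : ℝ}

theorem IsAtomicDecomposition.congr {f g : TX n → ℂ} {c : ℕ → ℂ} {a : ℕ → TX n → ℂ}
    (h : IsAtomicDecomposition n α β f c a) (hfg : f =ᵐ[halfMeasure n] g) :
    IsAtomicDecomposition n α β g c a :=
  ⟨h.summable, h.atom, by filter_upwards [h.hasSum, hfg] with p hp hp'; rwa [← hp']⟩

theorem atomicNorm_congr {f g : TX n → ℂ} (hfg : f =ᵐ[halfMeasure n] g) :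
    atomicNorm n α β f = atomicNorm n α β g := by
  refine le_antisymm ?_ ?_
  · exact le_iInf fun c => le_iInf fun a => le_iInf fun h => (h.congr hfg.symm).atomicNorm_le
  · exact le_iInf fun c => le_iInf fun a => le_iInf fun h => (h.congr hfg).atomicNorm_le

theorem tentInftyNorm_congr {f g : TX n → ℂ} (hfg : f =ᵐ[halfMeasure n] g) :
    tentInftyNorm n α β f = tentInftyNorm n α β g := by
  unfold tentInftyNorm
  congr! 7 with x r hr
  rw [← restrict_halfMeasure_tent]
  refine lintegral_congr_ae (ae_restrict_of_ae ?_)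
  filter_upwards [hfg] with p hp
  rw [hp]

theorem ae_summable_of_countable (hαβ : 0 ≤ α + β - 1) (hd : 0 < (n : ℝ) - 2 * (α + β - 1))
    {ι : Type*} [Countable ι] {c : ι → ℂ} {a : ι → TX n → ℂ} (hc : ∑' i, ‖c i‖ₑ ≠ ∞)
    (ha : ∀ i, IsTentAtom n α β (a i)) :
    ∀ᵐ p ∂(halfMeasure n), Summable fun i => c i * a i p := by
  obtain ⟨e, he⟩ := Countable.exists_injective_nat ι
  have hc' : Summable fun j => ‖Function.extend e c 0 j‖ := by
    have : (fun j => ‖Function.extend e c 0 j‖) = Function.extend e (fun i => ‖c i‖) 0 := by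
      ext j
      by_cases h : ∃ i, e i = j
      · obtain ⟨i, rfl⟩ := h
        simp only [he.extend_apply]
      · simp [Function.extend_apply' _ _ _ h]
    rw [this, summable_extend_zero he]
    simpa [enorm_eq_nnnorm, ENNReal.tsum_coe_ne_top_iff_summable, ← NNReal.summable_coe] using hc
  have ha' : ∀ j, IsTentAtom n α β (Function.extend e a 0 j) := by
    intro j
    by_cases h : ∃ i, e i = j
    · obtain ⟨i, rfl⟩ := h
      rw [he.extend_apply]
      exact ha i
    · rw [Function.extend_apply' _ _ _ h]
      exact isTentAtom_zero
  filter_upwards [ae_summable_of_forall_atom hαβ hd hc' ha'] with p hp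
  have := (Summable.of_norm hp).comp_injective he
  simpa only [Function.comp_def, he.extend_apply] using this

/-- Countable subadditivity of the atomic norm. -/
theorem ae_summable_and_atomicNorm_le_tsum (hαβ : 0 ≤ α + β - 1)
    (hd : 0 < (n : ℝ) - 2 * (α + β - 1)) {ι : Type} [Countable ι] {h : ι → TX n → ℂ}
    (hfin : ∑' k, atomicNorm n α β (h k) ≠ ∞) :
    (∀ᵐ p ∂(halfMeasure n), Summable fun k => h k p) ∧
    ∀ f : TX n → ℂ, (∀ᵐ p ∂(halfMeasure n), HasSum (fun k => h k p) (f p)) →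
      atomicNorm n α β f ≤ ∑' k, atomicNorm n α β (h k) := by
  have key : ∀ ε : ℝ≥0∞, ε ≠ 0 → ε ≠ ∞ →
      (∀ᵐ p ∂(halfMeasure n), Summable fun k => h k p) ∧
      ∀ f : TX n → ℂ, (∀ᵐ p ∂(halfMeasure n), HasSum (fun k => h k p) (f p)) →
        atomicNorm n α β f ≤ ∑' k, atomicNorm n α β (h k) + ε := by
    -- Near-optimal decompositions of all `h k`, with summable errors, are pooled into one family
    -- over `ι × ℕ`. Its almost everywhere summability allows summing first over the atoms of each
    -- `h k`.
    intro ε hε hεtop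
    obtain ⟨δ, hδ, hδsum⟩ := ENNReal.exists_pos_sum_of_countable hε ι
    have hlt : ∀ k, atomicNorm n α β (h k) < atomicNorm n α β (h k) + δ k := fun k =>
      ENNReal.lt_add_right (ENNReal.ne_top_of_tsum_ne_top hfin k) (by simpa using (hδ k).ne')
    choose c a hca hlt' using fun k => exists_isAtomicDecomposition_of_lt (hlt k)
    have hsum : ∑' q : ι × ℕ, ‖c q.1 q.2‖ₑ ≤ ∑' k, atomicNorm n α β (h k) + ε := by
      rw [ENNReal.tsum_prod']
      calc _ ≤ ∑' k, (atomicNorm n α β (h k) + δ k) :=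
            ENNReal.tsum_le_tsum fun k => (hlt' k).le
        _ ≤ _ := by
          rw [ENNReal.tsum_add]
          gcongr
    have hsum' : ∑' q : ι × ℕ, ‖c q.1 q.2‖ₑ ≠ ∞ :=
      ne_top_of_le_ne_top (ENNReal.add_ne_top.2 ⟨hfin, hεtop⟩) hsum
    have hae := ae_summable_of_countable hαβ hd (c := fun q : ι × ℕ => c q.1 q.2)
      (a := fun q => a q.1 q.2) hsum' fun q => (hca q.1).atom q.2
    have hdec : ∀ᵐ p ∂(halfMeasure n), ∀ k, HasSum (fun j => c k j * a k j p) (h k p) :=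
      ae_all_iff.2 fun k => (hca k).hasSum
    refine ⟨?_, fun f hf => ?_⟩
    · filter_upwards [hae, hdec] with p hp hp'
      exact (hp.hasSum.prod_fiberwise hp').summable
    · refine (atomicNorm_le_of_countable (c := fun q : ι × ℕ => c q.1 q.2)
        (a := fun q => a q.1 q.2) (fun q => (hca q.1).atom q.2) ?_).trans hsum
      filter_upwards [hae, hdec, hf] with p hp hp' hfp
      rw [hfp.unique (hp.hasSum.prod_fiberwise hp')]
      exact hp.hasSum
  refine ⟨(key 1 one_ne_zero ENNReal.one_ne_top).1, fun f hf => ?_⟩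
  refine ENNReal.le_of_forall_pos_le_add fun ε hε _ => ?_
  exact (key ε (by simpa using hε.ne') ENNReal.coe_ne_top).2 f hf

theorem atomicNorm_add_le (hαβ : 0 ≤ α + β - 1) (hd : 0 < (n : ℝ) - 2 * (α + β - 1))
    {f g h : TX n → ℂ} (hh : ∀ᵐ p ∂(halfMeasure n), h p = f p + g p) :
    atomicNorm n α β h ≤ atomicNorm n α β f + atomicNorm n α β g := by
  by_cases hfin : atomicNorm n α β f + atomicNorm n α β g = ∞
  · simp [hfin]
  have e : ∑' b : Bool, atomicNorm n α β (cond b f g)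
      = atomicNorm n α β f + atomicNorm n α β g := by simp [tsum_fintype]
  rw [← e]
  refine (ae_summable_and_atomicNorm_le_tsum hαβ hd (by rwa [e])).2 h (hh.mono fun p hp => ?_)
  rw [hp]
  convert hasSum_fintype (fun b : Bool => cond b f g p) using 1
  simp

theorem atomicNorm_zero : atomicNorm n α β 0 = 0 := by
  refine le_antisymm ?_ zero_le
  refine (atomicNorm_le_of_countable (ι := Empty) (c := fun _ => 0) (a := fun _ => 0)
    (fun i => i.elim) (Eventually.of_forall fun p => ?_)).trans (by simp)
  simp

theorem atomicNorm_smul_le (k : ℂ) {f h : TX n → ℂ} (hh : ∀ᵐ p ∂(halfMeasure n), h p = k * f p) :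
    atomicNorm n α β h ≤ ‖k‖ₑ * atomicNorm n α β f := by
  by_cases hk : k = 0
  · rw [atomicNorm_congr (g := 0) (hh.mono fun p hp => by simp [hp, hk]), atomicNorm_zero]
    exact zero_le
  rw [mul_comm, ← ENNReal.div_le_iff_le_mul (Or.inl (by simpa using hk)) (Or.inl (by simp))]
  refine le_iInf fun c => le_iInf fun a => le_iInf fun hca => ENNReal.div_le_of_le_mul ?_
  have : IsAtomicDecomposition n α β h (fun j => k * c j) a := by
    refine ⟨by simpa [norm_mul] using hca.summable.mul_left ‖k‖, hca.atom, ?_⟩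
    filter_upwards [hh, hca.hasSum] with p hp hp'
    rw [hp]
    simpa only [mul_assoc] using hp'.mul_left k
  refine this.atomicNorm_le.trans (le_of_eq ?_)
  simp only [enorm_mul]
  rw [ENNReal.tsum_mul_left, mul_comm]

theorem atomicNorm_smul (k : ℂ) {f h : TX n → ℂ} (hh : ∀ᵐ p ∂(halfMeasure n), h p = k * f p) :
    atomicNorm n α β h = ‖k‖ₑ * atomicNorm n α β f := by
  refine le_antisymm (atomicNorm_smul_le k hh) ?_
  by_cases hk : k = 0
  · simp [hk]
  calc ‖k‖ₑ * atomicNorm n α β f ≤ ‖k‖ₑ * (‖k⁻¹‖ₑ * atomicNorm n α β h) := by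
        gcongr
        refine atomicNorm_smul_le k⁻¹ (hh.mono fun p hp => ?_)
        rw [hp, inv_mul_cancel_left₀ hk]
    _ = _ := by
        rw [← mul_assoc, ← enorm_mul, mul_inv_cancel₀ hk, enorm_one, one_mul]

theorem measure_tent_ball_le (hn : 0 < n) (x : EuclideanSpace ℝ (Fin n)) {r : ℝ} (hr : 0 < r) :
    volume (tent (Metric.ball x r)) ≤ ENNReal.ofReal (r ^ (n + 1)) *
      volume (Metric.ball (0 : EuclideanSpace ℝ (Fin n)) 1) := by
  have hsub : tent (Metric.ball x r) ⊆ Ioc 0 r ×ˢ Metric.ball x r := fun p hp =>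
    ⟨⟨hp.1, tent_ball_fst_le hn hp⟩, hp.2 (Metric.mem_ball_self hp.1)⟩
  refine (measure_mono hsub).trans (le_of_eq ?_)
  rw [Measure.volume_eq_prod, Measure.prod_prod, Real.volume_Ioc,
    Measure.addHaar_ball_of_pos _ _ hr, finrank_euclideanSpace_fin, ← mul_assoc,
    ← ENNReal.ofReal_mul (by linarith), sub_zero, pow_succ']

/-- Qualitative converse of `lintegral_tent_le_tentInftyNorm`. -/
theorem tentInftyNorm_lt_top_of_carleson (hn : 0 < n) (hd : 0 < (n : ℝ) - 2 * (α + β - 1))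
    {g : TX n → ℂ} {M : ℝ≥0∞} (hM : M ≠ ∞)
    (h : ∀ (x : EuclideanSpace ℝ (Fin n)) (r : ℝ), 0 < r →
      ∫⁻ p in tent (Metric.ball x r), ‖g p‖ₑ ^ 2 / ENNReal.ofReal (p.1 ^ (1 + 2 * (α - β + 1)))
        ≤ M * ENNReal.ofReal (r ^ ((n : ℝ) - 2 * (α + β - 1)))) :
    tentInftyNorm n α β g < ∞ := by
  have hB := ballConst_pos n α β
  refine lt_of_le_of_lt (b := (M / ballConst n α β) ^ (1 / 2 : ℝ)) ?_ ?_
  · refine iSup_le fun x => iSup₂_le fun r hr => ?_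
    refine ENNReal.rpow_le_rpow ?_ (by norm_num)
    rw [volume_ball_rpow hn hd x hr]
    refine ENNReal.div_le_of_le_mul ((h x r hr).trans (le_of_eq ?_))
    rw [mul_comm (ENNReal.ofReal _), ← mul_assoc, ENNReal.div_mul_cancel (by simpa using hB.ne')
      (by simp)]
  · exact ENNReal.rpow_lt_top_of_nonneg (by norm_num)
      (ENNReal.div_ne_top hM (by simpa using hB.ne'))

/-- The tents over the balls `B(0, m + 1)` exhaust the half-space. -/
theorem ae_of_forall_tent {P : TX n → Prop}
    (h : ∀ m : ℕ, ∀ᵐ p ∂(halfMeasure n), p ∈ tent (Metric.ball 0 (m + 1 : ℝ)) → P p) :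
    ∀ᵐ p ∂(halfMeasure n), P p := by
  filter_upwards [ae_all_iff.2 h, ae_halfMeasure_pos] with p hp ht
  obtain ⟨m, hm⟩ := exists_nat_ge (‖p.2‖ + p.1)
  refine hp m ⟨ht, fun y hy => ?_⟩
  rw [mem_ball_zero_iff]
  have h1 := norm_sub_norm_le y p.2
  rw [Metric.mem_ball, dist_eq_norm] at hy
  linarith

/-- Testing against powers of `t` restricted to tents shows that the `T¹`-norm is definite. -/
theorem ae_eq_zero_of_tentOneNorm_eq_zero (hαβ : 0 ≤ α + β - 1)
    (hd : 0 < (n : ℝ) - 2 * (α + β - 1)) {f : TX n → ℂ}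
    (hf : AEStronglyMeasurable f (halfMeasure n)) (h0 : tentOneNorm n α β f = 0) :
    ∀ᵐ p ∂(halfMeasure n), f p = 0 := by
  have hn := pos_of_dim_pos hαβ hd
  refine ae_of_forall_tent fun m => ?_
  set K := tent (Metric.ball (0 : EuclideanSpace ℝ (Fin n)) (m + 1 : ℝ)) with hK
  set V := volume (Metric.ball (0 : EuclideanSpace ℝ (Fin n)) 1) with hV
  have hVtop : V ≠ ∞ := measure_ball_lt_top.ne
  have hKtop : volume K ≠ ∞ := ne_top_of_le_ne_top (ENNReal.mul_ne_top (by simp) hVtop)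
    (measure_tent_ball_le hn 0 (by positivity))
  -- The power of `t` is chosen so that `|g|² t^(-1-2γ)` is the indicator of `K`: the measure to be
  -- tested is Lebesgue measure on `K`.
  set g : TX n → ℂ := K.indicator fun p => ((p.1 ^ ((1 + 2 * (α - β + 1)) / 2) : ℝ) : ℂ) with hg
  have hgm : Measurable g := Measurable.indicator (by fun_prop) (measurableSet_tent _)
  have hgsq : ∀ p, ‖g p‖ₑ ^ 2 / ENNReal.ofReal (p.1 ^ (1 + 2 * (α - β + 1)))
      ≤ K.indicator 1 p := by
    intro p
    by_cases hp : p ∈ K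
    · have ht : 0 < p.1 := hp.1
      rw [hg, indicator_of_mem hp, indicator_of_mem hp]
      refine ENNReal.div_le_of_le_mul ?_
      rw [Pi.one_apply, one_mul, ← ofReal_norm, Complex.norm_real,
        Real.norm_of_nonneg (by positivity), ← ENNReal.ofReal_pow (by positivity),
        ← Real.rpow_natCast, ← Real.rpow_mul ht.le]
      apply le_of_eq
      congr 2
      push_cast
      ring
    · simp [hg, hp]
  have hgfin : tentInftyNorm n α β g < ∞ := by
    refine tentInftyNorm_lt_top_of_carleson hn hd (M := V + volume K)
      (ENNReal.add_ne_top.2 ⟨hVtop, hKtop⟩) fun x r hr => ?_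
    have hle : ∫⁻ p in tent (Metric.ball x r),
        ‖g p‖ₑ ^ 2 / ENNReal.ofReal (p.1 ^ (1 + 2 * (α - β + 1)))
        ≤ volume (K ∩ tent (Metric.ball x r)) := by
      refine (lintegral_mono hgsq).trans (le_of_eq ?_)
      rw [lintegral_indicator_one (measurableSet_tent _),
        Measure.restrict_apply (measurableSet_tent _)]
    refine hle.trans ?_
    -- Small balls use the tent volume `rⁿ⁺¹ ≤ rᵈ`, valid as `d ≤ n`; for large ones `rᵈ ≥ 1` and
    -- the volume of `K` suffices.
    rcases le_total r 1 with h1 | h1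
    · calc _ ≤ volume (tent (Metric.ball x r)) := measure_mono inter_subset_right
        _ ≤ ENNReal.ofReal (r ^ (n + 1)) * V := measure_tent_ball_le hn x hr
        _ ≤ ENNReal.ofReal (r ^ ((n : ℝ) - 2 * (α + β - 1))) * (V + volume K) := by
            gcongr ENNReal.ofReal ?_ * ?_
            · rw [← Real.rpow_natCast]
              refine Real.rpow_le_rpow_of_exponent_ge hr h1 ?_
              push_cast
              linarith
            · exact le_self_add
        _ = _ := mul_comm _ _
    · calc _ ≤ volume K * 1 := by
            rw [mul_one]
            exact measure_mono inter_subset_left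
        _ ≤ _ := by
          gcongr
          · exact le_add_self
          · rw [ENNReal.one_le_ofReal]
            exact Real.one_le_rpow h1 hd.le
  have hpair := lintegral_pairing_le hαβ hd hf hgm.aestronglyMeasurable (by simp [h0]) hgfin
  rw [h0, mul_zero, zero_mul, nonpos_iff_eq_zero, lintegral_eq_zero_iff'
    (f := fun p => ‖f p * g p‖ₑ / ENNReal.ofReal p.1)
    ((hf.aemeasurable.mul hgm.aemeasurable).enorm.div (by fun_prop))] at hpair
  filter_upwards [hpair] with p hp hpK
  have ht : 0 < p.1 := hpK.1
  have hpow : p.1 ^ ((1 + 2 * (α - β + 1)) / 2) ≠ 0 := by positivity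
  simp only [Pi.zero_apply, ENNReal.div_eq_zero_iff, ENNReal.ofReal_ne_top, or_false,
    enorm_eq_zero, mul_eq_zero, hg, indicator_of_mem hpK, Complex.ofReal_eq_zero, hpow] at hp
  exact hp

end AtomicNorm

/-! ### Completeness, density of atoms and testing of functionals -/

section Duality

variable {n : ℕ} {α β : ℝ} {V : Type*} [NormedAddCommGroup V] [NormedSpace ℂ V]
  {T : V →ₗ[ℂ] (TX n →ₘ[halfMeasure n] ℂ)}

/-- Here and below `V` plays the role of `T¹` with its atomic norm and `T` that of its inclusion
into measurable functions; `hT` and `hsurj` express this. -/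
theorem injective_of_enorm_eq_atomicNorm (hT : ∀ v, ‖v‖ₑ = atomicNorm n α β (T v)) :
    Function.Injective T := by
  refine (injective_iff_map_eq_zero T).2 fun v hv => ?_
  rw [← enorm_eq_zero, hT, hv, atomicNorm_congr AEEqFun.coeFn_zero, atomicNorm_zero]

/-- The remainder after `N` terms is almost everywhere the sum of the tail, so countable
subadditivity bounds its norm by the tail of a convergent series. -/
theorem tendsto_sum_of_ae_hasSum (hαβ : 0 ≤ α + β - 1) (hd : 0 < (n : ℝ) - 2 * (α + β - 1))
    (hT : ∀ v, ‖v‖ₑ = atomicNorm n α β (T v)) {u : ℕ → V} {v : V} (hu : ∑' k, ‖u k‖ₑ ≠ ∞)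
    (h : ∀ᵐ p ∂(halfMeasure n), HasSum (fun k => T (u k) p) (T v p)) :
    Tendsto (fun N => ∑ k ∈ Finset.range N, u k) atTop (𝓝 v) := by
  have hstep : ∀ N, ∀ᵐ p ∂(halfMeasure n),
      HasSum (fun k => T (u (k + N)) p) (T (v - ∑ k ∈ Finset.range N, u k) p) := by
    intro N
    induction N with
    | zero => simpa using h
    | succ N ih =>
      have e : T (v - ∑ k ∈ Finset.range (N + 1), u k)
          = T (v - ∑ k ∈ Finset.range N, u k) - T (u N) := by
        rw [Finset.sum_range_succ, ← sub_sub, map_sub T _ (u N)]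
      rw [e]
      filter_upwards [ih, AEEqFun.coeFn_sub (T (v - ∑ k ∈ Finset.range N, u k)) (T (u N))]
        with p hp hp'
      rw [hp']
      have := (hasSum_nat_add_iff' 1).2 hp
      simpa [add_assoc, add_comm 1 N] using this
  rw [tendsto_iff_edist_tendsto_0]
  refine tendsto_of_tendsto_of_tendsto_of_le_of_le tendsto_const_nhds
    (ENNReal.tendsto_sum_nat_add _ hu) (fun _ => zero_le) fun N => ?_
  rw [edist_comm, edist_eq_enorm_sub, hT]
  simp only [hT] at hu ⊢
  refine (ae_summable_and_atomicNorm_le_tsum hαβ hd (h := fun k => T (u (k + N))) ?_).2 _ (hstep N)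
  exact ne_top_of_le_ne_top hu (ENNReal.tsum_comp_le_tsum_of_injective (add_left_injective N)
    fun k => atomicNorm n α β (T (u k)))

/-- An absolutely convergent series converges almost everywhere, its sum has finite atomic norm by
countable subadditivity, and the convergence then holds in norm. -/
theorem completeSpace_of_enorm_eq_atomicNorm (hαβ : 0 ≤ α + β - 1)
    (hd : 0 < (n : ℝ) - 2 * (α + β - 1)) (hT : ∀ v, ‖v‖ₑ = atomicNorm n α β (T v))
    (hsurj : ∀ f : TX n →ₘ[halfMeasure n] ℂ, atomicNorm n α β f < ∞ → ∃ v, T v = f) :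
    CompleteSpace V := by
  refine NormedAddCommGroup.completeSpace_of_summable_imp_tendsto fun u hu => ?_
  have hu' : ∑' k, ‖u k‖ₑ ≠ ∞ := by
    simpa [enorm_eq_nnnorm, ENNReal.tsum_coe_ne_top_iff_summable, ← NNReal.summable_coe] using hu
  have hu'' : ∑' k, atomicNorm n α β (T (u k)) ≠ ∞ := by simpa only [hT] using hu'
  obtain ⟨hsum, hle⟩ := ae_summable_and_atomicNorm_le_tsum hαβ hd hu''
  have hm : AEMeasurable (fun p => ∑' k, T (u k) p) (halfMeasure n) :=
    AEMeasurable.tsum fun k => (T (u k)).aemeasurable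
  set f := AEEqFun.mk _ hm.aestronglyMeasurable with hf
  have hfsum : ∀ᵐ p ∂(halfMeasure n), HasSum (fun k => T (u k) p) (f p) := by
    filter_upwards [hsum, AEEqFun.coeFn_mk _ hm.aestronglyMeasurable] with p hp hp'
    rw [hf, hp']
    exact hp.hasSum
  obtain ⟨v, hv⟩ := hsurj f ((hle f hfsum).trans_lt (lt_top_iff_ne_top.2 hu''))
  exact ⟨v, tendsto_sum_of_ae_hasSum hαβ hd hT hu' (by rwa [hv])⟩

/-- Atomic series converge in norm, so functionals are determined by their values on multiples of
atoms. -/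
theorem eq_of_forall_supported (hαβ : 0 ≤ α + β - 1) (hd : 0 < (n : ℝ) - 2 * (α + β - 1))
    (hT : ∀ v, ‖v‖ₑ = atomicNorm n α β (T v))
    (hsurj : ∀ f : TX n →ₘ[halfMeasure n] ℂ, atomicNorm n α β f < ∞ → ∃ v, T v = f)
    {φ ψ : V →L[ℂ] ℂ}
    (h : ∀ (x : EuclideanSpace ℝ (Fin n)) (r : ℝ), 0 < r → ∀ v,
      (∀ᵐ p ∂(halfMeasure n), p ∉ tent (Metric.ball x r) → T v p = 0) →
      ∫⁻ p, ‖T v p‖ₑ ^ 2 / ENNReal.ofReal (p.1 ^ (1 - 2 * (α - β + 1))) ∂(halfMeasure n) ≠ ∞ →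
      φ v = ψ v) : φ = ψ := by
  have hn := pos_of_dim_pos hαβ hd
  ext v
  obtain ⟨c, a, hca, -⟩ := exists_isAtomicDecomposition_of_lt (n := n) (α := α) (β := β)
    (f := T v) (y := ∞) (by rw [← hT]; exact enorm_lt_top)
  have hm : ∀ j, AEStronglyMeasurable (fun p => c j * a j p) (halfMeasure n) := fun j =>
    (hca.atom j).1.const_mul _
  have hnorm : ∀ j, atomicNorm n α β (AEEqFun.mk _ (hm j)) ≤ ‖c j‖ₑ := by
    intro j
    refine (atomicNorm_le_of_countable (ι := Unit) (c := fun _ => c j) (a := fun _ => a j)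
      (fun _ => hca.atom j) ?_).trans (by simp)
    filter_upwards [AEEqFun.coeFn_mk _ (hm j)] with p hp
    rw [hp]
    simp
  choose u hu using fun j => hsurj _ ((hnorm j).trans_lt enorm_lt_top)
  have hufin : ∑' j, ‖u j‖ₑ ≠ ∞ :=
    ne_top_of_le_ne_top hca.tsum_enorm_ne_top
      (ENNReal.tsum_le_tsum fun j => by rw [hT, hu]; exact hnorm j)
  have huae : ∀ j, ∀ᵐ p ∂(halfMeasure n), T (u j) p = c j * a j p := fun j => by
    rw [hu]
    exact AEEqFun.coeFn_mk _ (hm j)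
  have hlim := tendsto_sum_of_ae_hasSum hαβ hd hT hufin (v := v) (by
    filter_upwards [hca.hasSum, ae_all_iff.2 huae] with p hp hp'
    simpa only [hp'] using hp)
  have heq : ∀ j, φ (u j) = ψ (u j) := by
    intro j
    obtain ⟨-, x, r, hr, hsupp, hint⟩ := hca.atom j
    refine h x r hr (u j) ?_ ?_
    · filter_upwards [hsupp, huae j] with p hp hp' hpt
      rw [hp', hp hpt, mul_zero]
    · have e : ∫⁻ p, ‖T (u j) p‖ₑ ^ 2 / ENNReal.ofReal (p.1 ^ (1 - 2 * (α - β + 1)))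
            ∂(halfMeasure n) = ‖c j‖ₑ ^ 2 * ∫⁻ p in tent (Metric.ball x r),
            ‖a j p‖ₑ ^ 2 / ENNReal.ofReal (p.1 ^ (1 - 2 * (α - β + 1))) := by
        rw [← restrict_halfMeasure_tent, ← lintegral_const_mul' _ _ (by simp),
          ← lintegral_indicator (measurableSet_tent _)]
        refine lintegral_congr_ae ?_
        filter_upwards [hsupp, huae j] with p hp hp'
        by_cases hpt : p ∈ tent (Metric.ball x r)
        · rw [indicator_of_mem hpt, hp', enorm_mul, mul_pow, mul_div_assoc]
        · simp [indicator_of_notMem hpt, hp', hp hpt]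
      rw [e]
      refine ENNReal.mul_ne_top (by simp) (ne_top_of_le_ne_top ?_ hint)
      rw [volume_ball_rpow hn hd x hr]
      have hB := ballConst_pos n α β
      refine ENNReal.div_ne_top (by simp) (mul_ne_zero ?_ (by simpa using hB.ne'))
      simpa using by positivity
  have h1 := (φ.continuous.tendsto v).comp hlim
  have h2 := (ψ.continuous.tendsto v).comp hlim
  refine tendsto_nhds_unique h1 (h2.congr fun N => ?_)
  simp only [Function.comp_apply, map_sum, heq]

/-- Functions supported in a tent with finite weighted `L²`-norm. -/
theorem atomicNorm_le_of_supported (hn : 0 < n) (hd : 0 < (n : ℝ) - 2 * (α + β - 1))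
    {f : TX n → ℂ} (hf : AEStronglyMeasurable f (halfMeasure n)) (x : EuclideanSpace ℝ (Fin n))
    {r : ℝ} (hr : 0 < r) (hsupp : ∀ᵐ p ∂(halfMeasure n), p ∉ tent (Metric.ball x r) → f p = 0)
    (hfin : ∫⁻ p, ‖f p‖ₑ ^ 2 / ENNReal.ofReal (p.1 ^ (1 - 2 * (α - β + 1)))
      ∂(halfMeasure n) ≠ ∞) :
    atomicNorm n α β f ≤ (∫⁻ p, ‖f p‖ₑ ^ 2 / ENNReal.ofReal (p.1 ^ (1 - 2 * (α - β + 1)))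
      ∂(halfMeasure n)) ^ (1 / 2 : ℝ) *
      (volume (Metric.ball x r) ^ (1 - 2 * (α + β - 1) / n)) ^ (1 / 2 : ℝ) := by
  -- One tent with `ω = v = 1`; the cutting lemma does not ask `ω` to be admissible.
  obtain ⟨c, a, h, hle⟩ := exists_isAtomicDecomposition_of_cover (ι := Unit) hn hd hf
    (ω := fun _ => 1) (x := fun _ => x) (r := fun _ => r) (fun _ => hr) (v := fun _ => 1)
    (fun _ => one_ne_zero) (A := fun _ => tent (Metric.ball x r)) (fun _ => measurableSet_tent _)
    (fun _ => subset_rfl) (fun _ _ _ => le_rfl)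
    (hsupp.mono fun p hp hfp => ⟨(), by_contra fun h => hfp (hp h)⟩)
    (S := ENNReal.ofReal (r ^ ((n : ℝ) - 2 * (α + β - 1)))) (by simp) (by simp)
    (by simpa using hfin)
  refine h.atomicNorm_le.trans (hle.trans (le_of_eq ?_))
  simp only [ENNReal.coe_one, div_one]
  rw [volume_ball_rpow hn hd x hr]

/-- Testing a functional against `conj g t ^ (-2γ) 1_{T(B)}` bounds the `T^∞`-norm of `g`. -/
theorem tentInftyNorm_le_enorm (hαβ : 0 ≤ α + β - 1) (hd : 0 < (n : ℝ) - 2 * (α + β - 1))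
    (hT : ∀ v, ‖v‖ₑ = atomicNorm n α β (T v))
    (hsurj : ∀ f : TX n →ₘ[halfMeasure n] ℂ, atomicNorm n α β f < ∞ → ∃ v, T v = f)
    {φ : V →L[ℂ] ℂ} {g : TX n → ℂ} (hg : AEStronglyMeasurable g (halfMeasure n))
    (hgfin : ∀ (x : EuclideanSpace ℝ (Fin n)) (r : ℝ), 0 < r →
      ∫⁻ p in tent (Metric.ball x r), ‖g p‖ₑ ^ 2 / ENNReal.ofReal (p.1 ^ (1 + 2 * (α - β + 1))) ≠ ∞)
    (h : ∀ (x : EuclideanSpace ℝ (Fin n)) (r : ℝ), 0 < r → ∀ v,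
      (∀ᵐ p ∂(halfMeasure n), p ∉ tent (Metric.ball x r) → T v p = 0) →
      ∫⁻ p, ‖T v p‖ₑ ^ 2 / ENNReal.ofReal (p.1 ^ (1 - 2 * (α - β + 1))) ∂(halfMeasure n) ≠ ∞ →
      φ v = ∫ p, T v p * g p / (p.1 : ℂ) ∂(halfMeasure n)) :
    tentInftyNorm n α β g ≤ ‖φ‖ₑ := by
  have hn := pos_of_dim_pos hαβ hd
  refine iSup_le fun x => iSup₂_le fun r hr => ?_
  set K := tent (Metric.ball x r) with hK
  set W' : TX n → ℝ≥0∞ := fun p => ENNReal.ofReal (p.1 ^ (1 + 2 * (α - β + 1))) with hW'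
  set I := ∫⁻ p in K, ‖g p‖ₑ ^ 2 / W' p with hI
  have hItop : I ≠ ∞ := hgfin x r hr
  set R := volume (Metric.ball x r) ^ (1 - 2 * (α + β - 1) / n) with hR
  have hB := ballConst_pos n α β
  have hR0 : R ≠ 0 := by
    rw [hR, volume_ball_rpow hn hd x hr]
    refine mul_ne_zero ?_ (by simpa using hB.ne')
    simpa using by positivity
  have hRtop : R ≠ ∞ := by
    rw [hR, volume_ball_rpow hn hd x hr]
    exact ENNReal.mul_ne_top (by simp) (by simp)
  -- With this choice both `f g / t` and `|f|² t^(-1+2γ)` equal `|g|² t^(-1-2γ)` on `K`, so `φ` at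
  -- `f` and the squared weighted norm of `f` are the same number `I`.
  set f : TX n → ℂ := K.indicator fun p =>
    (starRingEnd ℂ) (g p) * ((p.1 ^ (-(2 * (α - β + 1))) : ℝ) : ℂ) with hf
  have hfm : AEStronglyMeasurable f (halfMeasure n) := by
    refine AEStronglyMeasurable.indicator (AEStronglyMeasurable.mul ?_ ?_) (measurableSet_tent _)
    · exact Complex.continuous_conj.comp_aestronglyMeasurable hg
    · exact Measurable.aestronglyMeasurable (by fun_prop)
  have hconj : ∀ p, ‖(starRingEnd ℂ) (g p)‖ₑ = ‖g p‖ₑ := fun p => by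
    rw [← ofReal_norm, RCLike.norm_conj, ofReal_norm]
  have hfint : ∫⁻ p, ‖f p‖ₑ ^ 2 / ENNReal.ofReal (p.1 ^ (1 - 2 * (α - β + 1)))
      ∂(halfMeasure n) = I := by
    rw [hI, ← restrict_halfMeasure_tent, ← lintegral_indicator (measurableSet_tent _)]
    refine lintegral_congr fun p => ?_
    change _ = K.indicator _ p
    by_cases hp : p ∈ K
    · have ht : 0 < p.1 := hp.1
      have e : ‖((p.1 ^ (-(2 * (α - β + 1))) : ℝ) : ℂ)‖ₑ ^ 2 /
          ENNReal.ofReal (p.1 ^ (1 - 2 * (α - β + 1))) = (W' p)⁻¹ := by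
        rw [← ofReal_norm, Complex.norm_real, Real.norm_of_nonneg (by positivity),
          ← ENNReal.ofReal_pow (by positivity), ← Real.rpow_natCast, ← Real.rpow_mul ht.le,
          ← ENNReal.ofReal_div_of_pos (by positivity), ← Real.rpow_sub ht, hW',
          ← ENNReal.ofReal_inv_of_pos (by positivity), ← Real.rpow_neg ht.le]
        congr 2
        push_cast
        ring
      simp only [hf, indicator_of_mem hp, enorm_mul, mul_pow, hconj, mul_div_assoc, e]
      rfl
    · simp [hf, hp]
  have hfK : ∀ p, p ∉ K → f p = 0 := fun p hp => indicator_of_notMem hp _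
  have hfnorm := atomicNorm_le_of_supported hn hd hfm x hr (Eventually.of_forall hfK)
    (by rw [hfint]; exact hItop)
  rw [hfint] at hfnorm
  have hmk := AEEqFun.coeFn_mk f hfm
  have hfin : I ^ (1 / 2 : ℝ) * R ^ (1 / 2 : ℝ) < ∞ :=
    ENNReal.mul_lt_top (ENNReal.rpow_lt_top_of_nonneg (by norm_num) hItop)
      (ENNReal.rpow_lt_top_of_nonneg (by norm_num) hRtop)
  obtain ⟨v, hv⟩ := hsurj (AEEqFun.mk f hfm)
    ((atomicNorm_congr hmk).trans_lt (hfnorm.trans_lt hfin))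
  have hvnorm : ‖v‖ₑ ≤ I ^ (1 / 2 : ℝ) * R ^ (1 / 2 : ℝ) := by
    rw [hT, hv, atomicNorm_congr hmk]
    exact hfnorm
  have hvf : ∀ᵐ p ∂(halfMeasure n), T v p = f p := by
    rw [hv]
    exact hmk
  have hφ : ‖φ v‖ₑ = I := by
    rw [h x r hr v (hvf.mono fun p hp hpK => by rw [hp, hfK p hpK]) ?_]
    · have hreal : ∀ᵐ p ∂(halfMeasure n), T v p * g p / (p.1 : ℂ)
          = (((K.indicator (fun p => ‖g p‖ₑ ^ 2 / W' p) p).toReal : ℝ) : ℂ) := by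
        filter_upwards [hvf] with p hp
        rw [hp]
        by_cases hpK : p ∈ K
        · have ht : 0 < p.1 := hpK.1
          rw [hf, indicator_of_mem hpK, indicator_of_mem hpK, mul_right_comm,
            ← Complex.normSq_eq_conj_mul_self, Complex.normSq_eq_norm_sq, ← Complex.ofReal_mul,
            ← Complex.ofReal_div]
          congr 1
          rw [ENNReal.toReal_div, ENNReal.toReal_pow, toReal_enorm, hW',
            ENNReal.toReal_ofReal (by positivity), Real.rpow_neg ht.le, Real.rpow_add ht,
            Real.rpow_one]
          field_simp
        · simp [hf, hpK]
      rw [integral_congr_ae hreal, integral_complex_ofReal, integral_toReal]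
      · rw [lintegral_indicator (measurableSet_tent _), restrict_halfMeasure_tent, ← hI,
          ← ofReal_norm, Complex.norm_real, Real.norm_of_nonneg ENNReal.toReal_nonneg,
          ENNReal.ofReal_toReal hItop]
      · exact ((hg.aemeasurable.enorm.pow_const 2).div (by fun_prop)).indicator
          (measurableSet_tent _)
      · filter_upwards with p
        by_cases hpK : p ∈ K
        · have ht : 0 < p.1 := hpK.1
          rw [indicator_of_mem hpK]
          refine ENNReal.div_lt_top (by simp) ?_
          simpa [hW'] using by positivity
        · simp [hpK]
    · rw [lintegral_congr_ae (g := fun p => ‖f p‖ₑ ^ 2 /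
        ENNReal.ofReal (p.1 ^ (1 - 2 * (α - β + 1)))) (hvf.mono fun p hp => by simp only [hp]),
        hfint]
      exact hItop
  -- Dividing by `I^(1/2)` gives the claim; this is where the local finiteness of `g` is needed.
  have hle : I ≤ ‖φ‖ₑ * (I ^ (1 / 2 : ℝ) * R ^ (1 / 2 : ℝ)) := by
    rw [← hφ]
    calc ‖φ v‖ₑ ≤ ‖φ‖ₑ * ‖v‖ₑ := φ.le_opENorm v
      _ ≤ _ := by
        rw [hφ]
        gcongr
  rw [ENNReal.div_rpow_of_nonneg _ _ (by norm_num)]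
  refine ENNReal.div_le_of_le_mul ?_
  by_cases hI0 : I = 0
  · simp [hI0]
  have hI0' : I ^ (1 / 2 : ℝ) ≠ 0 := by simp [hI0, hItop]
  have hItop' : I ^ (1 / 2 : ℝ) ≠ ∞ := ENNReal.rpow_ne_top_of_nonneg (by norm_num) hItop
  have hsq : I ^ (1 / 2 : ℝ) * I ^ (1 / 2 : ℝ) = I := by
    rw [← ENNReal.rpow_add _ _ hI0 hItop]
    norm_num
  rw [← ENNReal.mul_le_mul_iff_right hI0' hItop', hsq]
  exact hle.trans_eq (by ring)

end Duality

/-! ### Riesz representation and the dual space -/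

section Representation

variable {n : ℕ} {α β : ℝ}

/-- A ball weight over `B(0, m + 1)`, `m ∈ ℕ`, with small positive summable coefficients. Every tent
lies in one of the tents used, so a single term of the sum supplies the lower bound `δ`. -/
theorem exists_pos_weight (hn : 0 < n) {d : ℝ} (hd : 0 < d) :
    ∃ ω : TX n → ℝ≥0, Measurable ω ∧ capacityIntegral d (nontangentialMax ω) ≤ 1 ∧
      ∀ (x : EuclideanSpace ℝ (Fin n)) (r : ℝ),
        ∃ δ : ℝ≥0, 0 < δ ∧ ∀ p ∈ tent (Metric.ball x r), δ ≤ ω p := by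
  have hκ := capacityConst_pos n d
  obtain ⟨b, hb, hbsum⟩ := ENNReal.exists_pos_sum_of_countable
    (ε := (capacityConst n d : ℝ≥0∞)⁻¹) (by simp) ℕ
  have hbκ : capacityConst n d * ∑' m, (b m : ℝ≥0∞) ≤ 1 :=
    (mul_le_mul_right hbsum.le _).trans_eq
      (ENNReal.mul_inv_cancel (by simpa using hκ.ne') (by simp))
  have htop := ballWeight_ne_top hn hd (tsum_ne_top_of_capacityConst_mul_le hbκ)
    (fun _ => (0 : EuclideanSpace ℝ (Fin n))) fun m : ℕ => (m + 1 : ℝ)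
  refine ⟨_, (measurable_ballWeight d (fun m => (b m : ℝ≥0∞)) (fun _ => 0)
    fun m : ℕ => (m + 1 : ℝ)).ennreal_toNNReal,
    capacityIntegral_ballWeight_le hd hbκ _ fun m => by positivity, fun x r => ?_⟩
  obtain ⟨m, hm⟩ := exists_nat_ge (‖x‖ + r)
  have hsub : tent (Metric.ball x r)
      ⊆ tent (Metric.ball (0 : EuclideanSpace ℝ (Fin n)) (m + 1 : ℝ)) := by
    refine tent_mono (Metric.ball_subset_ball' ?_)
    rw [dist_zero_right]
    linarith
  have hle : ∀ p ∈ tent (Metric.ball x r), (b m : ℝ≥0∞) / ENNReal.ofReal ((m + 1 : ℝ) ^ d)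
      ≤ ballWeight d (fun m => (b m : ℝ≥0∞)) (fun _ => 0) (fun m : ℕ => (m + 1 : ℝ)) p := by
    intro p hp
    refine le_trans (le_of_eq ?_) (ENNReal.le_tsum m)
    rw [indicator_of_mem (hsub hp)]
  have hm0 : (0 : ℝ) < (m + 1 : ℝ) ^ d := by positivity
  have hδtop : (b m : ℝ≥0∞) / ENNReal.ofReal ((m + 1 : ℝ) ^ d) ≠ ∞ :=
    ENNReal.div_ne_top (by simp) (by simpa using hm0)
  refine ⟨((b m : ℝ≥0∞) / ENNReal.ofReal ((m + 1 : ℝ) ^ d)).toNNReal,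
    ENNReal.toNNReal_pos (ENNReal.div_ne_zero.2 ⟨by simpa using (hb m).ne', by simp⟩) hδtop,
    fun p hp => ENNReal.toNNReal_mono (htop p) (hle p hp)⟩

variable {V : Type*} [NormedAddCommGroup V] [NormedSpace ℂ V]
  {T : V →ₗ[ℂ] (TX n →ₘ[halfMeasure n] ℂ)}

theorem ENNReal.mul_mul_div_div_cancel {a b : ℝ≥0∞} (ha : a ≠ 0) (ha' : a ≠ ∞) (hb : b ≠ 0)
    (hb' : b ≠ ∞) (x : ℝ≥0∞) : a * b * x / a / b = x := by
  rw [mul_assoc, ENNReal.mul_div_right_comm, ENNReal.div_self ha ha', one_mul,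
    ENNReal.mul_div_right_comm, ENNReal.div_self hb hb', one_mul]

theorem eLpNorm_two_eq {f : TX n → ℂ} {μ : Measure (TX n)} :
    eLpNorm f 2 μ = (∫⁻ p, ‖f p‖ₑ ^ 2 ∂μ) ^ (1 / 2 : ℝ) := by
  rw [eLpNorm_eq_lintegral_rpow_enorm_toReal two_ne_zero ENNReal.ofNat_ne_top]
  simp

/-- A functional is represented by a function on the elements supported in tents: Riesz
representation in a weighted `L²`-space that embeds in `T¹`. -/
theorem exists_representing_function (hαβ : 0 ≤ α + β - 1)
    (hd : 0 < (n : ℝ) - 2 * (α + β - 1)) (hT : ∀ v, ‖v‖ₑ = atomicNorm n α β (T v))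
    (hsurj : ∀ f : TX n →ₘ[halfMeasure n] ℂ, atomicNorm n α β f < ∞ → ∃ v, T v = f)
    (φ : V →L[ℂ] ℂ) :
    ∃ g : TX n → ℂ, AEStronglyMeasurable g (halfMeasure n) ∧
      (∀ (x : EuclideanSpace ℝ (Fin n)) (r : ℝ), 0 < r → ∫⁻ p in tent (Metric.ball x r),
        ‖g p‖ₑ ^ 2 / ENNReal.ofReal (p.1 ^ (1 + 2 * (α - β + 1))) ≠ ∞) ∧
      ∀ (x : EuclideanSpace ℝ (Fin n)) (r : ℝ), 0 < r → ∀ v,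
        (∀ᵐ p ∂(halfMeasure n), p ∉ tent (Metric.ball x r) → T v p = 0) →
        ∫⁻ p, ‖T v p‖ₑ ^ 2 / ENNReal.ofReal (p.1 ^ (1 - 2 * (α - β + 1))) ∂(halfMeasure n) ≠ ∞ →
        φ v = ∫ p, T v p * g p / (p.1 : ℂ) ∂(halfMeasure n) := by
  have hn := pos_of_dim_pos hαβ hd
  have hTinj := injective_of_enorm_eq_atomicNorm hT
  obtain ⟨ω, hω, hcap, hδ⟩ := exists_pos_weight hn hd
  have hωpos : ∀ p : TX n, 0 < p.1 → 0 < ω p := fun p hp => by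
    obtain ⟨δ, hδ0, hδ⟩ := hδ p.2 p.1
    exact hδ0.trans_le (hδ p ⟨hp, subset_rfl⟩)
  set W : TX n → ℝ≥0∞ := fun p => ENNReal.ofReal (p.1 ^ (1 - 2 * (α - β + 1))) with hW
  -- Multiplication by `ρ = (ωW)^(1/2)` maps `L²` into `T¹`: with the weight `ω`, the `T¹` integral
  -- of `ρ u` is the `L²` integral of `u`.
  set ρ : TX n → ℂ := fun p => (Real.sqrt (ω p * p.1 ^ (1 - 2 * (α - β + 1))) : ℂ) with hρ
  have hρm : Measurable ρ := by fun_prop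
  have hρsq : ∀ p : TX n, 0 < p.1 → ‖ρ p‖ₑ ^ 2 = ω p * W p := by
    intro p hp
    rw [hρ, ← ofReal_norm, Complex.norm_real, Real.norm_of_nonneg (by positivity),
      ← ENNReal.ofReal_pow (by positivity), Real.sq_sqrt (by positivity),
      ENNReal.ofReal_mul (by positivity), ENNReal.ofReal_coe_nnreal]
  have hW0 : ∀ p : TX n, 0 < p.1 → W p ≠ 0 := fun p hp => by simpa [hW] using by positivity
  have hWtop : ∀ p : TX n, W p ≠ ∞ := fun p => by simp [hW]
  have hω0 : ∀ p : TX n, 0 < p.1 → (ω p : ℝ≥0∞) ≠ 0 := fun p hp => by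
    simpa using (hωpos p hp).ne'
  have hρ0 : ∀ p : TX n, 0 < p.1 → ρ p ≠ 0 := by
    intro p hp h
    have := hρsq p hp
    rw [h, enorm_zero, zero_pow two_ne_zero] at this
    exact mul_ne_zero (hω0 p hp) (hW0 p hp) this.symm
  let R : TX n →ₘ[halfMeasure n] ℂ := AEEqFun.mk ρ hρm.aestronglyMeasurable
  have hRu : ∀ u : TX n →ₘ[halfMeasure n] ℂ,
      ∀ᵐ p ∂(halfMeasure n), (R * u : TX n →ₘ[halfMeasure n] ℂ) p = ρ p * u p := by
    intro u
    filter_upwards [AEEqFun.coeFn_mul R u, AEEqFun.coeFn_mk ρ hρm.aestronglyMeasurable]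
      with p hp hp'
    rw [hp, Pi.mul_apply, hp']
  have hJ : ∀ u : Lp ℂ 2 (halfMeasure n), atomicNorm n α β (R * u.1 : TX n →ₘ[halfMeasure n] ℂ)
      ≤ decompositionConst n α β * ‖u‖ₑ := by
    intro u
    refine (atomicNorm_le_tentOneNorm hαβ hd (AEEqFun.aestronglyMeasurable _)).trans ?_
    gcongr
    refine (tentOneNorm_le hω hcap ?_).trans (le_of_eq ?_)
    · filter_upwards [ae_halfMeasure_pos] with p hp h
      exact absurd h (hωpos p hp).ne'
    · rw [Lp.enorm_def, eLpNorm_two_eq]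
      congr 1
      refine lintegral_congr_ae ?_
      filter_upwards [hRu u.1, ae_halfMeasure_pos] with p hp ht
      rw [hp, enorm_mul, mul_pow, hρsq p ht]
      exact ENNReal.mul_mul_div_div_cancel (hω0 p ht) (by simp) (hW0 p ht) (hWtop p) _
  choose L hL using fun u : Lp ℂ 2 (halfMeasure n) =>
    hsurj (R * u.1) ((hJ u).trans_lt (ENNReal.mul_lt_top (by simp) enorm_lt_top))
  have hRadd : ∀ u w : TX n →ₘ[halfMeasure n] ℂ, R * (u + w) = R * u + R * w := by
    refine fun u w => AEEqFun.ext ?_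
    filter_upwards [hRu (u + w), hRu u, hRu w, AEEqFun.coeFn_add u w,
      AEEqFun.coeFn_add (R * u) (R * w)] with p h1 h2 h3 h4 h5
    rw [h1, h5, h4, Pi.add_apply, Pi.add_apply, h2, h3, mul_add]
  have hRsmul : ∀ (k : ℂ) (u : TX n →ₘ[halfMeasure n] ℂ), R * (k • u) = k • (R * u) := by
    refine fun k u => AEEqFun.ext ?_
    filter_upwards [hRu (k • u), hRu u, AEEqFun.coeFn_smul k u, AEEqFun.coeFn_smul k (R * u)]
      with p h1 h2 h3 h4
    rw [h1, h4, h3, Pi.smul_apply, Pi.smul_apply, h2, mul_smul_comm]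
  let L' : Lp ℂ 2 (halfMeasure n) →ₗ[ℂ] V :=
    { toFun := L
      map_add' := fun u w => hTinj (by rw [map_add, hL, hL, hL, ← hRadd]; rfl)
      map_smul' := fun k u => hTinj (by
        rw [RingHom.id_apply, map_smul, hL, hL, ← hRsmul]; rfl) }
  let ψ : Lp ℂ 2 (halfMeasure n) →L[ℂ] ℂ := φ.comp
    (L'.mkContinuous (decompositionConst n α β) fun u => by
      have h1 : ‖L u‖ₑ ≤ decompositionConst n α β * ‖u‖ₑ := by
        rw [hT, hL]
        exact hJ u
      have h2 := ENNReal.toReal_mono (ENNReal.mul_ne_top (by simp) enorm_ne_top) h1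
      rw [ENNReal.toReal_mul, toReal_enorm, toReal_enorm] at h2
      exact h2)
  set h := (InnerProductSpace.toDual ℂ (Lp ℂ 2 (halfMeasure n))).symm ψ with hh
  have hψ : ∀ u : Lp ℂ 2 (halfMeasure n),
      φ (L u) = ∫ p, u p * (starRingEnd ℂ) (h p) ∂(halfMeasure n) := by
    intro u
    have h1 : inner ℂ h u = ψ u := InnerProductSpace.toDual_symm_apply
    rw [L2.inner_def] at h1
    simp only [RCLike.inner_apply] at h1
    exact h1.symm
  have hhfin : ∫⁻ p, ‖h p‖ₑ ^ 2 ∂(halfMeasure n) ≠ ∞ := by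
    have h1 := (Lp.memLp h).2
    rw [eLpNorm_two_eq, ENNReal.rpow_lt_top_iff_of_pos (by norm_num)] at h1
    exact h1.ne
  -- The factor `t / ρ` rewrites `∫ u conj h` as the pairing of `ρ u` with `g` under `dt dx / t`.
  refine ⟨fun p => (starRingEnd ℂ) (h p) * ((p.1 : ℂ) / ρ p), ?_, ?_, ?_⟩
  · refine AEStronglyMeasurable.mul ?_ (Measurable.aestronglyMeasurable (by fun_prop))
    exact Complex.continuous_conj.comp_aestronglyMeasurable (Lp.aestronglyMeasurable h)
  · intro x r hr
    obtain ⟨δ, hδ0, hδ⟩ := hδ x r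
    -- Pointwise `|g|² t^(-1-2γ) = |h|² / ω`, and `ω ≥ δ` on the tent.
    refine ne_top_of_le_ne_top (ENNReal.div_ne_top hhfin (y := δ) (by simpa using hδ0.ne')) ?_
    rw [div_eq_mul_inv, ← lintegral_mul_const' _ _ (by simpa using hδ0.ne')]
    refine le_trans (setLIntegral_mono' (measurableSet_tent _) fun p hp => ?_)
      ((lintegral_mono' (restrict_halfMeasure_tent (Metric.ball x r)).ge le_rfl).trans
        (setLIntegral_le_lintegral _ _))
    have ht : 0 < p.1 := hp.1
    have hW'0 : ENNReal.ofReal (p.1 ^ (1 + 2 * (α - β + 1))) ≠ 0 := by simpa using by positivity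
    have hρ2 : ‖(p.1 : ℂ) / ρ p‖ₑ ^ 2 = ENNReal.ofReal p.1 ^ 2 * (ω p * W p)⁻¹ := by
      rw [div_eq_mul_inv, enorm_mul, mul_pow, enorm_inv (hρ0 p ht), ← ENNReal.inv_pow, hρsq p ht,
        ← ofReal_norm, Complex.norm_real, Real.norm_of_nonneg ht.le]
    have hconj : ‖(starRingEnd ℂ) (h p)‖ₑ = ‖h p‖ₑ := by
      rw [← ofReal_norm, RCLike.norm_conj, ofReal_norm]
    have hωle : (ω p : ℝ≥0∞)⁻¹ ≤ (δ : ℝ≥0∞)⁻¹ := by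
      gcongr
      exact hδ p hp
    rw [enorm_mul, mul_pow, hconj, hρ2, ← weight_mul_weight (γ := α - β + 1) ht,
      ENNReal.mul_inv (Or.inl (hω0 p ht)) (Or.inl (by simp)), div_eq_mul_inv]
    calc _ = ‖h p‖ₑ ^ 2 * (ω p : ℝ≥0∞)⁻¹ * (W p * (W p)⁻¹) *
          (ENNReal.ofReal (p.1 ^ (1 + 2 * (α - β + 1))) *
          (ENNReal.ofReal (p.1 ^ (1 + 2 * (α - β + 1))))⁻¹) := by
          simp only [hW]
          ring
      _ = ‖h p‖ₑ ^ 2 * (ω p : ℝ≥0∞)⁻¹ := by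
          rw [ENNReal.mul_inv_cancel (hW0 p ht) (hWtop p),
            ENNReal.mul_inv_cancel hW'0 (by simp), mul_one, mul_one]
      _ ≤ _ := by gcongr
  · intro x r hr v hsupp hfin
    obtain ⟨δ, hδ0, hδ⟩ := hδ x r
    have hum : AEStronglyMeasurable (fun p => T v p / ρ p) (halfMeasure n) :=
      ((T v).aemeasurable.div hρm.aemeasurable).aestronglyMeasurable
    -- The lower bound `ω ≥ δ` on the tent puts `T v / ρ` in `L²`, so `v` lies in the image of the
    -- embedding.
    have humem : MemLp (fun p => T v p / ρ p) 2 (halfMeasure n) := by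
      refine ⟨hum, ?_⟩
      rw [eLpNorm_two_eq, ENNReal.rpow_lt_top_iff_of_pos (by norm_num)]
      refine lt_of_le_of_lt ?_ (ENNReal.div_lt_top hfin (y := δ) (by simpa using hδ0.ne'))
      rw [div_eq_mul_inv, ← lintegral_mul_const' _ _ (by simpa using hδ0.ne')]
      refine lintegral_mono_ae ?_
      filter_upwards [hsupp, ae_halfMeasure_pos] with p hp ht
      by_cases hpt : p ∈ tent (Metric.ball x r)
      · have hωle : (ω p : ℝ≥0∞)⁻¹ ≤ (δ : ℝ≥0∞)⁻¹ := by
          gcongr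
          exact hδ p hpt
        rw [div_eq_mul_inv, enorm_mul, mul_pow, enorm_inv (hρ0 p ht), ← ENNReal.inv_pow, hρsq p ht,
          ENNReal.mul_inv (Or.inl (hω0 p ht)) (Or.inl (by simp)), div_eq_mul_inv, mul_assoc,
          mul_comm (W p)⁻¹]
        gcongr
      · simp [hp hpt]
    have huL := humem.coeFn_toLp
    have hv : L humem.toLp = v := by
      refine hTinj (AEEqFun.ext ?_)
      rw [hL]
      filter_upwards [hRu humem.toLp.1, huL, ae_halfMeasure_pos] with p hp hp' ht
      rw [hp, hp', mul_div_cancel₀ _ (hρ0 p ht)]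
    rw [← hv, hψ, hv]
    refine integral_congr_ae ?_
    filter_upwards [huL, ae_halfMeasure_pos] with p hp ht
    have ht' : (p.1 : ℂ) ≠ 0 := by exact_mod_cast ht.ne'
    have := hρ0 p ht
    rw [hp]
    field_simp

theorem integrable_pairing (hαβ : 0 ≤ α + β - 1) (hd : 0 < (n : ℝ) - 2 * (α + β - 1))
    (hT : ∀ v, ‖v‖ₑ = atomicNorm n α β (T v)) (v : V) (g : TentInfty n α β) :
    Integrable (fun p => T v p * g.1 p / (p.1 : ℂ)) (halfMeasure n) ∧
    ‖∫ p, T v p * g.1 p / (p.1 : ℂ) ∂(halfMeasure n)‖ₑ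
      ≤ (pairingConst n α β * atomConst n α β : ℝ≥0) * tentInftyNorm n α β g.1 * ‖v‖ₑ := by
  have hg : tentInftyNorm n α β g.1 < ∞ := g.2
  have hle := tentOneNorm_le_atomicNorm hαβ hd (T v)
  rw [← hT] at hle
  have hpair := lintegral_pairing_le hαβ hd (T v).aestronglyMeasurable g.1.aestronglyMeasurable
    (hle.trans_lt (ENNReal.mul_lt_top (by simp) enorm_lt_top)) hg
  have hbound : ∫⁻ p, ‖T v p * g.1 p / (p.1 : ℂ)‖ₑ ∂(halfMeasure n)
      ≤ (pairingConst n α β * atomConst n α β : ℝ≥0) * tentInftyNorm n α β g.1 * ‖v‖ₑ := by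
    calc _ = ∫⁻ p, ‖T v p * g.1 p‖ₑ / ENNReal.ofReal p.1 ∂(halfMeasure n) := by
          refine lintegral_congr_ae ?_
          filter_upwards [ae_halfMeasure_pos] with p ht
          have ht' : (p.1 : ℂ) ≠ 0 := by exact_mod_cast ht.ne'
          rw [div_eq_mul_inv, enorm_mul, enorm_inv ht', ← ofReal_norm (p.1 : ℂ),
            Complex.norm_real, Real.norm_of_nonneg ht.le, div_eq_mul_inv]
      _ ≤ _ := hpair
      _ ≤ pairingConst n α β * (atomConst n α β * ‖v‖ₑ) * tentInftyNorm n α β g.1 := by gcongr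
      _ = _ := by
          push_cast
          ring
  refine ⟨⟨?_, ?_⟩, (enorm_integral_le_lintegral_enorm _).trans hbound⟩
  · have hm : Measurable fun p : TX n => (p.1 : ℂ) := by fun_prop
    exact (((T v).aemeasurable.mul g.1.aemeasurable).div hm.aemeasurable).aestronglyMeasurable
  · exact hbound.trans_lt (ENNReal.mul_lt_top (ENNReal.mul_lt_top ENNReal.coe_lt_top hg)
      enorm_lt_top)

/-- Boundedness is the pairing inequality. The testing bound is a lower bound with constant 1, hence
injectivity. For surjectivity, testing puts the Riesz representative in `T^∞`, and density of atoms
extends the formula to all of `V`. -/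
theorem exists_duality_equiv (hαβ : 0 ≤ α + β - 1)
    (hd : 0 < (n : ℝ) - 2 * (α + β - 1)) (hT : ∀ v, ‖v‖ₑ = atomicNorm n α β (T v))
    (hsurj : ∀ f : TX n →ₘ[halfMeasure n] ℂ, atomicNorm n α β f < ∞ → ∃ v, T v = f) :
    ∃ Φ : TentInfty n α β ≃ₗ[ℂ] (V →L[ℂ] ℂ),
      (∀ (g : TentInfty n α β) (v : V),
        Φ g v = ∫ p, T v p * g.1 p / (p.1 : ℂ) ∂(halfMeasure n)) ∧
      ∃ C : ℝ≥0, ∀ g : TentInfty n α β,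
        ‖Φ g‖ₑ ≤ C * tentInftyNorm n α β g.1 ∧ tentInftyNorm n α β g.1 ≤ C * ‖Φ g‖ₑ := by
  have hn := pos_of_dim_pos hαβ hd
  have hint : ∀ (g : TentInfty n α β) (v : V),
      Integrable (fun p => T v p * g.1 p / (p.1 : ℂ)) (halfMeasure n) :=
    fun g v => (integrable_pairing hαβ hd hT v g).1
  let B : TentInfty n α β →ₗ[ℂ] V →ₗ[ℂ] ℂ := LinearMap.mk₂ ℂ
    (fun g v => ∫ p, T v p * g.1 p / (p.1 : ℂ) ∂(halfMeasure n))
    (fun g₁ g₂ v => by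
      rw [← integral_add (hint g₁ v) (hint g₂ v)]
      refine integral_congr_ae ?_
      filter_upwards [AEEqFun.coeFn_add g₁.1 g₂.1] with p hp
      rw [Submodule.coe_add, hp, Pi.add_apply]
      ring)
    (fun c g v => by
      rw [← integral_smul]
      refine integral_congr_ae ?_
      filter_upwards [AEEqFun.coeFn_smul c g.1] with p hp
      rw [Submodule.coe_smul, hp, Pi.smul_apply, smul_eq_mul, smul_eq_mul]
      ring)
    (fun g v₁ v₂ => by
      rw [← integral_add (hint g v₁) (hint g v₂)]
      refine integral_congr_ae ?_
      filter_upwards [AEEqFun.coeFn_add (T v₁) (T v₂)] with p hp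
      rw [map_add, hp, Pi.add_apply]
      ring)
    (fun c g v => by
      rw [← integral_smul]
      refine integral_congr_ae ?_
      filter_upwards [AEEqFun.coeFn_smul c (T v)] with p hp
      rw [map_smul, hp, Pi.smul_apply, smul_eq_mul, smul_eq_mul]
      ring)
  have hBbound : ∀ (g : TentInfty n α β) (v : V), ‖B g v‖
      ≤ ((pairingConst n α β * atomConst n α β : ℝ≥0) * tentInftyNorm n α β g.1).toReal * ‖v‖ := by
    intro g v
    have hg : tentInftyNorm n α β g.1 < ∞ := g.2
    have h1 := ENNReal.toReal_mono (ENNReal.mul_ne_top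
      (ENNReal.mul_ne_top ENNReal.coe_ne_top hg.ne) enorm_ne_top)
      (integrable_pairing hαβ hd hT v g).2
    rw [ENNReal.toReal_mul, toReal_enorm, toReal_enorm] at h1
    exact h1
  let Φ : TentInfty n α β →ₗ[ℂ] (V →L[ℂ] ℂ) :=
    { toFun := fun g => (B g).mkContinuous _ (hBbound g)
      map_add' := fun g₁ g₂ => by
        ext v
        simp
      map_smul' := fun c g => by
        ext v
        simp }
  have hΦ : ∀ (g : TentInfty n α β) (v : V),
      Φ g v = ∫ p, T v p * g.1 p / (p.1 : ℂ) ∂(halfMeasure n) := fun g v => rfl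
  have hlower : ∀ g : TentInfty n α β, tentInftyNorm n α β g.1 ≤ ‖Φ g‖ₑ := by
    intro g
    have hg : tentInftyNorm n α β g.1 < ∞ := g.2
    refine tentInftyNorm_le_enorm hαβ hd hT hsurj g.1.aestronglyMeasurable (fun x r hr => ?_)
      fun x r hr v _ _ => hΦ g v
    refine ne_top_of_le_ne_top ?_ (lintegral_tent_le_tentInftyNorm hn hd g.1 x hr)
    exact ENNReal.mul_ne_top (ENNReal.mul_ne_top (ENNReal.pow_ne_top hg.ne) (by simp)) (by simp)
  have hker : ∀ g, Φ g = 0 → g = 0 := by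
    intro g hg
    have h0 : tentInftyNorm n α β g.1 = 0 := by
      refine le_antisymm ((hlower g).trans ?_) zero_le
      refine (Φ g).opENorm_le_bound fun v => ?_
      rw [hg]
      simp
    refine Subtype.ext (AEEqFun.ext ?_)
    have hz : ∀ᵐ p ∂(halfMeasure n), g.1 p = 0 := by
      refine ae_of_forall_tent fun m => ?_
      have h1 := lintegral_tent_le_tentInftyNorm hn hd g.1 0 (r := m + 1) (by positivity)
      rw [h0, zero_pow two_ne_zero, zero_mul, zero_mul, nonpos_iff_eq_zero,
        ← restrict_halfMeasure_tent, lintegral_eq_zero_iff'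
          (f := fun p : TX n => ‖g.1 p‖ₑ ^ 2 / ENNReal.ofReal (p.1 ^ (1 + 2 * (α - β + 1))))
          ((g.1.aemeasurable.enorm.pow_const 2).div (by fun_prop)).restrict,
        Filter.EventuallyEq, ae_restrict_iff' (measurableSet_tent _)] at h1
      filter_upwards [h1] with p hp hpt
      simpa using hp hpt
    filter_upwards [hz, AEEqFun.coeFn_zero (α := TX n) (β := ℂ) (μ := halfMeasure n)] with p hp hp'
    rw [hp, Submodule.coe_zero, hp', Pi.zero_apply]
  have hinj : Function.Injective Φ := fun g₁ g₂ h =>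
    sub_eq_zero.1 (hker _ (by rw [map_sub, h, sub_self]))
  have hsurjΦ : Function.Surjective Φ := by
    intro φ
    obtain ⟨g, hgm, hgfin, hg⟩ := exists_representing_function hαβ hd hT hsurj φ
    have hmk := AEEqFun.coeFn_mk g hgm
    have hgnorm : tentInftyNorm n α β (AEEqFun.mk g hgm) < ∞ := by
      rw [tentInftyNorm_congr hmk]
      exact (tentInftyNorm_le_enorm hαβ hd hT hsurj hgm hgfin hg).trans_lt enorm_lt_top
    refine ⟨⟨AEEqFun.mk g hgm, hgnorm⟩, eq_of_forall_supported hαβ hd hT hsurj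
      fun x r hr v hsupp hfin => ?_⟩
    rw [hg x r hr v hsupp hfin, hΦ]
    refine integral_congr_ae ?_
    filter_upwards [hmk] with p hp
    simp only [hp]
  refine ⟨LinearEquiv.ofBijective Φ ⟨hinj, hsurjΦ⟩, hΦ,
    max (pairingConst n α β * atomConst n α β) 1, fun g => ⟨?_, ?_⟩⟩
  · refine ((Φ g).opENorm_le_bound fun v => (integrable_pairing hαβ hd hT v g).2).trans ?_
    gcongr
    exact le_max_left _ _
  · refine (hlower g).trans (le_mul_of_one_le_left zero_le ?_)
    exact_mod_cast le_max_right _ _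

end Representation

/-! ### Assembly of the theorem -/

theorem tentOne_normedSpaceCore {n : ℕ} {α β : ℝ} (hαβ : 0 ≤ α + β - 1)
    (hd : 0 < (n : ℝ) - 2 * (α + β - 1)) : NormedSpace.Core ℂ (TentOne n α β) := by
  have hfin : ∀ f : TentOne n α β, atomicNorm n α β f.1 ≠ ∞ := fun f =>
    ((tentOneNorm_lt_top_iff_atomicNorm_lt_top hαβ hd f.1.aestronglyMeasurable).1 f.2).ne
  refine { norm_nonneg := fun f => ENNReal.toReal_nonneg, norm_smul := ?_, norm_triangle := ?_,
           norm_eq_zero_iff := ?_ }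
  · intro c f
    change (atomicNorm n α β (c • f : TentOne n α β).1).toReal = ‖c‖ * (atomicNorm n α β f.1).toReal
    rw [atomicNorm_smul c (f := f.1), ENNReal.toReal_mul, toReal_enorm]
    filter_upwards [AEEqFun.coeFn_smul c f.1] with p hp
    rw [Submodule.coe_smul, hp, Pi.smul_apply, smul_eq_mul]
  · intro f g
    change (atomicNorm n α β (f + g : TentOne n α β).1).toReal
      ≤ (atomicNorm n α β f.1).toReal + (atomicNorm n α β g.1).toReal
    rw [← ENNReal.toReal_add (hfin f) (hfin g)]
    refine ENNReal.toReal_mono (ENNReal.add_ne_top.2 ⟨hfin f, hfin g⟩)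
      (atomicNorm_add_le hαβ hd ?_)
    filter_upwards [AEEqFun.coeFn_add f.1 g.1] with p hp
    rw [Submodule.coe_add, hp, Pi.add_apply]
  · intro f
    change (atomicNorm n α β f.1).toReal = 0 ↔ f = 0
    rw [ENNReal.toReal_eq_zero_iff, or_iff_left (hfin f)]
    constructor
    · intro h0
      have h1 : tentOneNorm n α β f.1 = 0 := by
        have := tentOneNorm_le_atomicNorm hαβ hd (f.1 : TX n → ℂ)
        simpa [h0] using this
      refine Subtype.ext (AEEqFun.ext ?_)
      filter_upwards [ae_eq_zero_of_tentOneNorm_eq_zero hαβ hd f.1.aestronglyMeasurable h1,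
        AEEqFun.coeFn_zero (α := TX n) (β := ℂ) (μ := halfMeasure n)] with p hp hp'
      rw [hp, Submodule.coe_zero, hp', Pi.zero_apply]
    · rintro rfl
      rw [Submodule.coe_zero, atomicNorm_congr AEEqFun.coeFn_zero, atomicNorm_zero]

/-- Each remainder is again an atomic series, with the tail of the coefficients, so its `T¹`-norm
tends to zero. -/
theorem exists_sum_of_atoms {n : ℕ} {α β : ℝ} (hαβ : 0 ≤ α + β - 1)
    (hd : 0 < (n : ℝ) - 2 * (α + β - 1)) {c : ℕ → ℂ} {a : ℕ → TX n → ℂ}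
    (hc : Summable fun j => ‖c j‖) (ha : ∀ j, IsTentAtom n α β (a j)) :
    ∃ f ∈ TentOne n α β, IsAtomicDecomposition n α β f c a ∧
      Tendsto (fun N => tentOneNorm n α β
        fun p => f p - ∑ j ∈ Finset.range N, c j * a j p) atTop (𝓝 0) := by
  have hm : AEMeasurable (fun p => ∑' j, c j * a j p) (halfMeasure n) :=
    AEMeasurable.tsum fun j => ((ha j).1.const_mul _).aemeasurable
  have hdec : IsAtomicDecomposition n α β (AEEqFun.mk _ hm.aestronglyMeasurable) c a := by
    refine ⟨hc, ha, ?_⟩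
    filter_upwards [ae_summable_of_forall_atom hαβ hd hc ha,
      AEEqFun.coeFn_mk _ hm.aestronglyMeasurable] with p hp hp'
    rw [hp']
    exact hp.of_norm.hasSum
  refine ⟨_, (tentOneNorm_lt_top_iff_exists_decomposition hαβ hd
    (AEEqFun.aestronglyMeasurable _)).2 ⟨c, a, hdec⟩, hdec, ?_⟩
  have hlim : Tendsto (fun N => (atomConst n α β : ℝ≥0∞) * ∑' j, ‖c (j + N)‖ₑ) atTop (𝓝 0) := by
    have := ENNReal.Tendsto.const_mul (a := (atomConst n α β : ℝ≥0∞))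
      (ENNReal.tendsto_sum_nat_add _ hdec.tsum_enorm_ne_top) (Or.inr (by simp))
    simpa using this
  refine tendsto_of_tendsto_of_tendsto_of_le_of_le tendsto_const_nhds hlim (fun _ => zero_le)
    fun N => ?_
  have htail : IsAtomicDecomposition n α β
      (fun p => AEEqFun.mk _ hm.aestronglyMeasurable p - ∑ j ∈ Finset.range N, c j * a j p)
      (fun j => c (j + N)) fun j => a (j + N) := by
    refine ⟨(summable_nat_add_iff N).2 hc, fun j => ha _, ?_⟩
    filter_upwards [hdec.hasSum] with p hp
    exact (hasSum_nat_add_iff' N).2 hp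
  exact htail.tentOneNorm_le hαβ hd

theorem theorem3p3 (n : ℕ) (α β : ℝ) (hα : 0 < α) (hβ : max (1 / 2) α < β) (hβ' : β < 1)
    (hαβ : 0 ≤ α + β - 1) (hd : 0 < (n : ℝ) - 2 * (α + β - 1)) :
    -- atomic decomposition
    (∀ f : TX n →ₘ[halfMeasure n] ℂ,
      f ∈ TentOne n α β ↔ ∃ c a, IsAtomicDecomposition n α β f c a) ∧
    -- every `ℓ¹` combination of atoms converges, almost everywhere and in `T¹`
    (∀ (c : ℕ → ℂ) (a : ℕ → TX n → ℂ), (Summable fun j => ‖c j‖) →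
      (∀ j, IsTentAtom n α β (a j)) →
      ∃ f ∈ TentOne n α β, IsAtomicDecomposition n α β f c a ∧
        Tendsto (fun N => tentOneNorm n α β
          fun p => f p - ∑ j ∈ Finset.range N, c j * a j p) atTop (𝓝 0)) ∧
    -- equivalence of the norms
    (∃ C : ℝ≥0, ∀ f ∈ TentOne n α β,
      tentOneNorm n α β f ≤ C * atomicNorm n α β f ∧
      atomicNorm n α β f ≤ C * tentOneNorm n α β f) ∧
    -- the pairing inequality
    (∃ C : ℝ≥0, ∀ f ∈ TentOne n α β, ∀ g ∈ TentInfty n α β,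
      ∫⁻ p, ‖f p * g p‖ₑ / ENNReal.ofReal p.1 ∂(halfMeasure n)
        ≤ C * tentOneNorm n α β f * tentInftyNorm n α β g) ∧
    -- the atomic norm is a norm on `T¹`, `T¹` is a Banach space, and its dual is `T^∞`
    ∃ hcore : NormedSpace.Core ℂ (TentOne n α β),
      letI : NormedAddCommGroup (TentOne n α β) := NormedAddCommGroup.ofCore hcore
      letI : NormedSpace ℂ (TentOne n α β) := NormedSpace.ofCore hcore
      CompleteSpace (TentOne n α β) ∧
      ∃ Φ : TentInfty n α β ≃ₗ[ℂ] (TentOne n α β →L[ℂ] ℂ),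
        (∀ (g : TentInfty n α β) (f : TentOne n α β),
          Φ g f = ∫ p, f.1 p * g.1 p / (p.1 : ℂ) ∂(halfMeasure n)) ∧
        ∃ C : ℝ≥0, ∀ g : TentInfty n α β,
          ‖Φ g‖ₑ ≤ C * tentInftyNorm n α β g.1 ∧ tentInftyNorm n α β g.1 ≤ C * ‖Φ g‖ₑ := by

  have hm : ∀ f : TX n →ₘ[halfMeasure n] ℂ, AEStronglyMeasurable f (halfMeasure n) :=
    fun f => f.aestronglyMeasurable
  refine ⟨fun f => tentOneNorm_lt_top_iff_exists_decomposition hαβ hd (hm f),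
    fun c a hc ha => exists_sum_of_atoms hαβ hd hc ha,
    ⟨max (atomConst n α β) (decompositionConst n α β), fun f _ => ⟨?_, ?_⟩⟩,
    ⟨pairingConst n α β, fun f hf g hg =>
      lintegral_pairing_le hαβ hd (hm f) (hm g) hf hg⟩,
    tentOne_normedSpaceCore hαβ hd, ?_⟩
  · refine (tentOneNorm_le_atomicNorm hαβ hd f).trans ?_
    gcongr
    exact le_max_left _ _
  · refine (atomicNorm_le_tentOneNorm hαβ hd (hm f)).trans ?_
    gcongr
    exact le_max_right _ _
  -- The results on `V` and `T` now apply to `T¹` itself and its inclusion.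
  · let : NormedAddCommGroup (TentOne n α β) :=
      NormedAddCommGroup.ofCore (tentOne_normedSpaceCore hαβ hd)
    let : NormedSpace ℂ (TentOne n α β) := NormedSpace.ofCore (tentOne_normedSpaceCore hαβ hd)
    have hT : ∀ v : TentOne n α β, ‖v‖ₑ = atomicNorm n α β ((TentOne n α β).subtype v) := by
      intro v
      rw [← ofReal_norm]
      exact ENNReal.ofReal_toReal
        ((tentOneNorm_lt_top_iff_atomicNorm_lt_top hαβ hd (hm v.1)).1 v.2).ne
    have hsurj : ∀ f : TX n →ₘ[halfMeasure n] ℂ, atomicNorm n α β f < ∞ →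
        ∃ v, (TentOne n α β).subtype v = f := fun f hf =>
      ⟨⟨f, (tentOneNorm_lt_top_iff_atomicNorm_lt_top hαβ hd (hm f)).2 hf⟩, rfl⟩
    exact ⟨completeSpace_of_enorm_eq_atomicNorm hαβ hd hT hsurj,
      exists_duality_equiv hαβ hd hT hsurj⟩
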